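/- **Setting.** Let $k$ be a field. Formulas of multiplicative linear logic (MLL) are built from oriented atoms $(X,+),(X,-)$ with $\otimes$ and $\parr$; negation satisfies $\neg(A\otimes B)=\neg B\parr\neg A$, $\neg(A\parr B)=\neg B\otimes\neg A$, $\neg(X,x)=(X,\bar x)$. A formula $A$ has a sequence of oriented atoms, obtained by reading $A$ from left to right; negation reverses this sequence and flips the signs. A proof structure $\pi$ is a finite directed multigraph with edges labelled by formulas and vertices that are axiom, cut, $\otimes$, $\parr$ links or conclusion vertices, with the usual conditions on premises and conclusions; a proof net is a proof structure that is the translation of a sequent calculus proof of MLL (without units). $U_\pi$ is the disjoint union, over the edges of $\pi$, of the atom occurrences of their labels, and $P_\pi=k[U_\pi]$. Each link contributes generators $U-V$: at an axiom or cut link with edges labelled $A,\neg A$, $V$ is the occurrence in $\neg A$ corresponding to the occurrence $U$ in $A$; at a $\otimes$ or $\parr$ link, $U$ is an occurrence in a premise and $V$ the corresponding one in the conclusion. $I_\pi$ is the ideal generated by all of them. Write $U\sim V$ if $U-V$ or $V-U$ is such a generator, and $\approx$ for the equivalence relation generated by $\sim$. If $\pi$ is a proof net with single conclusion $A$, each class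 of $\approx$ is enumerated without repetition by a sequence, a *persistent path*, that starts at a negative atom of $A$, ends at a positive atom of $A$, and in which neighbours are related by $\sim$. Let $\mathscr P_1,\dots,\mathscr P_m$ be the persistent paths of $\pi$ in the order in which their last atoms appear in $A$. The concatenation $\mathscr P_1,\dots,\mathscr P_m$ lists $U_\pi$ in increasing order for $<_0$, and $G^{(0)}_\pi=\{V-U : U\sim V,\ U<_0V\}$. A reduction $\gamma:\pi\to\pi'$ contracts one redex. In an $a$-redex a cut link has premises $e_1,e_2$ labelled $A,\neg A$ and an axiom link has conclusions $e_2,e_3$ labelled $\neg A,A$, with $e_1\ne e_3$; the two links and the edges $e_1,e_2$ are removed, and $e_3$ now starts where $e_1$ started. In an $m$-redex a cut joins the conclusion $A\otimes B$ of a $\otimes$ link to the conclusion $\neg B\parr\neg A$ of a $\parr$ link; these three links and the two edges labelled $A\otimes B$, $\neg B\parr\neg A$ are removed, and new cut links join the premises $A,\neg A$, and the premises $B,\neg B$. So the edges of $\pi'$ are identified with edges of $\pi$, which gives $U_{\pi'}\subseteq U_\pi$ and $P_{\pi'}\subseteq P_\pi$. Let $\Gamma:\pi\to\pi'$ be a nonempty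 finite sequence of reductions between proof nets with single conclusion $A$; composing the inclusions, regard $U_{\pi'}\subseteq U_\pi$ and $P_{\pi'}\subseteq P_\pi$. Let $\mathscr Q_i$ be the subsequence of $\mathscr P_i$ of the atoms in $U_{\pi'}$. The sequence $$\mathscr Q_1,\dots,\mathscr Q_m,\ \mathscr P_1\setminus\mathscr Q_1,\dots,\mathscr P_m\setminus\mathscr Q_m$$ lists $U_\pi$ in increasing order for $<_\Gamma$. Both $<_0$ and $<_\Gamma$ also denote the lexicographic monomial orders determined by these orders of the variables. $G^{(\Gamma)}_\pi$ is the sequence of the polynomials $V-U$ with $U\sim V$, $U<_\Gamma V$, in the lexicographic order of the pairs $(V,U)$ with respect to $<_\Gamma$. **Buchberger with Early Stopping.** Division of $p$ by $(f_1,\dots,f_s)$ with early stopping: as long as $p\neq0$ and some $\mathrm{LT}(f_i)$ divides $\mathrm{LT}(p)$, replace $p$ by $p-\frac{\mathrm{LT}(p)}{\mathrm{LT}(f_i)}f_i$ for the first such $i$; return the $p$ at which this stops. The algorithm, on input $F=(f_1,\dots,f_s)$ and a monomial order $<$, starts with $G=F$, $t=s$, $B=\{(i,j):1\le i<j\le s\}$.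 While $B\ne\emptyset$, let $(i,j)$ be the lexicographically first element of $B$. If $\mathrm{LCM}(\mathrm{LM}f_i,\mathrm{LM}f_j)\ne\mathrm{LM}f_i\,\mathrm{LM}f_j$, and there is no $l\le t$ with $l\notin\{i,j\}$ such that the ordered pairs formed from $\{i,l\}$ and from $\{j,l\}$ are not in $B$ and $\mathrm{LM}f_l$ divides $\mathrm{LCM}(\mathrm{LM}f_i,\mathrm{LM}f_j)$, then divide the $S$-polynomial $S(f_i,f_j)$ by $G$ with early stopping; if the result $S$ is nonzero, increase $t$ by one, append $f_t=S/\mathrm{LC}(S)$ to $G$ and add $(1,t),\dots,(t-1,t)$ to $B$. Then remove $(i,j)$ from $B$. When $B=\emptyset$, the output is $G$, denoted $\mathbb B_{es}(F,<)$. **Theorem.** Let $\Gamma:\pi\to\pi'$ be a reduction sequence between MLL proof nets with single conclusion $A$. The persistent paths of $\pi$ and $\pi'$ exist, so that $<_\Gamma$ on $P_\pi$ and $<_0$ on $P_{\pi'}$ are defined; the set $G^{(0)}_{\pi'}$ is a minimal Gröbner basis of $I_{\pi'}$ with respect to $<_0$; the Buchberger algorithm with Early Stopping terminates on the input $(G^{(\Gamma)}_\pi,<_\Gamma)$;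 and there is an equality of sets $$G^{(0)}_{\pi'}=\mathbb B_{es}\big(G^{(\Gamma)}_\pi,<_\Gamma\big)\cap P_{\pi'} .$$ -/

import Mathlib

open MvPolynomial

namespace MLL

universe u v

/-! ### Formulas -/

/-- Formulas over the unoriented atoms `α`, in negation normal form: since negation is pushed to
the oriented atoms by `¬(A ⊗ B) = ¬B ⅋ ¬A`, `¬(A ⅋ B) = ¬B ⊗ ¬A`, `¬(X, x) = (X, x̄)`, every class of
pre-formulas has exactly one such representative. The sign `true` stands for `+`. -/
inductive Formula (α : Type u) : Type u
  | atom (X : α) (sign : Bool)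
  | tensor (A B : Formula α)
  | par (A B : Formula α)

namespace Formula

variable {α : Type u}

/-- Negation of formulas. -/
def neg : Formula α → Formula α
  | atom X s => atom X (!s)
  | tensor A B => par B.neg A.neg
  | par A B => tensor B.neg A.neg

/-- The sequence of oriented atoms of a formula. -/
def atoms : Formula α → List (α × Bool)
  | atom X s => [(X, s)]
  | tensor A B => A.atoms ++ B.atoms
  | par A B => A.atoms ++ B.atoms

end Formula

/-- Labels of the vertices of a proof structure. -/
inductive Node
  | ax
  | cut
  | tensor
  | par
  | c

/-- The two binary connectives. -/
inductive Conn
  | tensor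
  | par

/-- The label of a link that introduces a connective. -/
def Conn.node : Conn → Node
  | tensor => .tensor
  | par => .par

/-- The formula built by a connective. -/
def Conn.form {α : Type u} : Conn → Formula α → Formula α → Formula α
  | tensor => .tensor
  | par => .par

/-! ### Proof structures -/

/-- Directed multigraphs with labelled vertices and edges. The flag `isRight` orders the two
premises of a tensor or par vertex (`false` on the left one, `true` on the right one); it has no
meaning on the other edges. -/
structure ProofGraph (α : Type u) where
  V : Type
  E : Type
  source : E → V
  target : E → V
  node : V → Node
  label : E → Formula α
  isRight : E → Bool

namespace ProofGraph

variable {α : Type u} (G : ProofGraph α)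

/-- `v` is an axiom link whose conclusions are exactly the two edges `e`, `e'`. -/
structure IsAx (v : G.V) (e e' : G.E) : Prop where
  node : G.node v = .ax
  ne : e ≠ e'
  premise : ∀ d, G.target d ≠ v
  conclusion : ∀ d, G.source d = v ↔ d = e ∨ d = e'
  label : G.label e' = (G.label e).neg

/-- `v` is a cut link whose premises are exactly the two edges `e`, `e'`. -/
structure IsCut (v : G.V) (e e' : G.E) : Prop where
  node : G.node v = .cut
  ne : e ≠ e'
  premise : ∀ d, G.target d = v ↔ d = e ∨ d = e'
  conclusion : ∀ d, G.source d ≠ v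
  label : G.label e' = (G.label e).neg

/-- `v` is a tensor or par link with left premise `l`, right premise `r` and conclusion `d`. -/
structure IsBin (t : Conn) (v : G.V) (l r d : G.E) : Prop where
  node : G.node v = t.node
  ne : l ≠ r
  premise : ∀ x, G.target x = v ↔ x = l ∨ x = r
  left : G.isRight l = false
  right : G.isRight r = true
  conclusion : ∀ x, G.source x = v ↔ x = d
  label : G.label d = t.form (G.label l) (G.label r)

/-- `v` is a conclusion vertex with premise `e`. -/
structure IsConcl (v : G.V) (e : G.E) : Prop where
  node : G.node v = .c
  premise : ∀ d, G.target d = v ↔ d = e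
  conclusion : ∀ d, G.source d ≠ v

/-- The set of unoriented atoms of a graph: the disjoint union over the edges of the sets of
(occurrences of) unoriented atoms of their labels. -/
abbrev Atom : Type := Σ e : G.E, Fin (G.label e).atoms.length

/-- The sign of an atom occurrence in its formula. -/
def sign (U : G.Atom) : Bool := ((G.label U.1).atoms.get U.2).2

/-- The pairs `(U, V)` of atoms for which `U - V` is one of the generators attached to a link. Negation
reverses the sequence of atoms, so at an axiom or cut link the `i`-th atom of `A` corresponds to the
`i`-th last atom of `¬A`. At a tensor or par link the sequence of the conclusion is the concatenation
of the sequences of the premises. -/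
inductive Linked : G.Atom → G.Atom → Prop
  | ax {w : G.V} {e e' : G.E} (h : G.IsAx w e e') (i : Fin (G.label e).atoms.length)
      (j : Fin (G.label e').atoms.length) (hij : (i : ℕ) + j + 1 = (G.label e).atoms.length) :
      Linked ⟨e, i⟩ ⟨e', j⟩
  | cut {w : G.V} {e e' : G.E} (h : G.IsCut w e e') (i : Fin (G.label e).atoms.length)
      (j : Fin (G.label e').atoms.length) (hij : (i : ℕ) + j + 1 = (G.label e).atoms.length) :
      Linked ⟨e, i⟩ ⟨e', j⟩
  | left {t : Conn} {w : G.V} {l r d : G.E} (h : G.IsBin t w l r d)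
      (i : Fin (G.label l).atoms.length) (j : Fin (G.label d).atoms.length)
      (hij : (j : ℕ) = i) : Linked ⟨l, i⟩ ⟨d, j⟩
  | right {t : Conn} {w : G.V} {l r d : G.E} (h : G.IsBin t w l r d)
      (i : Fin (G.label r).atoms.length) (j : Fin (G.label d).atoms.length)
      (hij : (j : ℕ) = (G.label l).atoms.length + i) : Linked ⟨r, i⟩ ⟨d, j⟩

/-- The relation `U ∼ V`: one of `U - V`, `V - U` is a generator. -/
def Sim (U V : G.Atom) : Prop := G.Linked U V ∨ G.Linked V U

/-- The defining ideal, in the polynomial ring on the set of unoriented atoms. -/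
noncomputable def ideal (k : Type v) [Field k] : Ideal (MvPolynomial G.Atom k) :=
  Ideal.span {f | ∃ U V, G.Linked U V ∧ f = X U - X V}

/-- `e` is the only conclusion of the graph. -/
def IsSingleConclusion (e : G.E) : Prop :=
  ∀ d, G.node (G.target d) = .c ↔ d = e

/-- Isomorphisms of labelled graphs. The order of premises has to be respected at tensor and par
vertices only. -/
structure Iso (G H : ProofGraph α) where
  vert : G.V ≃ H.V
  edge : G.E ≃ H.E
  source_eq : ∀ e, H.source (edge e) = vert (G.source e)
  target_eq : ∀ e, H.target (edge e) = vert (G.target e)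
  node_eq : ∀ w, H.node (vert w) = G.node w
  label_eq : ∀ e, H.label (edge e) = G.label e
  isRight_eq : ∀ e t, G.node (G.target e) = Conn.node t → H.isRight (edge e) = G.isRight e

end ProofGraph

/-- Proof structures. -/
structure ProofStructure (α : Type u) extends ProofGraph α where
  finite_V : Finite V
  finite_E : Finite E
  ax_spec : ∀ w, node w = .ax → ∃ e e', toProofGraph.IsAx w e e'
  cut_spec : ∀ w, node w = .cut → ∃ e e', toProofGraph.IsCut w e e'
  bin_spec : ∀ t w, node w = Conn.node t → ∃ l r d, toProofGraph.IsBin t w l r d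
  concl_spec : ∀ w, node w = .c → ∃ e, toProofGraph.IsConcl w e

/-! ### Sequent calculus proofs and their translation -/

/-- Proofs of one-sided sequents in the sequent calculus of multiplicative linear logic. -/
inductive SequentProof {α : Type u} : List (Formula α) → Type u
  | ax (A : Formula α) : SequentProof [A.neg, A]
  | exch {Θ Δ : List (Formula α)} {A B : Formula α} (p : SequentProof (Θ ++ A :: B :: Δ)) :
      SequentProof (Θ ++ B :: A :: Δ)
  | cut {Θ Δ : List (Formula α)} {A : Formula α} (p : SequentProof (A :: Θ))
      (q : SequentProof (A.neg :: Δ)) : SequentProof (Θ ++ Δ)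
  | tensor {Θ Δ : List (Formula α)} {A B : Formula α} (p : SequentProof (A :: Θ))
      (q : SequentProof (B :: Δ)) : SequentProof (A.tensor B :: (Θ ++ Δ))
  | par {Θ : List (Formula α)} {A B : Formula α} (p : SequentProof (A :: B :: Θ)) :
      SequentProof (A.par B :: Θ)

namespace ProofGraph

variable {α : Type u}

/-- One axiom link (the vertex `none`) whose two conclusions, labelled `¬A` (the edge `false`) and `A`
(the edge `true`), end in two conclusion vertices. -/
def axGraph (A : Formula α) : ProofGraph α where
  V := Option Bool
  E := Bool
  source := fun _ => none
  target := fun e => some e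
  node := fun w => match w with
    | none => .ax
    | some _ => .c
  label := fun e => if e then A else A.neg
  isRight := fun _ => false

/-- Disjoint union. -/
def union (G H : ProofGraph α) : ProofGraph α where
  V := G.V ⊕ H.V
  E := G.E ⊕ H.E
  source := Sum.map G.source H.source
  target := Sum.map G.target H.target
  node := Sum.elim G.node H.node
  label := Sum.elim G.label H.label
  isRight := Sum.elim G.isRight H.isRight

/-- The vertices other than the endpoints of `a` and `b`. -/
abbrev Rest (G : ProofGraph α) (a b : G.E) : Type := {w : G.V // w ≠ G.target a ∧ w ≠ G.target b}

open Classical in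
/-- Replace the endpoints of `a` and `b` by one new vertex. -/
noncomputable def merge (G : ProofGraph α) (a b : G.E) {W : Type} (old : G.Rest a b → W) (new : W)
    (w : G.V) : W :=
  if h : w ≠ G.target a ∧ w ≠ G.target b then old ⟨w, h⟩ else new

/-- Remove the conclusion vertices at the end of `a` and `b`, and make `a` and `b` the premises of a
new cut link (the vertex `none`). -/
noncomputable def addCut (G : ProofGraph α) (a b : G.E) : ProofGraph α where
  V := Option (G.Rest a b)
  E := G.E
  source := fun e => G.merge a b some none (G.source e)
  target := fun e => G.merge a b some none (G.target e)
  node := fun w => match w with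
    | none => .cut
    | some w => G.node w
  label := G.label
  isRight := G.isRight

open Classical in
/-- Remove the conclusion vertices at the end of `a` and `b`, and make `a` and `b` the left and the
right premise of a new tensor or par link (the vertex `inr false`), whose conclusion (the edge `none`)
ends in a new conclusion vertex (the vertex `inr true`). -/
noncomputable def addBin (G : ProofGraph α) (t : Conn) (a b : G.E) : ProofGraph α where
  V := G.Rest a b ⊕ Bool
  E := Option G.E
  source := fun e => match e with
    | none => Sum.inr false
    | some e => G.merge a b Sum.inl (Sum.inr false) (G.source e)
  target := fun e => match e with
    | none => Sum.inr true
    | some e => G.merge a b Sum.inl (Sum.inr false) (G.target e)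
  node := fun w => match w with
    | Sum.inl w => G.node w.1
    | Sum.inr false => t.node
    | Sum.inr true => .c
  label := fun e => match e with
    | none => t.form (G.label a) (G.label b)
    | some e => G.label e
  isRight := fun e => match e with
    | none => false
    | some e => if e = a then false else if e = b then true else G.isRight e

end ProofGraph

open ProofGraph in
/-- The translation of sequent calculus proofs. `Translation p G es` says that `G` is the graph of the
proof `p`, where `es` lists the conclusions of `G` in the order of the formulas of the sequent. -/
inductive Translation {α : Type u} :
    {Θ : List (Formula α)} → SequentProof Θ → (G : ProofGraph α) → List G.E → Prop
  | ax (A : Formula α) :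
      Translation (SequentProof.ax A) (axGraph A) ([false, true] : List Bool)
  | exch {Θ Δ : List (Formula α)} {A B : Formula α} {p : SequentProof (Θ ++ A :: B :: Δ)}
      {G : ProofGraph α} {es ds : List G.E} {a b : G.E}
      (h : Translation p G (es ++ a :: b :: ds)) (hlen : es.length = Θ.length) :
      Translation (SequentProof.exch p) G (es ++ b :: a :: ds)
  | cut {Θ Δ : List (Formula α)} {A : Formula α} {p : SequentProof (A :: Θ)}
      {q : SequentProof (A.neg :: Δ)} {G H : ProofGraph α} {a : G.E} {es : List G.E} {b : H.E}
      {ds : List H.E} (hp : Translation p G (a :: es)) (hq : Translation q H (b :: ds)) :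
      Translation (SequentProof.cut p q) ((G.union H).addCut (Sum.inl a) (Sum.inr b))
        (es.map Sum.inl ++ ds.map Sum.inr : List (G.E ⊕ H.E))
  | tensor {Θ Δ : List (Formula α)} {A B : Formula α} {p : SequentProof (A :: Θ)}
      {q : SequentProof (B :: Δ)} {G H : ProofGraph α} {a : G.E} {es : List G.E} {b : H.E}
      {ds : List H.E} (hp : Translation p G (a :: es)) (hq : Translation q H (b :: ds)) :
      Translation (SequentProof.tensor p q)
        ((G.union H).addBin Conn.tensor (Sum.inl a) (Sum.inr b))
        (none :: (es.map (fun x => some (Sum.inl x)) ++ ds.map (fun x => some (Sum.inr x))) :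
          List (Option (G.E ⊕ H.E)))
  | par {Θ : List (Formula α)} {A B : Formula α} {p : SequentProof (A :: B :: Θ)}
      {G : ProofGraph α} {a b : G.E} {es : List G.E} (h : Translation p G (a :: b :: es)) :
      Translation (SequentProof.par p) (G.addBin Conn.par a b)
        (none :: es.map some : List (Option G.E))

/-- Proof nets: the proof structures that are (isomorphic to) the translation of a sequent calculus
proof. -/
def ProofStructure.IsProofNet {α : Type u} (π : ProofStructure α) : Prop :=
  ∃ (Θ : List (Formula α)) (p : SequentProof Θ) (G : ProofGraph α) (es : List G.E),
    Translation p G es ∧ Nonempty (ProofGraph.Iso π.toProofGraph G)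

/-! ### Reduction -/

section Reduction

variable {α : Type u}

open Classical in
/-- The reduction of an `a`-redex of `π` gives `π'`. The redex consists of a cut link `cut` with
premises `left` (labelled `A`) and `mid` (labelled `¬A`), and an axiom link `ax` with conclusions `mid`
and `right` (labelled `A`). The edge of `π'` that replaces the redex is identified with `right`; it
starts where `left` started. -/
structure AReduction (π π' : ProofStructure α) where
  cut : π.V
  ax : π.V
  left : π.E
  mid : π.E
  right : π.E
  left_ne_right : left ≠ right
  isCut : π.IsCut cut left mid
  isAx : π.IsAx ax mid right
  vert : π'.V ≃ {w : π.V // w ≠ cut ∧ w ≠ ax}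
  edge : π'.E ≃ {e : π.E // e ≠ left ∧ e ≠ mid}
  source_eq : ∀ e, (vert (π'.source e)).1 =
    if (edge e).1 = right then π.source left else π.source (edge e).1
  target_eq : ∀ e, (vert (π'.target e)).1 = π.target (edge e).1
  node_eq : ∀ w, π'.node w = π.node (vert w).1
  label_eq : ∀ e, π'.label e = π.label (edge e).1
  isRight_eq : ∀ e t, π'.node (π'.target e) = Conn.node t → π'.isRight e = π.isRight (edge e).1

open Classical in
/-- The reduction of an `m`-redex of `π` gives `π'`. The redex consists of a tensor link `tens` with
premises `a`, `b` (labelled `A`, `B`) and conclusion `ab`, a par link `parr` with premises `b'`, `a'`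
(labelled `¬B`, `¬A`) and conclusion `ba'`, and a cut link `cut` with premises `ab`, `ba'`. In `π'` the
place of `tens` is taken by a cut link with premises `a`, `a'`, and that of `parr` by a cut link with
premises `b`, `b'`. -/
structure MReduction (π π' : ProofStructure α) where
  cut : π.V
  tens : π.V
  parr : π.V
  a : π.E
  b : π.E
  b' : π.E
  a' : π.E
  ab : π.E
  ba' : π.E
  isCut : π.IsCut cut ab ba'
  isTensor : π.IsBin .tensor tens a b ab
  isPar : π.IsBin .par parr b' a' ba'
  vert : π'.V ≃ {w : π.V // w ≠ cut}
  edge : π'.E ≃ {e : π.E // e ≠ ab ∧ e ≠ ba'}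
  source_eq : ∀ e, (vert (π'.source e)).1 = π.source (edge e).1
  target_eq : ∀ e, (vert (π'.target e)).1 =
    if (edge e).1 = a' then tens else if (edge e).1 = b then parr else π.target (edge e).1
  node_eq : ∀ w, π'.node w =
    if (vert w).1 = tens ∨ (vert w).1 = parr then Node.cut else π.node (vert w).1
  label_eq : ∀ e, π'.label e = π.label (edge e).1
  isRight_eq : ∀ e t, π'.node (π'.target e) = Conn.node t → π'.isRight e = π.isRight (edge e).1

/-- A reduction `γ : π ⟶ π'`. -/
inductive Reduction (π π' : ProofStructure α)
  | a (γ : AReduction π π')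
  | m (γ : MReduction π π')

/-- The inclusion of the edges of `π'` into those of `π`. -/
def Reduction.edge {π π' : ProofStructure α} : Reduction π π' → π'.E → π.E
  | a γ, e => (γ.edge e).1
  | m γ, e => (γ.edge e).1

theorem Reduction.label_edge {π π' : ProofStructure α} (γ : Reduction π π') (e : π'.E) :
    π'.label e = π.label (γ.edge e) := by
  cases γ with
  | a γ => exact γ.label_eq e
  | m γ => exact γ.label_eq e

/-- The map on unoriented atoms that induces `T_γ : P_π' ⟶ P_π`. -/
def Reduction.atomMap {π π' : ProofStructure α} (γ : Reduction π π') (U : π'.Atom) : π.Atom :=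
  ⟨γ.edge U.1, Fin.cast (by rw [γ.label_edge U.1]) U.2⟩

/-- Nonempty sequences of reductions. -/
inductive ReductionSequence : ProofStructure α → ProofStructure α → Type (max u 1)
  | single {π π' : ProofStructure α} (γ : Reduction π π') : ReductionSequence π π'
  | cons {π ρ π' : ProofStructure α} (γ : Reduction π ρ) (Γ : ReductionSequence ρ π') :
      ReductionSequence π π'

/-- The map on unoriented atoms that induces `T_Γ`. -/
def ReductionSequence.atomMap : {π π' : ProofStructure α} → ReductionSequence π π' →
    π'.Atom → π.Atom
  | _, _, .single γ => γ.atomMap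
  | _, _, .cons γ Γ => γ.atomMap ∘ Γ.atomMap

/-- The algebra homomorphism `T_Γ : P_π' ⟶ P_π`. -/
noncomputable def ReductionSequence.T (k : Type v) [Field k] {π π' : ProofStructure α}
    (Γ : ReductionSequence π π') : MvPolynomial π'.Atom k →ₐ[k] MvPolynomial π.Atom k :=
  rename Γ.atomMap

end Reduction

/-! ### Persistent paths and orders on the variables -/

section Paths

variable {α : Type u}

/-- A persistent path of a graph with single conclusion `e`: an enumeration of a class of the
equivalence relation `≈` generated by `∼`, in which neighbours are related by `∼`, from a negative atom
of the conclusion to a positive one. -/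
structure ProofGraph.IsPersistentPath (G : ProofGraph α) (e : G.E) (P : List G.Atom) : Prop where
  nodup : P.Nodup
  eqClass : ∃ U, ∀ V, V ∈ P ↔ Relation.EqvGen G.Sim U V
  chain : P.IsChain G.Sim
  head : ∃ i, P.head? = some ⟨e, i⟩ ∧ G.sign ⟨e, i⟩ = false
  last : ∃ i, P.getLast? = some ⟨e, i⟩ ∧ G.sign ⟨e, i⟩ = true

/-- `Ps` is the list of all persistent paths, in the order in which their last atoms appear in the
conclusion `e`. -/
structure ProofGraph.IsPathList (G : ProofGraph α) (e : G.E) (Ps : List (List G.Atom)) : Prop where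
  path : ∀ P ∈ Ps, G.IsPersistentPath e P
  cover : ∀ U, ∃ P ∈ Ps, U ∈ P
  sorted : Ps.Pairwise fun P Q => ∀ i j, P.getLast? = some ⟨e, i⟩ → Q.getLast? = some ⟨e, j⟩ → i < j

/-- The variables in increasing order for `<₀`, given the list of persistent paths. -/
def order0 {σ : Type} (Ps : List (List σ)) : List σ := Ps.flatten

open Classical in
/-- The variables in increasing order for `<_Γ`, given the list of persistent paths: first the atoms
in the image of `f` (path by path), then the others (path by path). -/
noncomputable def orderGamma {σ τ : Type} (f : τ → σ) (Ps : List (List σ)) : List σ :=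
  (Ps.map fun P => P.filter (fun U => U ∈ Set.range f)).flatten ++
    (Ps.map fun P => P.filter (fun U => U ∉ Set.range f)).flatten

theorem ProofGraph.IsPathList.mem_order0 {G : ProofGraph α} {e : G.E} {Ps : List (List G.Atom)}
    (h : G.IsPathList e Ps) (U : G.Atom) : U ∈ order0 Ps := by
  obtain ⟨P, hP, hU⟩ := h.cover U
  exact List.mem_flatten.2 ⟨P, hP, hU⟩

theorem ProofGraph.IsPathList.mem_orderGamma {G : ProofGraph α} {e : G.E} {Ps : List (List G.Atom)}
    (h : G.IsPathList e Ps) {τ : Type} (f : τ → G.Atom) (U : G.Atom) : U ∈ orderGamma f Ps := by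
  classical
  obtain ⟨P, hP, hU⟩ := h.cover U
  rw [orderGamma, List.mem_append, List.mem_flatten, List.mem_flatten]
  by_cases hr : U ∈ Set.range f
  · exact Or.inl ⟨_, List.mem_map_of_mem hP, List.mem_filter.2 ⟨hU, by simpa using hr⟩⟩
  · exact Or.inr ⟨_, List.mem_map_of_mem hP, List.mem_filter.2 ⟨hU, by simpa using hr⟩⟩

open Classical in
/-- `U` is before `V` in the list `L`. -/
noncomputable def Before {σ : Type} (L : List σ) (U V : σ) : Prop := L.idxOf U < L.idxOf V

open Classical in
/-- The linear order on the variables that is dual to the order of the list `L`. -/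
@[reducible] noncomputable def revOrder {σ : Type} (L : List σ) (hL : ∀ U, U ∈ L) : LinearOrder σ :=
  LinearOrder.lift' (fun U => OrderDual.toDual (L.idxOf U)) fun U V h => by
    have h' : L.idxOf U = L.idxOf V := OrderDual.toDual.injective h
    exact (List.idxOf_inj (hL U)).1 h'

/-- The lexicographic monomial order for which the variables, in increasing order, are listed by `L`:
the last variable of `L` is the largest one. (Mathlib's `MonomialOrder.lex` makes the smallest
variable of its linear order the most significant one.) -/
noncomputable def lexOrder {σ : Type} (L : List σ) (hL : ∀ U, U ∈ L) : MonomialOrder σ :=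
  letI := revOrder L hL
  haveI : Finite σ := Finite.of_surjective (fun i : Fin L.length => L.get i)
    fun U => List.mem_iff_get.1 (hL U)
  MonomialOrder.lex

open Classical in
/-- The edges `(V, U)`, from `U` to `V`, of the oriented graph given by `U ∼ V` and `U` before `V` in
`L`. They are sorted by target and then by source, with respect to the order of `L`. -/
noncomputable def ProofGraph.edgeList (G : ProofGraph α) (L : List G.Atom) :
    List (G.Atom × G.Atom) :=
  L.flatMap fun V => (L.filter fun U => G.Sim U V ∧ Before L U V).map fun U => (V, U)

/-- The ordered set of the polynomials `V - U`, where `U ⟶ V` runs through the edges in `edgeList`. -/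
noncomputable def ProofGraph.generators (k : Type v) [Field k] (G : ProofGraph α)
    (L : List G.Atom) : List (MvPolynomial G.Atom k) :=
  (G.edgeList L).map fun p => X p.1 - X p.2

end Paths

/-! ### Gröbner bases and the Buchberger algorithm with early stopping -/

section Buchberger

variable {σ : Type} {k : Type v} [Field k]

/-- `B` is a minimal Gröbner basis of the ideal `I`: a finite subset of `I` whose leading terms generate
the ideal of leading terms of `I`, with leading coefficients `1`, such that no leading term lies in the
ideal generated by the other leading terms. -/
structure IsMinimalGroebnerBasis (m : MonomialOrder σ) (I : Ideal (MvPolynomial σ k))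
    (B : Set (MvPolynomial σ k)) : Prop where
  finite : B.Finite
  subset : ∀ g ∈ B, g ∈ I
  span_eq : Ideal.span (m.leadingTerm '' B) =
    Ideal.span (m.leadingTerm '' (I : Set (MvPolynomial σ k)))
  monic : ∀ g ∈ B, m.leadingCoeff g = 1
  minimal : ∀ g ∈ B, m.leadingTerm g ∉ Ideal.span (m.leadingTerm '' (B \ {g}))

/-- `c x^d / LT(g)`, where `x^d` is a multiple of the leading monomial of `g`. -/
noncomputable def termDiv (m : MonomialOrder σ) (d : σ →₀ ℕ) (c : k) (g : MvPolynomial σ k) :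
    MvPolynomial σ k :=
  monomial (d - m.degree g) (c / m.leadingCoeff g)

/-- The `S`-polynomial `(x^γ / LT(g)) g - (x^γ / LT(h)) h`, where `x^γ` is the least common multiple of
the leading monomials. -/
noncomputable def sPoly (m : MonomialOrder σ) (g h : MvPolynomial σ k) : MvPolynomial σ k :=
  termDiv m (m.degree g ⊔ m.degree h) 1 g * g - termDiv m (m.degree g ⊔ m.degree h) 1 h * h

open Classical in
/-- Euclidean division with early stopping by the sequence `F`: started at the polynomial `p`, the
algorithm stops and returns the remainder `r`. As long as the leading term of `p` is divisible by that
of some element of `F`, the first such element is used. As soon as there is none, `p` is returned. -/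
inductive DivES (m : MonomialOrder σ) (F : List (MvPolynomial σ k)) :
    MvPolynomial σ k → MvPolynomial σ k → Prop
  | zero : DivES m F 0 0
  | step {p f r : MvPolynomial σ k} (hp : p ≠ 0)
      (hf : F.find? (fun f => m.leadingTerm f ∣ m.leadingTerm p) = some f)
      (h : DivES m F (p - termDiv m (m.degree p) (m.leadingCoeff p) f * f) r) : DivES m F p r
  | halt {p : MvPolynomial σ k} (hp : p ≠ 0)
      (hF : ∀ f ∈ F, ¬ m.leadingTerm f ∣ m.leadingTerm p) : DivES m F p p

/-- The pair `[i, j]`, with the smaller index first. -/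
def sortedPair (i j : ℕ) : ℕ × ℕ := (min i j, max i j)

/-- The criterion that allows the pair `(i, j)` to be skipped: for some `l ∉ {i, j}` the pairs `[i, l]`
and `[j, l]` are not in `B`, and the leading monomial of the `l`-th element divides the least common
multiple of those of the `i`-th and `j`-th one. -/
def Criterion (m : MonomialOrder σ) (F : List (MvPolynomial σ k)) (B : Finset (ℕ × ℕ)) (i j : ℕ) :
    Prop :=
  ∃ l < F.length, l ≠ i ∧ l ≠ j ∧ sortedPair i l ∉ B ∧ sortedPair j l ∉ B ∧
    m.degree (F.getD l 0) ≤ m.degree (F.getD i 0) ⊔ m.degree (F.getD j 0)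

/-- The test of the algorithm on the pair `(i, j)`: the leading monomials are not coprime, and the
criterion does not hold. -/
def Relevant (m : MonomialOrder σ) (F : List (MvPolynomial σ k)) (B : Finset (ℕ × ℕ)) (i j : ℕ) :
    Prop :=
  m.degree (F.getD i 0) ⊔ m.degree (F.getD j 0) ≠ m.degree (F.getD i 0) + m.degree (F.getD j 0) ∧
    ¬ Criterion m F B i j

/-- `(i, j)` is the first element of `B` in the lexicographic order. -/
def IsFirst (B : Finset (ℕ × ℕ)) (i j : ℕ) : Prop :=
  (i, j) ∈ B ∧ ∀ q ∈ B, toLex (i, j) ≤ toLex q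

/-- The main loop of the Buchberger algorithm with early stopping: started in the state `(F, B)`, the
loop stops and returns the sequence `H`. (Sequences are indexed from `0`.) -/
inductive BuchbergerLoop (m : MonomialOrder σ) :
    List (MvPolynomial σ k) → Finset (ℕ × ℕ) → List (MvPolynomial σ k) → Prop
  | done {F : List (MvPolynomial σ k)} : BuchbergerLoop m F ∅ F
  | skip {F H : List (MvPolynomial σ k)} {B : Finset (ℕ × ℕ)} {i j : ℕ} (hij : IsFirst B i j)
      (hrel : ¬ Relevant m F B i j) (h : BuchbergerLoop m F (B.erase (i, j)) H) :
      BuchbergerLoop m F B H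
  | zero {F H : List (MvPolynomial σ k)} {B : Finset (ℕ × ℕ)} {i j : ℕ} (hij : IsFirst B i j)
      (hrel : Relevant m F B i j) (hdiv : DivES m F (sPoly m (F.getD i 0) (F.getD j 0)) 0)
      (h : BuchbergerLoop m F (B.erase (i, j)) H) : BuchbergerLoop m F B H
  | add {F H : List (MvPolynomial σ k)} {B : Finset (ℕ × ℕ)} {i j : ℕ} {s : MvPolynomial σ k}
      (hij : IsFirst B i j) (hrel : Relevant m F B i j)
      (hdiv : DivES m F (sPoly m (F.getD i 0) (F.getD j 0)) s) (hs : s ≠ 0)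
      (h : BuchbergerLoop m (F ++ [C (m.leadingCoeff s)⁻¹ * s])
        ((B ∪ (Finset.range F.length).image fun l => (l, F.length)).erase (i, j)) H) :
      BuchbergerLoop m F B H

/-- The Buchberger algorithm with early stopping terminates on the input `F` with output `H`. -/
def BuchbergerES (m : MonomialOrder σ) (F H : List (MvPolynomial σ k)) : Prop :=
  BuchbergerLoop m F
    ((Finset.range F.length ×ˢ Finset.range F.length).filter fun q => q.1 < q.2) H

end Buchberger

end MLL

namespace MLL

universe u v

section Differences

variable {σ : Type} {k : Type v} [Field k] {m : MonomialOrder σ}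

/-- The order on the variables given by a monomial order. -/
def VarLt (m : MonomialOrder σ) (U V : σ) : Prop :=
  m.toSyn (Finsupp.single U 1) < m.toSyn (Finsupp.single V 1)

theorem VarLt.asymm {U V : σ} (h : VarLt m U V) : ¬ VarLt m V U := lt_asymm h

theorem VarLt.ne {U V : σ} (h : VarLt m U V) : U ≠ V := by
  rintro rfl
  exact lt_irrefl _ h

theorem varLt_lexOrder {L : List σ} (hL : ∀ U, U ∈ L) {U V : σ} :
    VarLt (lexOrder L hL) U V ↔ Before L U V := by
  let := revOrder L hL
  have : Finite σ := Finite.of_surjective (fun i : Fin L.length => L.get i)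
    fun U => List.mem_iff_get.1 (hL U)
  change (toLex (Finsupp.single U 1) : Lex (σ →₀ ℕ)) < toLex (Finsupp.single V 1) ↔ _
  rw [Finsupp.Lex.single_lt_iff]
  rfl

theorem degree_X_sub_X {U V : σ} (h : VarLt m U V) :
    m.degree (X V - X U : MvPolynomial σ k) = Finsupp.single V 1 := by
  rw [m.degree_sub_of_lt, m.degree_X]
  rw [m.degree_X, m.degree_X]
  exact h

theorem leadingCoeff_X_sub_X {U V : σ} (h : VarLt m U V) :
    m.leadingCoeff (X V - X U : MvPolynomial σ k) = 1 := by
  rw [m.leadingCoeff_sub_of_lt, m.leadingCoeff_X]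
  rw [m.degree_X, m.degree_X]
  exact h

theorem leadingTerm_X_sub_X {U V : σ} (h : VarLt m U V) :
    m.leadingTerm (X V - X U : MvPolynomial σ k) = X V := by
  rw [MonomialOrder.leadingTerm, degree_X_sub_X h, leadingCoeff_X_sub_X h]
  rfl

theorem X_sub_X_ne_zero {U V : σ} (h : VarLt m U V) : (X V - X U : MvPolynomial σ k) ≠ 0 :=
  sub_ne_zero.2 fun h' => h.ne (X_injective h').symm

theorem degree_C_mul_X_sub_X {U V : σ} (h : VarLt m U V) {c : k} (hc : c ≠ 0) :
    m.degree (C c * (X V - X U) : MvPolynomial σ k) = Finsupp.single V 1 := by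
  rw [m.degree_mul (by simpa using hc) (X_sub_X_ne_zero h), m.degree_C, zero_add, degree_X_sub_X h]

theorem leadingCoeff_C_mul_X_sub_X {U V : σ} (h : VarLt m U V) (c : k) :
    m.leadingCoeff (C c * (X V - X U) : MvPolynomial σ k) = c := by
  rw [m.leadingCoeff_mul, m.leadingCoeff_C, leadingCoeff_X_sub_X h, mul_one]

theorem leadingTerm_dvd_iff {U V a b : σ} (h : VarLt m U V) (h' : VarLt m b a) {c : k}
    (hc : c ≠ 0) :
    m.leadingTerm (X V - X U : MvPolynomial σ k) ∣ m.leadingTerm (C c * (X a - X b)) ↔ V = a := by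
  classical
  rw [leadingTerm_X_sub_X h, MonomialOrder.leadingTerm, degree_C_mul_X_sub_X h' hc,
    leadingCoeff_C_mul_X_sub_X h', X_dvd_monomial, Finsupp.single_apply]
  simp [hc, eq_comm]

/-- The differences of variables given by a list of pairs. -/
noncomputable def diffs (k : Type v) [Field k] (E : List (σ × σ)) : List (MvPolynomial σ k) :=
  E.map fun p => X p.1 - X p.2

theorem DivES.unique {F : List (MvPolynomial σ k)} {p r s : MvPolynomial σ k}
    (hr : DivES m F p r) (hs : DivES m F p s) : r = s := by
  induction hr with
  | zero =>
    cases hs with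
    | zero => rfl
    | step hp => exact absurd rfl hp
    | halt hp => rfl
  | step hp hf h ih =>
    cases hs with
    | zero => exact absurd rfl hp
    | step hp' hf' h' =>
      rw [hf] at hf'
      cases hf'
      exact ih h'
    | halt hp' hF =>
      exact absurd (by simpa using List.find?_some hf) (hF _ (List.mem_of_find?_eq_some hf))
  | halt hp hF =>
    cases hs with
    | zero => rfl
    | step hp' hf' h' =>
      exact absurd (by simpa using List.find?_some hf') (hF _ (List.mem_of_find?_eq_some hf'))
    | halt => rfl

theorem DivES.halt_sub {E : List (σ × σ)} (hE : ∀ p ∈ E, VarLt m p.2 p.1) {a b : σ}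
    (hab : VarLt m b a) {c : k} (hc : c ≠ 0) (ha : ∀ u, (a, u) ∉ E) :
    DivES m (diffs k E) (C c * (X a - X b)) (C c * (X a - X b)) := by
  refine .halt (mul_ne_zero (by simpa using hc) (X_sub_X_ne_zero hab)) fun f hf => ?_
  obtain ⟨⟨V, U⟩, hp, rfl⟩ := List.mem_map.1 hf
  rw [leadingTerm_dvd_iff (hE _ hp) hab hc]
  rintro rfl
  exact ha _ hp

theorem DivES.step_sub {E : List (σ × σ)} (hE : ∀ p ∈ E, VarLt m p.2 p.1) {a b u : σ}
    (hab : VarLt m b a) {c : k} (hc : c ≠ 0) (hu : (a, u) ∈ E) (huu : ∀ u', (a, u') ∈ E → u' = u)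
    {r : MvPolynomial σ k} (h : DivES m (diffs k E) (C c * (X u - X b)) r) :
    DivES m (diffs k E) (C c * (X a - X b)) r := by
  classical
  have hne : (C c * (X a - X b) : MvPolynomial σ k) ≠ 0 :=
    mul_ne_zero (by simpa using hc) (X_sub_X_ne_zero hab)
  have hau : VarLt m u a := hE _ hu
  cases hfind : (diffs k E).find? (fun f => m.leadingTerm f ∣ m.leadingTerm (C c * (X a - X b))) with
  | none =>
    have := List.find?_eq_none.1 hfind (X a - X u) (List.mem_map.2 ⟨_, hu, rfl⟩)
    rw [decide_eq_true_iff, leadingTerm_dvd_iff hau hab hc] at this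
    exact absurd rfl this
  | some f =>
    obtain ⟨⟨V, U⟩, hp, rfl⟩ := List.mem_map.1 (List.mem_of_find?_eq_some hfind)
    have hV := List.find?_some hfind
    rw [decide_eq_true_iff, leadingTerm_dvd_iff (hE _ hp) hab hc] at hV
    dsimp only at hV
    subst hV
    obtain rfl := huu _ hp
    convert DivES.step hne (by convert hfind) ?_
    rw [termDiv, degree_X_sub_X hau, leadingCoeff_X_sub_X hau, degree_C_mul_X_sub_X hab hc,
      leadingCoeff_C_mul_X_sub_X hab, tsub_self, div_one]
    convert h using 1
    change _ - C c * _ = _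
    ring

theorem sPoly_X_sub_X {a b z : σ} (ha : VarLt m a z) (hb : VarLt m b z) :
    sPoly m (X z - X a : MvPolynomial σ k) (X z - X b) = X b - X a := by
  rw [sPoly, termDiv, termDiv, degree_X_sub_X ha, degree_X_sub_X hb, leadingCoeff_X_sub_X ha,
    leadingCoeff_X_sub_X hb, sup_idem, tsub_self, div_one]
  change C 1 * _ - C 1 * _ = _
  rw [C_1]
  ring

theorem IsFirst.unique {B : Finset (ℕ × ℕ)} {i j i' j' : ℕ} (h : IsFirst B i j)
    (h' : IsFirst B i' j') : i = i' ∧ j = j' := by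
  have := toLex.injective (le_antisymm (h.2 _ h'.1) (h'.2 _ h.1))
  simpa using this

theorem IsFirst.exists {B : Finset (ℕ × ℕ)} (hB : B.Nonempty) : ∃ i j, IsFirst B i j := by
  obtain ⟨q, hq, h⟩ := B.exists_min_image toLex hB
  exact ⟨q.1, q.2, hq, h⟩

theorem BuchbergerLoop.unique {F H H' : List (MvPolynomial σ k)} {B : Finset (ℕ × ℕ)}
    (h : BuchbergerLoop m F B H) (h' : BuchbergerLoop m F B H') : H = H' := by
  induction h with
  | done =>
    cases h' with
    | done => rfl
    | skip hij => simp [IsFirst] at hij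
    | zero hij => simp [IsFirst] at hij
    | add hij => simp [IsFirst] at hij
  | skip hij hrel h ih =>
    cases h' with
    | done => simp [IsFirst] at hij
    | skip hij' hrel' h' =>
      obtain ⟨rfl, rfl⟩ := hij.unique hij'
      exact ih h'
    | zero hij' hrel' =>
      obtain ⟨rfl, rfl⟩ := hij.unique hij'
      exact absurd hrel' hrel
    | add hij' hrel' =>
      obtain ⟨rfl, rfl⟩ := hij.unique hij'
      exact absurd hrel' hrel
  | zero hij hrel hdiv h ih =>
    cases h' with
    | done => simp [IsFirst] at hij
    | skip hij' hrel' h' =>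
      obtain ⟨rfl, rfl⟩ := hij.unique hij'
      exact absurd hrel hrel'
    | zero hij' hrel' hdiv' h' =>
      obtain ⟨rfl, rfl⟩ := hij.unique hij'
      exact ih h'
    | add hij' hrel' hdiv' hs' =>
      obtain ⟨rfl, rfl⟩ := hij.unique hij'
      exact absurd (hdiv'.unique hdiv) hs'
  | add hij hrel hdiv hs h ih =>
    cases h' with
    | done => simp [IsFirst] at hij
    | skip hij' hrel' h' =>
      obtain ⟨rfl, rfl⟩ := hij.unique hij'
      exact absurd hrel hrel'
    | zero hij' hrel' hdiv' h' =>
      obtain ⟨rfl, rfl⟩ := hij.unique hij'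
      exact absurd (hdiv.unique hdiv') hs
    | add hij' hrel' hdiv' hs' h' =>
      obtain ⟨rfl, rfl⟩ := hij.unique hij'
      obtain rfl := hdiv.unique hdiv'
      exact ih h'

end Differences

section Minimal

variable {σ : Type} {k : Type v} [Field k] {m : MonomialOrder σ}

/-- Differences of variables along a functional decreasing relation are a minimal Gröbner basis. -/
theorem isMinimalGroebnerBasis_differences [Finite σ] (R : σ → σ → Prop)
    (hlt : ∀ U V, R U V → VarLt m U V) (hco : ∀ U U' V, R U V → R U' V → U = U')
    (I : Ideal (MvPolynomial σ k)) (B : Set (MvPolynomial σ k))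
    (hB : ∀ g, g ∈ B ↔ ∃ U V, R U V ∧ g = X V - X U) (hI : I = Ideal.span B) :
    IsMinimalGroebnerBasis m I B := by
  classical
  have hlead : ∀ g ∈ B, ∃ U V, R U V ∧ g = X V - X U ∧ m.leadingTerm g = X V := by
    intro g hg
    obtain ⟨U, V, h, rfl⟩ := (hB g).1 hg
    exact ⟨U, V, h, rfl, leadingTerm_X_sub_X (hlt _ _ h)⟩
  have hmonic : ∀ g ∈ B, m.leadingCoeff g = 1 := by
    intro g hg
    obtain ⟨U, V, h, rfl⟩ := (hB g).1 hg
    exact leadingCoeff_X_sub_X (hlt _ _ h)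
  have hsub : ∀ g ∈ B, g ∈ I := fun g hg => hI ▸ Ideal.subset_span hg
  refine ⟨?_, hsub, ?_, hmonic, ?_⟩
  · refine (Set.finite_range fun p : σ × σ => (X p.2 - X p.1 : MvPolynomial σ k)).subset ?_
    intro g hg
    obtain ⟨U, V, h, rfl⟩ := (hB g).1 hg
    exact ⟨(U, V), rfl⟩
  · apply le_antisymm (Ideal.span_mono (Set.image_mono hsub))
    -- every variable has a source, reached by a chain for `R`
    have hwf : WellFounded (VarLt m) := InvImage.wf _ (wellFounded_lt (α := m.syn))
    have hsource : ∃ φ : σ → σ, (∀ U V, R U V → φ U = φ V) ∧ ∀ V, (¬ ∃ U, R U V) → φ V = V := by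
      have : ∀ V, ∃ S, Relation.ReflTransGen R S V ∧ ¬ ∃ U, R U S := by
        intro V
        induction V using hwf.induction with
        | _ V ih =>
          by_cases h : ∃ U, R U V
          · obtain ⟨U, hU⟩ := h
            obtain ⟨S, hS, hS'⟩ := ih U (hlt _ _ hU)
            exact ⟨S, hS.tail hU, hS'⟩
          · exact ⟨V, .refl, h⟩
      choose φ hφ hφ' using this
      have huniq : ∀ V S, Relation.ReflTransGen R S V → (¬ ∃ U, R U S) → S = φ V := by
        intro V
        induction V using hwf.induction with
        | _ V ih =>
          intro S hS hS'
          rcases hS.cases_tail with rfl | ⟨U, hSU, hUV⟩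
          · rcases (hφ V).cases_tail with h | ⟨U, -, hUV⟩
            · exact h
            · exact absurd ⟨U, hUV⟩ hS'
          · rcases (hφ V).cases_tail with h | ⟨U', hSU', hUV'⟩
            · exact absurd ⟨U, h ▸ hUV⟩ (hφ' V)
            · obtain rfl := hco _ _ _ hUV hUV'
              rw [ih U (hlt _ _ hUV) S hSU hS', ih U (hlt _ _ hUV) _ hSU' (hφ' V)]
      exact ⟨φ, fun U V h => huniq V _ ((hφ U).tail h) (hφ' U), fun V h => (huniq V V .refl h).symm⟩
    obtain ⟨φ, hφ, hφ'⟩ := hsource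
    have hker : ∀ f ∈ I, rename (R := k) φ f = 0 := by
      intro f hf
      have : I ≤ RingHom.ker (rename (R := k) φ) := by
        rw [hI, Ideal.span_le]
        intro g hg
        obtain ⟨U, V, h, rfl⟩ := (hB g).1 hg
        simp [RingHom.mem_ker, hφ _ _ h]
      exact this hf
    rw [Ideal.span_le]
    rintro _ ⟨f, hf, rfl⟩
    by_cases hf0 : f = 0
    · rw [hf0, m.leadingTerm_zero]
      exact Ideal.zero_mem _
    obtain ⟨g, r, hfr, hdeg, hr⟩ := m.div_set (B := B)
      (fun b hb => by rw [hmonic b hb]; exact isUnit_one) f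
    have hsum : Finsupp.linearCombination _ (fun b : B => (b : MvPolynomial σ k)) g ∈ I := by
      rw [Finsupp.linearCombination_apply]
      exact Ideal.sum_mem _ fun b _ => Ideal.mul_mem_left _ _ (hsub _ b.2)
    have hrI : r ∈ I := by
      have : r = f - Finsupp.linearCombination _ (fun b : B => (b : MvPolynomial σ k)) g := by
        rw [eq_sub_iff_add_eq, add_comm, ← hfr]
      rw [this]
      exact Ideal.sub_mem _ hf hsum
    have hrr : rename (R := k) φ r = r := by
      refine hom_congr_vars (f₁ := (rename (R := k) φ).toRingHom) (f₂ := RingHom.id _)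
        (by ext; simp) (fun V hV _ => ?_) rfl
      obtain ⟨d, hd, hVd⟩ := (mem_vars_iff_mem_support V).1 hV
      suffices h : φ V = V by simp [h]
      apply hφ' V
      rintro ⟨U, hU⟩
      refine hr d hd (X V - X U) ((hB _).2 ⟨U, V, hU, rfl⟩) ?_
      rw [degree_X_sub_X (hlt _ _ hU), Finsupp.single_le_iff]
      exact Nat.one_le_iff_ne_zero.2 (Finsupp.mem_support_iff.1 hVd)
    have hr0 : r = 0 := by rw [← hrr, hker r hrI]
    rw [hr0, add_zero, Finsupp.linearCombination_apply, Finsupp.sum] at hfr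
    have hcoef : f.coeff (m.degree f) ≠ 0 := m.coeff_degree_ne_zero_iff.2 hf0
    have : ∃ b : B, (g b • (b : MvPolynomial σ k)).coeff (m.degree f) ≠ 0 := by
      by_contra! hcon
      apply hcoef
      conv_lhs => rw [hfr]
      rw [coeff_sum, ← hfr]
      exact Finset.sum_eq_zero fun b _ => hcon b
    obtain ⟨b, hb⟩ := this
    obtain ⟨U, V, hUV, hbe, hbl⟩ := hlead b b.2
    rw [smul_eq_mul, mul_comm] at hb
    have hle := m.le_degree (mem_support_iff.2 hb)
    have heq : m.degree ((b : MvPolynomial σ k) * g b) = m.degree f :=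
      m.toSyn.injective (le_antisymm (hdeg b) hle)
    have hmul : (b : MvPolynomial σ k) * g b ≠ 0 := by
      intro h
      rw [h] at hb
      simp at hb
    rw [m.degree_mul (left_ne_zero_of_mul hmul) (right_ne_zero_of_mul hmul)] at heq
    have hdvd : (X V : MvPolynomial σ k) ∣ m.leadingTerm f := by
      rw [MonomialOrder.leadingTerm, X_dvd_monomial, ← heq, hbe, degree_X_sub_X (hlt _ _ hUV)]
      right
      simp
    exact Ideal.mem_of_dvd _ hdvd (Ideal.subset_span ⟨b, b.2, hbl⟩)
  · intro g hg hmem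
    obtain ⟨U, V, hUV, hge, hgl⟩ := hlead g hg
    have hsub' : m.leadingTerm '' (B \ {g}) ⊆ (X '' {W | W ≠ V} : Set (MvPolynomial σ k)) := by
      rintro _ ⟨g', ⟨hg', hne⟩, rfl⟩
      obtain ⟨U', V', hUV', hge', hgl'⟩ := hlead g' hg'
      refine ⟨V', ?_, hgl'.symm⟩
      rintro rfl
      obtain rfl := hco _ _ _ hUV hUV'
      exact hne (hge'.trans hge.symm)
    have := Ideal.span_mono hsub' hmem
    rw [hgl, mem_ideal_span_X_image] at this
    obtain ⟨W, hW, hW'⟩ := this (Finsupp.single V 1) (by simp [mem_support_iff])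
    exact hW' (Finsupp.single_eq_of_ne hW)

end Minimal

section Runs

variable {σ : Type} {k : Type v} [Field k] {m : MonomialOrder σ} {R : σ → σ → Prop} {K : σ → Prop}

/-- `z` is reached from `q` by steps of `R` that end outside `K`. -/
def Reach (R : σ → σ → Prop) (K : σ → Prop) : σ → σ → Prop :=
  Relation.ReflTransGen fun y z => R y z ∧ ¬ K z

/-- `q'` is reached from `q` by a nonempty sequence of steps of `R` with all intermediate elements
outside `K`. -/
def Hop (R : σ → σ → Prop) (K : σ → Prop) (q q' : σ) : Prop := ∃ z, Reach R K q z ∧ R z q'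

/-- A maximal sequence of elements outside `K`, with last element `z`, between `q` and `q'`. -/
structure IsRun (R : σ → σ → Prop) (K : σ → Prop) (q z q' : σ) : Prop where
  left : K q
  right : K q'
  last : ¬ K z
  reach : Reach R K q z
  step : R z q'

/-- Compatibility of a monomial order with the paths formed by `R` and the set `K`: along the paths,
the elements of `K` and those outside `K` increase, and the elements of `K` are smaller than the
others. -/
structure PathOrder (m : MonomialOrder σ) (R : σ → σ → Prop) (K : σ → Prop) : Prop where
  right_unique : ∀ {U V V'}, R U V → R U V' → V = V'
  left_unique : ∀ {U U' V}, R U V → R U' V → U = U'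
  lt_kept : ∀ {U V}, K U → K V → Hop R K U V → VarLt m U V
  lt_removed : ∀ {U V}, ¬ K U → ¬ K V → R U V → VarLt m U V
  lt_of_kept : ∀ {U V}, K U → ¬ K V → VarLt m U V
  exists_pred : ∀ {V}, ¬ K V → ∃ U, R U V

theorem Reach.unique (h : PathOrder m R K) {q q' z : σ} (hq : K q) (hq' : K q')
    (hz : Reach R K q z) (hz' : Reach R K q' z) : q = q' := by
  induction hz with
  | refl =>
    rcases hz'.cases_tail with h' | ⟨y, -, -, hy⟩
    · exact h'
    · exact absurd hq hy
  | tail hy hyz ih =>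
    rcases hz'.cases_tail with h' | ⟨y', hy', hy'z, -⟩
    · exact absurd (h' ▸ hq') hyz.2
    · obtain rfl := h.left_unique hyz.1 hy'z
      exact ih hy'

theorem Hop.unique (h : PathOrder m R K) {q q₁ q₂ : σ} (h₁ : K q₁) (h₂ : K q₂)
    (H₁ : Hop R K q q₁) (H₂ : Hop R K q q₂) : q₁ = q₂ := by
  obtain ⟨z, hz, hz₁⟩ := H₁
  induction hz using Relation.ReflTransGen.head_induction_on with
  | refl =>
    obtain ⟨w, hw, hw₂⟩ := H₂
    rcases hw.cases_head with rfl | ⟨y, ⟨hy, hyK⟩, -⟩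
    · exact h.right_unique hz₁ hw₂
    · exact absurd h₁ (h.right_unique hz₁ hy ▸ hyK)
  | head hy hyz ih =>
    apply ih
    obtain ⟨w, hw, hw₂⟩ := H₂
    rcases hw.cases_head with rfl | ⟨y, ⟨hy', -⟩, hyw⟩
    · exact absurd h₂ (h.right_unique hy.1 hw₂ ▸ hy.2)
    · exact ⟨w, h.right_unique hy.1 hy' ▸ hyw, hw₂⟩

theorem PathOrder.exists_reach (h : PathOrder m R K) (z : σ) (hz : ¬ K z) :
    ∃ q, K q ∧ Reach R K q z := by
  have hwf : WellFounded (VarLt m) := InvImage.wf _ (wellFounded_lt (α := m.syn))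
  induction z using hwf.induction with
  | _ z ih =>
    obtain ⟨y, hy⟩ := h.exists_pred hz
    by_cases hK : K y
    · exact ⟨y, hK, .single ⟨hy, hz⟩⟩
    · obtain ⟨q, hq, hqy⟩ := ih y (h.lt_removed hK hz hy) hK
      exact ⟨q, hq, hqy.tail ⟨hy, hz⟩⟩

theorem PathOrder.lt_of_step (h : PathOrder m R K) {U V : σ} (hR : R U V) (hV : ¬ K V) :
    VarLt m U V := by
  by_cases hU : K U
  · exact h.lt_of_kept hU hV
  · exact h.lt_removed hU hV hR

theorem IsRun.lt (h : PathOrder m R K) {q z q' : σ} (hr : IsRun R K q z q') : VarLt m q q' :=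
  h.lt_kept hr.left hr.right ⟨z, hr.reach, hr.step⟩

/-- The list `E` consists of the pairs `(V, U)` with `U < V` that are neighbours for `R`. -/
def IsEdgeList (m : MonomialOrder σ) (R : σ → σ → Prop) (E : List (σ × σ)) : Prop :=
  ∀ V U, (V, U) ∈ E ↔ (R U V ∨ R V U) ∧ VarLt m U V

section EdgeList

variable {E : List (σ × σ)}

theorem IsEdgeList.step_of_kept (hE : IsEdgeList m R E) (h : PathOrder m R K) {V U : σ}
    (hV : K V) (hVU : (V, U) ∈ E) : K U ∧ R U V := by
  obtain ⟨hR, hlt⟩ := (hE V U).1 hVU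
  have hU : K U := by
    by_contra hU
    exact hlt.asymm (h.lt_of_kept hV hU)
  refine ⟨hU, hR.resolve_right fun hR' => hlt.asymm (h.lt_kept hV hU ⟨V, .refl, hR'⟩)⟩

theorem IsEdgeList.step_of_removed (hE : IsEdgeList m R E) (h : PathOrder m R K) {V U : σ}
    (hV : ¬ K V) (hVU : (V, U) ∈ E) : R U V ∨ (K U ∧ R V U) := by
  obtain ⟨hR, hlt⟩ := (hE V U).1 hVU
  refine hR.imp_right fun hR => ⟨?_, hR⟩
  by_contra hU
  exact hlt.asymm (h.lt_removed hV hU hR)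

theorem divES_run (h : PathOrder m R K) {E' : List (σ × σ)} (hE : IsEdgeList m R E)
    (hlt : ∀ p ∈ E', VarLt m p.2 p.1) (hE' : ∀ z, ¬ K z → ∀ u, (z, u) ∈ E' ↔ (z, u) ∈ E)
    {q z w q' : σ} (hq' : K q') (hqq' : VarLt m q q') (hq'E : ∀ u, (q', u) ∉ E')
    (hz : Reach R K q z) (hzw : R z w) (hw : ¬ K w) {c : k} (hc : c ≠ 0) :
    DivES m (diffs k E') (C c * (X z - X q')) (C (-c) * (X q' - X q)) := by
  induction hz generalizing w with
  | refl =>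
    have : (C c * (X q - X q') : MvPolynomial σ k) = C (-c) * (X q' - X q) := by
      rw [C_neg]; ring
    rw [this]
    exact DivES.halt_sub hlt hqq' (neg_ne_zero.2 hc) hq'E
  | @tail y z hy hyz ih =>
    refine DivES.step_sub hlt (h.lt_of_kept hq' hyz.2) hc
      ((hE' z hyz.2 y).2 ((hE z y).2 ⟨.inl hyz.1, h.lt_of_step hyz.1 hyz.2⟩)) ?_ (ih hyz.1 hyz.2)
    intro u hu
    rcases hE.step_of_removed h hyz.2 ((hE' z hyz.2 u).1 hu) with hu | ⟨hu, hzu⟩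
    · exact h.left_unique hu hyz.1
    · exact absurd hu (h.right_unique hzw hzu ▸ hw)

/-- Properties of the part added to `E` by the algorithm. -/
structure IsAdded (R : σ → σ → Prop) (K : σ → Prop) (A : List (σ × σ)) : Prop where
  nodup : A.Nodup
  run : ∀ p ∈ A, ∃ z, IsRun R K p.2 z p.1

variable {A : List (σ × σ)}

theorem IsAdded.lt (hA : IsAdded R K A) (h : PathOrder m R K) (hE : IsEdgeList m R E) :
    ∀ p ∈ E ++ A, VarLt m p.2 p.1 := by
  intro p hp
  rcases List.mem_append.1 hp with hp | hp
  · exact ((hE _ _).1 hp).2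
  · obtain ⟨z, hz⟩ := hA.run p hp
    exact hz.lt h

theorem IsAdded.mem_iff_of_removed (hA : IsAdded R K A) {z u : σ} (hz : ¬ K z) :
    (z, u) ∈ E ++ A ↔ (z, u) ∈ E := by
  rw [List.mem_append, or_iff_left]
  intro hp
  obtain ⟨z', hz'⟩ := hA.run _ hp
  exact hz hz'.right

theorem IsAdded.eq_of_kept (hA : IsAdded R K A) (h : PathOrder m R K) (hE : IsEdgeList m R E)
    {z u u' : σ} (hz : K z) (hu : (z, u) ∈ E ++ A) (hu' : (z, u') ∈ E ++ A) : u = u' := by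
  rcases List.mem_append.1 hu with hu | hu <;> rcases List.mem_append.1 hu' with hu' | hu'
  · exact h.left_unique (hE.step_of_kept h hz hu).2 (hE.step_of_kept h hz hu').2
  · obtain ⟨y, hy⟩ := hA.run _ hu'
    obtain ⟨hK, hR⟩ := hE.step_of_kept h hz hu
    exact absurd hK (h.left_unique hy.step hR ▸ hy.last)
  · obtain ⟨y, hy⟩ := hA.run _ hu
    obtain ⟨hK, hR⟩ := hE.step_of_kept h hz hu'
    exact absurd hK (h.left_unique hy.step hR ▸ hy.last)
  · obtain ⟨y, hy⟩ := hA.run _ hu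
    obtain ⟨y', hy'⟩ := hA.run _ hu'
    obtain rfl := h.left_unique hy.step hy'.step
    exact hy.reach.unique h hy.left hy'.left hy'.reach

theorem IsAdded.nodup_append (hA : IsAdded R K A) (h : PathOrder m R K) (hE : IsEdgeList m R E)
    (hnd : E.Nodup) : (E ++ A).Nodup := by
  refine hnd.append hA.nodup fun p hp hpA => ?_
  obtain ⟨y, hy⟩ := hA.run _ hpA
  obtain ⟨hK, hR⟩ := hE.step_of_kept h hy.right hp
  exact absurd hK (h.left_unique hy.step hR ▸ hy.last)

theorem diffs_getD {i : ℕ} {p : σ × σ} (hi : E[i]? = some p) :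
    (diffs k E).getD i 0 = X p.1 - X p.2 := by
  simp [diffs, List.getD_eq_getElem?_getD, hi]

theorem getElem?_ne_of_nodup (hnd : E.Nodup) {i j : ℕ} {p q : σ × σ} (hi : E[i]? = some p)
    (hj : E[j]? = some q) (hij : i ≠ j) : p ≠ q := by
  rintro rfl
  obtain ⟨hi', hi⟩ := List.getElem?_eq_some_iff.1 hi
  obtain ⟨hj', hj⟩ := List.getElem?_eq_some_iff.1 hj
  exact hij ((hnd.getElem_inj_iff).1 (hi.trans hj.symm))

/-- Two elements with the same leading variable belong to a run. -/
theorem IsAdded.exists_run (hA : IsAdded R K A) (h : PathOrder m R K) (hE : IsEdgeList m R E)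
    {z u u' : σ} (hne : u ≠ u') (hu : (z, u) ∈ E ++ A) (hu' : (z, u') ∈ E ++ A) :
    ∃ q y q', IsRun R K q z q' ∧ R y z ∧ ((u = y ∧ u' = q') ∨ (u = q' ∧ u' = y)) := by
  have hz : ¬ K z := fun hz => hne (hA.eq_of_kept h hE hz hu hu')
  obtain ⟨q, hq, hqz⟩ := h.exists_reach z hz
  rcases hE.step_of_removed h hz ((hA.mem_iff_of_removed hz).1 hu) with h₁ | ⟨h₁, h₁'⟩ <;>
  rcases hE.step_of_removed h hz ((hA.mem_iff_of_removed hz).1 hu') with h₂ | ⟨h₂, h₂'⟩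
  · exact absurd (h.left_unique h₁ h₂) hne
  · exact ⟨q, u, u', ⟨hq, h₂, hz, hqz, h₂'⟩, h₁, .inl ⟨rfl, rfl⟩⟩
  · exact ⟨q, u', u, ⟨hq, h₁, hz, hqz, h₁'⟩, h₂, .inr ⟨rfl, rfl⟩⟩
  · exact absurd (h.right_unique h₁' h₂') hne

/-- At most two elements have the same leading variable. -/
theorem IsAdded.eq_or_eq (hA : IsAdded R K A) (h : PathOrder m R K) (hE : IsEdgeList m R E)
    {z u u' u'' : σ} (hne : u ≠ u') (hu : (z, u) ∈ E ++ A) (hu' : (z, u') ∈ E ++ A)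
    (hu'' : (z, u'') ∈ E ++ A) : u'' = u ∨ u'' = u' := by
  by_contra! hcon
  obtain ⟨q, y, q', hr, hy, h₁⟩ := hA.exists_run h hE hne hu hu'
  obtain ⟨q₂, y₂, q₂', hr₂, hy₂, h₂⟩ := hA.exists_run h hE hcon.1.symm hu hu''
  obtain rfl := h.left_unique hy hy₂
  obtain rfl := h.right_unique hr.step hr₂.step
  have := hcon.2
  rcases h₁ with ⟨rfl, rfl⟩ | ⟨rfl, rfl⟩ <;> rcases h₂ with ⟨h₂, rfl⟩ | ⟨h₂, rfl⟩ <;>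
    first | exact this rfl | exact hne h₂.symm | exact hne h₂

theorem relevant_iff (hlt : ∀ p ∈ E, VarLt m p.2 p.1) (hnd : E.Nodup)
    (htwo : ∀ z u u' u'', u ≠ u' → (z, u) ∈ E → (z, u') ∈ E → (z, u'') ∈ E → u'' = u ∨ u'' = u')
    (B : Finset (ℕ × ℕ)) {i j : ℕ} (hij : i ≠ j) {p p' : σ × σ} (hi : E[i]? = some p)
    (hj : E[j]? = some p') : Relevant m (diffs k E) B i j ↔ p.1 = p'.1 := by
  classical
  have hdeg : ∀ {l : ℕ} {q : σ × σ}, E[l]? = some q →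
      m.degree ((diffs k E).getD l 0) = Finsupp.single q.1 1 := by
    intro l q hl
    rw [diffs_getD hl, degree_X_sub_X (hlt q (List.mem_of_getElem? hl))]
  rw [Relevant, hdeg hi, hdeg hj]
  constructor
  · rintro ⟨hne, -⟩
    by_contra hpp
    apply hne
    ext x
    rw [Finsupp.sup_apply, Finsupp.add_apply, Finsupp.single_apply, Finsupp.single_apply]
    by_cases h1 : p.1 = x
    · have : p'.1 ≠ x := fun h2 => hpp (h1.trans h2.symm)
      simp [h1, this]
    · simp [h1]
  · intro hpp
    refine ⟨fun heq => ?_, ?_⟩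
    · have := DFunLike.congr_fun heq p.1
      simp [hpp] at this
    · rintro ⟨l, hl, hli, hlj, -, -, hle⟩
      rw [diffs, List.length_map] at hl
      have hl' : E[l]? = some E[l] := List.getElem?_eq_getElem hl
      rw [hdeg hi, hdeg hj, hdeg hl', ← hpp, sup_idem, Finsupp.single_le_iff] at hle
      have hz : p.1 = E[l].1 := by
        by_contra hne
        rw [Finsupp.single_eq_of_ne (Ne.symm hne)] at hle
        omega
      have hpne : p.2 ≠ p'.2 := fun h2 => getElem?_ne_of_nodup hnd hi hj hij (Prod.ext hpp h2)
      rcases htwo p.1 p.2 p'.2 E[l].2 hpne (List.mem_of_getElem? hi)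
        (by rw [hpp]; exact List.mem_of_getElem? hj) (by rw [hz]; exact List.getElem_mem hl) with h2 | h2
      · exact getElem?_ne_of_nodup hnd hl' hi hli (Prod.ext hz.symm h2)
      · exact getElem?_ne_of_nodup hnd hl' hj hlj (Prod.ext (hz.symm.trans hpp) h2)

/-- The loop of the algorithm adds exactly the differences given by the runs. -/
theorem exists_buchbergerLoop [Finite σ] (h : PathOrder m R K) (hE : IsEdgeList m R E)
    (hnd : E.Nodup) (n : ℕ) : ∀ (A : List (σ × σ)) (B : Finset (ℕ × ℕ)), IsAdded R K A →
    Nat.card {p : σ × σ // ∃ z, IsRun R K p.2 z p.1} = A.length + n →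
    (∀ p ∈ B, p.1 < p.2 ∧ p.2 < (E ++ A).length) →
    (∀ i j z u u' q q', i < j → (E ++ A)[i]? = some (z, u) → (E ++ A)[j]? = some (z, u') →
      IsRun R K q z q' → ((i, j) ∈ B ↔ (q', q) ∉ A)) →
    ∃ A', BuchbergerLoop m (diffs k (E ++ A)) B (diffs k (E ++ A')) ∧
      ∀ p, p ∈ A' ↔ ∃ z, IsRun R K p.2 z p.1 := by
  classical
  induction n using Nat.strong_induction_on with
  | _ n ihn =>
  intro A B hA hn hB hinv
  induction hb : B.card using Nat.strong_induction_on generalizing B with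
  | _ b ihb =>
  have hEA := hA.nodup_append h hE hnd
  have hlt := hA.lt h hE
  rcases B.eq_empty_or_nonempty with rfl | hne
  · refine ⟨A, .done, fun p => ⟨hA.run p, ?_⟩⟩
    rintro ⟨z, hz⟩
    by_contra hp
    obtain ⟨y, hy⟩ := h.exists_pred hz.last
    have h₁ : (z, y) ∈ E ++ A := List.mem_append_left _ ((hE _ _).2 ⟨.inl hy, h.lt_of_step hy hz.last⟩)
    have h₂ : (z, p.1) ∈ E ++ A :=
      List.mem_append_left _ ((hE _ _).2 ⟨.inr hz.step, h.lt_of_kept hz.right hz.last⟩)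
    have hyp : y ≠ p.1 := by
      rintro rfl
      rcases hz.reach.cases_tail with h' | ⟨y, hqy, hyz, -⟩
      · exact hz.last (h' ▸ hz.left)
      · obtain rfl := h.left_unique hy hyz
        rcases hqy.cases_tail with h' | ⟨x, hqx, hxy, hK⟩
        · exact (hz.lt h).ne h'.symm
        · exact hK hz.right
    obtain ⟨i, hi⟩ := List.mem_iff_getElem?.1 h₁
    obtain ⟨j, hj⟩ := List.mem_iff_getElem?.1 h₂
    have hij : i ≠ j := by
      rintro rfl
      rw [hi] at hj
      exact hyp (by simpa using hj)
    rcases lt_or_gt_of_ne hij with hij | hij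
    · simpa using (hinv i j z _ _ p.2 p.1 hij hi hj hz).2 hp
    · simpa using (hinv j i z _ _ p.2 p.1 hij hj hi hz).2 hp
  · obtain ⟨i, j, hij⟩ := IsFirst.exists hne
    obtain ⟨hij', hj'⟩ := hB _ hij.1
    dsimp only at hij' hj'
    have hi' := hij'.trans hj'
    obtain ⟨⟨z, u⟩, hi⟩ : ∃ p, (E ++ A)[i]? = some p := ⟨_, List.getElem?_eq_getElem hi'⟩
    obtain ⟨⟨z', u'⟩, hj⟩ : ∃ p, (E ++ A)[j]? = some p := ⟨_, List.getElem?_eq_getElem hj'⟩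
    have hrel := relevant_iff (k := k) hlt hEA
      (fun z u u' u'' hne hu hu' hu'' => hA.eq_or_eq h hE hne hu hu' hu'') B hij'.ne hi hj
    have hBe : ∀ p ∈ B.erase (i, j), p.1 < p.2 ∧ p.2 < (E ++ A).length :=
      fun p hp => hB p (Finset.mem_of_mem_erase hp)
    by_cases hz : z = z'
    · subst hz
      have huu : u ≠ u' := fun huu => getElem?_ne_of_nodup hEA hi hj hij'.ne (by rw [huu])
      have hmi := List.mem_of_getElem? hi
      have hmj := List.mem_of_getElem? hj
      obtain ⟨q, y, q', hr, hy, huq⟩ := hA.exists_run h hE huu hmi hmj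
      have hqA : (q', q) ∉ A := (hinv i j z u u' q q' hij' hi hj hr).1 hij.1
      have hq'E : ∀ w, (q', w) ∉ E ++ A := by
        intro w hw
        rcases List.mem_append.1 hw with hw | hw
        · obtain ⟨hK, hR⟩ := hE.step_of_kept h hr.right hw
          exact hr.last (h.left_unique hr.step hR ▸ hK)
        · obtain ⟨x, hx⟩ := hA.run _ hw
          obtain rfl := h.left_unique hx.step hr.step
          obtain rfl := hx.reach.unique h hx.left hr.left hr.reach
          exact hqA hw
      have hqy : Reach R K q y := by
        rcases hr.reach.cases_tail with h' | ⟨x, hqx, hxz, -⟩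
        · exact absurd (h' ▸ hr.left) hr.last
        · exact h.left_unique hy hxz ▸ hqx
      have hdiv : ∀ {c : k}, c ≠ 0 → _ := fun hc => divES_run (k := k) h hE hlt
        (fun z hz u => hA.mem_iff_of_removed hz) hr.right (hr.lt h) hq'E hqy hy hr.last hc
      obtain ⟨c, hc, hS⟩ : ∃ c : k, c ≠ 0 ∧ sPoly m ((diffs k (E ++ A)).getD i 0)
          ((diffs k (E ++ A)).getD j 0) = C c * (X y - X q') := by
        rw [diffs_getD hi, diffs_getD hj, sPoly_X_sub_X (z := z) (a := u) (b := u') (hlt _ hmi) (hlt _ hmj)]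
        rcases huq with ⟨rfl, rfl⟩ | ⟨rfl, rfl⟩
        · exact ⟨-1, by simp, by simp⟩
        · exact ⟨1, by simp, by simp⟩
      have hA' : IsAdded R K (A ++ [(q', q)]) := by
        refine ⟨hA.nodup.append (List.nodup_singleton _) (by simpa using hqA), fun p hp => ?_⟩
        rcases List.mem_append.1 hp with hp | hp
        · exact hA.run p hp
        · rw [List.mem_singleton.1 hp]
          exact ⟨z, hr⟩
      have hlen : A.length + 1 ≤ Nat.card {p : σ × σ // ∃ z, IsRun R K p.2 z p.1} := by
        have : Fintype {p : σ × σ // ∃ z, IsRun R K p.2 z p.1} := Fintype.ofFinite _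
        have hnd' := (hA'.nodup.pmap (f := fun p hp =>
          (⟨p, hp⟩ : {p : σ × σ // ∃ z, IsRun R K p.2 z p.1})) (H := hA'.run)
          fun a _ b _ hab => congrArg Subtype.val hab).length_le_card
        rw [Nat.card_eq_fintype_card]
        simpa using hnd'
      refine (ihn (n - 1) (by omega) (A ++ [(q', q)])
        ((B ∪ (Finset.range (diffs k (E ++ A)).length).image
          fun l => (l, (diffs k (E ++ A)).length)).erase (i, j)) hA' (by simp; omega) ?_ ?_).elim
        fun A' ⟨hA'', hA'm⟩ => ?_
      rotate_left 2
      · refine ⟨A', ?_, hA'm⟩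
        refine .add hij (hrel.2 rfl) (hS ▸ hdiv hc) ?_ ?_
        · exact mul_ne_zero (by simpa using hc) (X_sub_X_ne_zero (hr.lt h))
        · rw [leadingCoeff_C_mul_X_sub_X (hr.lt h), ← mul_assoc, ← C_mul,
            inv_mul_cancel₀ (neg_ne_zero.2 hc), C_1, one_mul]
          have : diffs k (E ++ A) ++ [X q' - X q] = diffs k (E ++ (A ++ [(q', q)])) := by
            simp [diffs]
          rw [this]
          exact hA''
      · intro p hp
        have hp' := Finset.mem_of_mem_erase hp
        rw [Finset.mem_union, Finset.mem_image] at hp'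
        rcases hp' with hp' | ⟨l, hl, rfl⟩
        · have := hB p hp'
          simp only [List.length_append, List.length_singleton] at this ⊢
          omega
        · rw [Finset.mem_range] at hl
          simp only [diffs, List.length_append, List.length_singleton, List.length_map] at hl ⊢
          omega
      · intro i₁ j₁ z₁ u₁ u₁' q₁ q₁' hij₁ hi₁ hj₁ hr₁
        have hold : ∀ {l : ℕ} {w : σ}, (E ++ (A ++ [(q', q)]))[l]? = some (z₁, w) →
            (E ++ A)[l]? = some (z₁, w) := by
          intro l w hl
          rw [← List.append_assoc, List.getElem?_append] at hl
          split_ifs at hl with hlt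
          · exact hl
          · rw [List.getElem?_singleton] at hl
            split_ifs at hl
            have : z₁ = q' := by simpa using (congrArg Prod.fst (Option.some.inj hl)).symm
            exact absurd hr.right (this ▸ hr₁.last)
        replace hi₁ := hold hi₁
        replace hj₁ := hold hj₁
        have hj₁' : j₁ < (diffs k (E ++ A)).length := by
          rw [diffs, List.length_map]
          exact (List.getElem?_eq_some_iff.1 hj₁).1
        rw [Finset.mem_erase, Finset.mem_union, or_iff_left, hinv i₁ j₁ z₁ u₁ u₁' q₁ q₁' hij₁ hi₁ hj₁ hr₁,
          List.mem_append, not_or, and_comm, List.mem_singleton]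
        · refine and_congr_right fun _ => not_congr ?_
          constructor
          · intro heq
            obtain ⟨rfl, rfl⟩ := Prod.mk.inj heq
            obtain rfl : z = z₁ := by simpa using congrArg Prod.fst (Option.some.inj (hi.symm.trans hi₁))
            obtain rfl := h.right_unique hr.step hr₁.step
            rw [hr.reach.unique h hr.left hr₁.left hr₁.reach]
          · intro heq
            obtain ⟨rfl, rfl⟩ := Prod.mk.inj heq
            obtain rfl := h.left_unique hr.step hr₁.step
            have hmem : ∀ {l : ℕ} {w : σ}, (E ++ A)[l]? = some (z, w) → l = i ∨ l = j := by
              intro l w hl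
              by_contra! hcon
              rcases hA.eq_or_eq h hE huu hmi hmj (List.mem_of_getElem? hl) with rfl | rfl
              · exact getElem?_ne_of_nodup hEA hl hi hcon.1 rfl
              · exact getElem?_ne_of_nodup hEA hl hj hcon.2 rfl
            have h1 := hmem hi₁
            have h2 := hmem hj₁
            rw [Prod.mk.injEq]
            omega
        · simp only [Finset.mem_image, Finset.mem_range, not_exists, not_and]
          intro l _ heq
          have := congrArg Prod.snd heq
          dsimp only at this
          omega
    · refine (ihb (B.erase (i, j)).card (hb ▸ Finset.card_erase_lt_of_mem hij.1)
        (B.erase (i, j)) hBe ?_ rfl).elim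
        fun A' ⟨hA', hA'm⟩ => ?_
      rotate_left
      · exact ⟨A', .skip hij (fun hr => hz (hrel.1 hr)) hA', hA'm⟩
      · intro i₁ j₁ z₁ u₁ u₁' q₁ q₁' hij₁ hi₁ hj₁ hr₁
        rw [← hinv i₁ j₁ z₁ u₁ u₁' q₁ q₁' hij₁ hi₁ hj₁ hr₁, Finset.mem_erase, and_iff_right]
        intro heq
        obtain ⟨rfl, rfl⟩ := Prod.mk.inj heq
        rw [hi] at hi₁
        rw [hj] at hj₁
        have h1 := congrArg Prod.fst (Option.some.inj hi₁)
        have h2 := congrArg Prod.fst (Option.some.inj hj₁)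
        exact hz (h1.trans h2.symm)

theorem exists_buchbergerES [Finite σ] (h : PathOrder m R K) (hE : IsEdgeList m R E)
    (hnd : E.Nodup) :
    ∃ A, BuchbergerES m (diffs k E) (diffs k (E ++ A)) ∧
      ∀ p, p ∈ A ↔ ∃ z, IsRun R K p.2 z p.1 := by
  have := exists_buchbergerLoop (k := k) h hE hnd _ []
    ((Finset.range (diffs k E).length ×ˢ Finset.range (diffs k E).length).filter
      fun q => q.1 < q.2) ⟨List.nodup_nil, by simp⟩ (by simp; rfl) ?_ ?_
  · simpa [BuchbergerES] using this
  · intro p hp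
    simp only [diffs, List.length_map, Finset.mem_filter, Finset.mem_product,
      Finset.mem_range, List.append_nil] at hp ⊢
    exact ⟨hp.2, hp.1.2⟩
  · intro i j z u u' q q' hij hi hj _
    have h1 := (List.getElem?_eq_some_iff.1 hi).1
    have h2 := (List.getElem?_eq_some_iff.1 hj).1
    simp only [List.append_nil] at h1 h2
    simp [diffs, hij, h1, h2]

end EdgeList

theorem X_sub_X_mem_range_rename {τ : Type} {f : τ → σ} {U V : σ} (hne : U ≠ V) :
    (X V - X U : MvPolynomial σ k) ∈ Set.range (rename (R := k) f) ↔
      U ∈ Set.range f ∧ V ∈ Set.range f := by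
  classical
  constructor
  · rintro ⟨p, hp⟩
    have hv : ∀ W, (X V - X U : MvPolynomial σ k).coeff (Finsupp.single W 1) ≠ 0 → W ∈ Set.range f := by
      intro W hW
      have : W ∈ (rename f p).vars := by
        rw [hp, mem_vars_iff_mem_support]
        exact ⟨_, mem_support_iff.2 hW, by simp⟩
      have := vars_rename f p this
      rw [Finset.mem_image] at this
      obtain ⟨T, -, rfl⟩ := this
      exact ⟨T, rfl⟩
    constructor
    · apply hv
      simp [coeff_X, Finsupp.single_left_inj, hne.symm]
    · apply hv
      simp [coeff_X, Finsupp.single_left_inj, hne]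
  · rintro ⟨⟨S, rfl⟩, ⟨T, rfl⟩⟩
    exact ⟨X T - X S, by simp⟩

/-- The elements of the output in the variables `K` are the differences given by `Hop`. -/
theorem mem_output_iff (h : PathOrder m R K) {E A : List (σ × σ)} (hE : IsEdgeList m R E)
    (hA : ∀ p, p ∈ A ↔ ∃ z, IsRun R K p.2 z p.1) {U V : σ} (hU : K U) (hV : K V) :
    (V, U) ∈ E ++ A ↔ Hop R K U V := by
  rw [List.mem_append, hA]
  constructor
  · rintro (hVU | ⟨z, hz⟩)
    · exact ⟨U, .refl, (hE.step_of_kept h hV hVU).2⟩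
    · exact ⟨z, hz.reach, hz.step⟩
  · rintro ⟨z, hz, hzV⟩
    by_cases hKz : K z
    · rcases hz.cases_tail with rfl | ⟨y, -, -, hK⟩
      · exact .inl ((hE _ _).2 ⟨.inl hzV, h.lt_kept hU hV ⟨_, .refl, hzV⟩⟩)
      · exact absurd hKz hK
    · exact .inr ⟨z, hU, hV, hKz, hz, hzV⟩

end Runs

/-! ### Acyclic relations -/

section Acyclic

variable {X Y I J : Type*}

/-- A relation without cycles. -/
def Acyclic (r : X → X → Prop) : Prop := ∀ x, ¬ Relation.TransGen r x x

/-- The pullback of a relation along a map. -/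
def pull (f : I → J) (r : J → J → Prop) (i j : I) : Prop := r (f i) (f j)

/-- The image of a relation under a map. -/
def push (f : I → X) (r : I → I → Prop) (x y : X) : Prop := ∃ i j, r i j ∧ x = f i ∧ y = f j

theorem Acyclic.mono {r s : X → X → Prop} (hs : Acyclic s) (h : ∀ x y, r x y → s x y) :
    Acyclic r := fun x hx => hs x (Relation.TransGen.mono h x x hx)

theorem Acyclic.of_map {r : X → X → Prop} {s : Y → Y → Prop} (f : X → Y) (hs : Acyclic s)
    (h : ∀ x y, r x y → s (f x) (f y)) : Acyclic r := fun x hx => hs (f x) (hx.lift f h)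

/-- Acyclicity can be tested after contracting the edges of a relation without paths of length `2`. -/
theorem Acyclic.of_contract {r c : X → X → Prop} {s : Y → Y → Prop} (f : X → Y) (hs : Acyclic s)
    (h : ∀ x y, r x y → s (f x) (f y) ∨ (f x = f y ∧ c x y)) (hc : ∀ x y z, c x y → ¬ c y z) :
    Acyclic r := by
  have key : ∀ x y, Relation.TransGen r x y →
      Relation.TransGen s (f x) (f y) ∨ (f x = f y ∧ c x y) := by
    intro x y hxy
    induction hxy with
    | single hxy => exact (h _ _ hxy).imp_left .single
    | @tail y z _ hyz ih =>
      rcases ih with ih | ⟨ih, ihc⟩ <;> rcases h _ _ hyz with hyz | ⟨hyz, hyzc⟩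
      · exact .inl (ih.tail hyz)
      · exact .inl (hyz ▸ ih)
      · exact .inl (ih ▸ .single hyz)
      · exact absurd hyzc (hc _ _ _ ihc)
  intro x hx
  rcases key x x hx with hx | ⟨-, hx⟩
  · exact hs _ hx
  · exact hc _ _ _ hx hx

theorem acyclic_sup_push {d : X → X → Prop} {f : I → X} (hf : Function.Injective f)
    (hd : Acyclic d) {t : I → I → Prop} (h : Acyclic (pull f (Relation.TransGen d) ⊔ t)) :
    Acyclic (d ⊔ push f t) := by
  have key : ∀ x y, Relation.TransGen (d ⊔ push f t) x y → Relation.TransGen d x y ∨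
      ∃ i j, Relation.ReflTransGen d x (f i) ∧
        Relation.TransGen (pull f (Relation.TransGen d) ⊔ t) i j ∧
        Relation.ReflTransGen d (f j) y := by
    intro x y hxy
    induction hxy with
    | single hxy =>
      rcases hxy with hxy | ⟨i, j, hij, rfl, rfl⟩
      · exact .inl (.single hxy)
      · exact .inr ⟨i, j, .refl, .single (.inr hij), .refl⟩
    | @tail y z _ hyz ih =>
      rcases ih with ih | ⟨i, j, hxi, hij, hjy⟩ <;>
      rcases hyz with hyz | ⟨i', j', hij', rfl, rfl⟩
      · exact .inl (ih.tail hyz)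
      · exact .inr ⟨i', j', ih.to_reflTransGen, .single (.inr hij'), .refl⟩
      · exact .inr ⟨i, j, hxi, hij, hjy.tail hyz⟩
      · refine .inr ⟨i, j', hxi, ?_, .refl⟩
        rcases Relation.reflTransGen_iff_eq_or_transGen.1 hjy with hjy | hjy
        · obtain rfl := hf hjy
          exact hij.tail (.inr hij')
        · exact (hij.tail (.inl hjy)).tail (.inr hij')
  intro x hx
  rcases key x x hx with hx | ⟨i, j, hxi, hij, hjx⟩
  · exact hd x hx
  · rcases Relation.reflTransGen_iff_eq_or_transGen.1 (hjx.trans hxi) with hji | hji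
    · exact h _ (hf hji ▸ hij)
    · exact h _ (hij.tail (.inl hji))

theorem acyclic_pull_sup {d : X → X → Prop} {f : I → X} {t : I → I → Prop}
    (h : Acyclic (d ⊔ push f t)) : Acyclic (pull f (Relation.TransGen d) ⊔ t) := by
  intro i hi
  refine h (f i) (Relation.TransGen.lift' f (fun i j hij => ?_) i i hi)
  rcases hij with hij | hij
  · exact Relation.TransGen.mono (fun _ _ => .inl) _ _ hij
  · exact .single (.inr ⟨i, j, hij, rfl, rfl⟩)

theorem transGen_liftRel {r : I → I → Prop} {s : J → J → Prop} {x y : I ⊕ J}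
    (h : Relation.TransGen (Sum.LiftRel r s) x y) :
    Sum.LiftRel (Relation.TransGen r) (Relation.TransGen s) x y := by
  induction h with
  | single h => exact h.mono (fun _ _ => .single) fun _ _ => .single
  | tail _ h ih =>
    cases ih with
    | inl ih => cases h with | inl h => exact .inl (ih.tail h)
    | inr ih => cases h with | inr h => exact .inr (ih.tail h)

theorem Acyclic.liftRel {r : I → I → Prop} {s : J → J → Prop} (hr : Acyclic r) (hs : Acyclic s) :
    Acyclic (Sum.LiftRel r s) := by
  rintro (x | x) hx
  · cases transGen_liftRel hx with
    | inl h => exact hr _ h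
  · cases transGen_liftRel hx with
    | inr h => exact hs _ h

theorem acyclic_pull_equiv (e : I ≃ J) {r : J → J → Prop} : Acyclic (pull e r) ↔ Acyclic r :=
  ⟨fun h => h.of_map e.symm fun x y hxy => by simpa [pull] using hxy,
    fun h => h.of_map e fun _ _ hxy => hxy⟩

/-- The relations whose union with each element of `P` is acyclic. -/
def Orth (P : (I → I → Prop) → Prop) (r : I → I → Prop) : Prop := ∀ s, P s → Acyclic (r ⊔ s)

/-- The disjoint unions of an element of `P` and an element of `Q`. -/
def Tens (P : (I → I → Prop) → Prop) (Q : (J → J → Prop) → Prop) (r : I ⊕ J → I ⊕ J → Prop) :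
    Prop := ∃ s t, P s ∧ Q t ∧ r = Sum.LiftRel s t

theorem orth_orth_orth (P : (I → I → Prop) → Prop) : Orth (Orth (Orth P)) = Orth P := by
  ext r
  constructor
  · intro h s hs
    exact h s fun t ht => sup_comm s t ▸ ht s hs
  · intro h s hs
    exact sup_comm r s ▸ hs r h

theorem orth_pull_iff (e : I ≃ J) {P : (J → J → Prop) → Prop} {Q : (I → I → Prop) → Prop}
    (h : ∀ r, P r ↔ Q (pull e r)) (r : J → J → Prop) : Orth P r ↔ Orth Q (pull e r) := by
  constructor
  · intro hr s hs
    have hse : s = pull e (pull e.symm s) := by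
      funext x y
      simp [pull]
    have := hr (pull e.symm s) ((h _).2 (hse ▸ hs))
    rw [hse]
    exact (acyclic_pull_equiv e).2 this
  · intro hr s hs
    exact (acyclic_pull_equiv e).1 (hr _ ((h s).1 hs))

theorem tens_pull_iff {I' J' : Type*} (e : I ≃ I') (f : J ≃ J') {P : (I → I → Prop) → Prop}
    {P' : (I' → I' → Prop) → Prop} {Q : (J → J → Prop) → Prop} {Q' : (J' → J' → Prop) → Prop}
    (hP : ∀ r, P' r ↔ P (pull e r)) (hQ : ∀ r, Q' r ↔ Q (pull f r))
    (r : J' ⊕ I' → J' ⊕ I' → Prop) :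
    Tens Q' P' r ↔ Tens P Q (pull ((e.sumCongr f).trans (Equiv.sumComm I' J')) r) := by
  constructor
  · rintro ⟨s, t, hs, ht, rfl⟩
    refine ⟨_, _, (hP t).1 ht, (hQ s).1 hs, ?_⟩
    funext x y
    rcases x with x | x <;> rcases y with y | y <;> simp [pull]
  · rintro ⟨s, t, hs, ht, hr⟩
    refine ⟨pull f.symm t, pull e.symm s, (hQ _).2 ?_, (hP _).2 ?_, ?_⟩
    · convert ht using 1
      funext x y
      simp [pull]
    · convert hs using 1
      funext x y
      simp [pull]
    · have hr' := fun x y => congrFun (congrFun hr x) y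
      funext x y
      rcases x with x | x <;> rcases y with y | y
      · simpa [pull] using hr' (.inr (f.symm x)) (.inr (f.symm y))
      · simpa [pull] using hr' (.inr (f.symm x)) (.inl (e.symm y))
      · simpa [pull] using hr' (.inl (e.symm x)) (.inr (f.symm y))
      · simpa [pull] using hr' (.inl (e.symm x)) (.inl (e.symm y))

end Acyclic

/-! ### The interpretation of formulas -/

namespace Formula

variable {α : Type u}

theorem neg_neg (A : Formula α) : A.neg.neg = A := by
  induction A with
  | atom X s => simp [neg]
  | tensor A B hA hB => simp [neg, hA, hB]
  | par A B hA hB => simp [neg, hA, hB]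

theorem atoms_neg (A : Formula α) :
    A.neg.atoms = (A.atoms.map fun p => (p.1, !p.2)).reverse := by
  induction A with
  | atom X s => rfl
  | tensor A B hA hB => simp [neg, atoms, hA, hB]
  | par A B hA hB => simp [neg, atoms, hA, hB]

theorem length_atoms_neg (A : Formula α) : A.neg.atoms.length = A.atoms.length := by
  simp [atoms_neg]

/-- The occurrences of atoms in a formula. -/
def Idx : Formula α → Type
  | atom _ _ => Unit
  | tensor A B => A.Idx ⊕ B.Idx
  | par A B => A.Idx ⊕ B.Idx

/-- The position of an occurrence in the sequence of atoms. -/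
def position : (A : Formula α) → A.Idx ≃ Fin A.atoms.length
  | atom _ _ => (Equiv.ofUnique Unit (Fin 1) : Unit ≃ Fin 1)
  | tensor A B => ((A.position.sumCongr B.position).trans finSumFinEquiv).trans
      (finCongr (List.length_append (as := A.atoms) (bs := B.atoms)).symm)
  | par A B => ((A.position.sumCongr B.position).trans finSumFinEquiv).trans
      (finCongr (List.length_append (as := A.atoms) (bs := B.atoms)).symm)

theorem position_tensor_inl (A B : Formula α) (x : A.Idx) :
    ((tensor A B).position (Sum.inl x) : ℕ) = A.position x := rfl

theorem position_tensor_inr (A B : Formula α) (x : B.Idx) :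
    ((tensor A B).position (Sum.inr x) : ℕ) = A.atoms.length + B.position x := rfl

theorem position_par_inl (A B : Formula α) (x : A.Idx) :
    ((par A B).position (Sum.inl x) : ℕ) = A.position x := rfl

theorem position_par_inr (A B : Formula α) (x : B.Idx) :
    ((par A B).position (Sum.inr x) : ℕ) = A.atoms.length + B.position x := rfl

/-- The relations on the occurrences that behave like proofs of `A` (for the flag `true`), or like
proofs of the negation of `A` (for the flag `false`). -/
def Sem : (A : Formula α) → Bool → (A.Idx → A.Idx → Prop) → Prop
  | atom _ _, _ => Acyclic (X := Unit)
  | tensor A B, true => Orth (Orth (Tens (A.Sem true) (B.Sem true)))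
  | tensor A B, false => Orth (Tens (A.Sem true) (B.Sem true))
  | par A B, true => Orth (Tens (A.Sem false) (B.Sem false))
  | par A B, false => Orth (Orth (Tens (A.Sem false) (B.Sem false)))

theorem sem_eq_orth (A : Formula α) (b : Bool) : A.Sem b = Orth (A.Sem !b) := by
  cases A with
  | atom X s =>
    funext r
    refine propext ⟨fun (h : Acyclic r) s (hs : Acyclic s) => ?_, fun h => ?_⟩
    · intro x hx
      obtain ⟨y, hy, -⟩ := Relation.TransGen.head'_iff.1 hx
      rcases hy with hy | hy
      · exact h x (.single hy)
      · exact hs x (.single hy)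
    · refine (h ⊥ ?_ : Acyclic _).mono fun _ _ => .inl
      intro x hx
      obtain ⟨y, hy, -⟩ := Relation.TransGen.head'_iff.1 hx
      exact hy
  | tensor A B =>
    cases b
    · exact (orth_orth_orth _).symm
    · rfl
  | par A B =>
    cases b
    · rfl
    · exact (orth_orth_orth _).symm

theorem acyclic_bot {X : Type*} : Acyclic (⊥ : X → X → Prop) := by
  intro x hx
  obtain ⟨y, hy, -⟩ := Relation.TransGen.head'_iff.1 hx
  exact hy

theorem sem_bot (A : Formula α) (b : Bool) : A.Sem b ⊥ := by
  have key : ∀ {A : Formula α} {b : Bool}, A.Sem (!b) ⊥ → ∀ r, A.Sem b r → Acyclic r := by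
    intro A b hA r hr
    rw [sem_eq_orth] at hr
    exact (hr ⊥ hA).mono fun _ _ => .inl
  have horth : ∀ {A B : Formula α} {b : Bool}, A.Sem (!b) ⊥ → B.Sem (!b) ⊥ →
      Orth (Tens (A.Sem b) (B.Sem b)) ⊥ := by
    rintro A B b hA hB _ ⟨s, t, hs, ht, rfl⟩
    rw [bot_sup_eq]
    exact (key hA s hs).liftRel (key hB t ht)
  have horth' : ∀ {A B : Formula α} {b : Bool}, A.Sem b ⊥ → B.Sem b ⊥ →
      Orth (Orth (Tens (A.Sem b) (B.Sem b))) ⊥ := by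
    intro A B b hA hB r hr
    exact (hr _ ⟨⊥, ⊥, hA, hB, rfl⟩).mono fun _ _ h => .inl (h.resolve_left id)
  induction A generalizing b with
  | atom X s => exact acyclic_bot
  | tensor A B hA hB =>
    cases b
    · exact horth (hA _) (hB _)
    · exact horth' (hA _) (hB _)
  | par A B hA hB =>
    cases b
    · exact horth' (hA _) (hB _)
    · exact horth (hA _) (hB _)

theorem exists_idx_neg (A : Formula α) : ∃ e : A.Idx ≃ A.neg.Idx,
    (∀ x, (A.neg.position (e x) : ℕ) + A.position x + 1 = A.atoms.length) ∧
    ∀ b r, A.neg.Sem b r ↔ A.Sem (!b) (pull e r) := by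
  induction A with
  | atom X s =>
    refine ⟨Equiv.refl Unit, fun x => ?_, fun b r => Iff.rfl⟩
    have h1 : ((atom X s).neg.position x : ℕ) < 1 := ((atom X s).neg.position x).2
    have h2 : ((atom X s).position x : ℕ) < 1 := ((atom X s).position x).2
    change ((atom X s).neg.position x : ℕ) + (atom X s).position x + 1 = 1
    omega
  | tensor A B hA hB =>
    obtain ⟨e, he, hes⟩ := hA
    obtain ⟨f, hf, hfs⟩ := hB
    refine ⟨(e.sumCongr f).trans (Equiv.sumComm _ _), ?_, ?_⟩
    · rintro (x | x)
      · have := he x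
        change ((par B.neg A.neg).position (Sum.inr (e x)) : ℕ) +
          (tensor A B).position (Sum.inl x) + 1 = (A.atoms ++ B.atoms).length
        rw [position_par_inr, position_tensor_inl, length_atoms_neg, List.length_append]
        omega
      · have := hf x
        change ((par B.neg A.neg).position (Sum.inl (f x)) : ℕ) +
          (tensor A B).position (Sum.inr x) + 1 = (A.atoms ++ B.atoms).length
        rw [position_par_inl, position_tensor_inr, List.length_append]
        omega
    · rintro (_ | _) r
      · exact orth_pull_iff _ (orth_pull_iff _ (tens_pull_iff e f (hes false) (hfs false))) r
      · exact orth_pull_iff _ (tens_pull_iff e f (hes false) (hfs false)) r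
  | par A B hA hB =>
    obtain ⟨e, he, hes⟩ := hA
    obtain ⟨f, hf, hfs⟩ := hB
    refine ⟨(e.sumCongr f).trans (Equiv.sumComm _ _), ?_, ?_⟩
    · rintro (x | x)
      · have := he x
        change ((tensor B.neg A.neg).position (Sum.inr (e x)) : ℕ) +
          (par A B).position (Sum.inl x) + 1 = (A.atoms ++ B.atoms).length
        rw [position_tensor_inr, position_par_inl, length_atoms_neg, List.length_append]
        omega
      · have := hf x
        change ((tensor B.neg A.neg).position (Sum.inl (f x)) : ℕ) +
          (par A B).position (Sum.inr x) + 1 = (A.atoms ++ B.atoms).length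
        rw [position_tensor_inl, position_par_inr, List.length_append]
        omega
    · rintro (_ | _) r
      · exact orth_pull_iff _ (tens_pull_iff e f (hes true) (hfs true)) r
      · exact orth_pull_iff _ (orth_pull_iff _ (tens_pull_iff e f (hes true) (hfs true))) r

end Formula

theorem Conn.length_atoms_form {α : Type u} (t : Conn) (A B : Formula α) :
    (t.form A B).atoms.length = A.atoms.length + B.atoms.length := by
  cases t <;> simp [Conn.form, Formula.atoms]

theorem Formula.exists_idx_of_eq_neg {α : Type u} {A B : Formula α} (h : B = A.neg) :
    ∃ e : A.Idx ≃ B.Idx,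
      (∀ x, (B.position (e x) : ℕ) + A.position x + 1 = A.atoms.length) ∧
      ∀ b r, B.Sem b r ↔ A.Sem (!b) (pull e r) := by
  subst h
  exact A.exists_idx_neg

namespace ProofGraph

variable {α : Type u}

/-! ### The direction of persistent paths -/

section Step

variable (G : ProofGraph α)

/-- The number of atoms on an edge. -/
abbrev len (e : G.E) : ℕ := (G.label e).atoms.length

/-- `U` and `V` correspond to each other at a link with label `n`, on two edges with the same endpoint
for the map `s`, which is the source or the target. -/
structure Opp (s : G.E → G.V) (n : Node) (U V : G.Atom) : Prop where
  node : G.node (s U.1) = n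
  same : s V.1 = s U.1
  ne : V.1 ≠ U.1
  sum : (U.2 : ℕ) + V.2 + 1 = G.len U.1

/-- `V` corresponds, in the conclusion of a tensor or par link, to `U` in one of the premises. -/
structure Desc (U V : G.Atom) : Prop where
  node : ∃ t, G.node (G.target U.1) = Conn.node t
  source : G.source V.1 = G.target U.1
  left : G.isRight U.1 = false → (V.2 : ℕ) = U.2
  right : G.isRight U.1 = true → (V.2 : ℕ) + G.len U.1 = G.len V.1 + U.2

/-- One step of a persistent path: it goes upwards through negative atoms and downwards through
positive ones. -/
inductive Step : G.Atom → G.Atom → Prop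
  | ax {U V : G.Atom} (h : G.Opp G.source .ax U V) (hU : G.sign U = false)
      (hV : G.sign V = true) : Step U V
  | cut {U V : G.Atom} (h : G.Opp G.target .cut U V) (hU : G.sign U = true)
      (hV : G.sign V = false) : Step U V
  | down {U V : G.Atom} (h : G.Desc U V) (hU : G.sign U = true) (hV : G.sign V = true) : Step U V
  | up {U V : G.Atom} (h : G.Desc V U) (hU : G.sign U = false) (hV : G.sign V = false) : Step U V

/-- The occurrence `x` in the label of `e`, as an atom of the graph. -/
def atomAt (e : G.E) (x : (G.label e).Idx) : G.Atom := ⟨e, (G.label e).position x⟩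

theorem atomAt_injective (e : G.E) : Function.Injective (G.atomAt e) := by
  intro x y h
  simpa [atomAt] using h

theorem exists_atomAt_eq {e : G.E} {U : G.Atom} (h : U.1 = e) : ∃ x, U = G.atomAt e x := by
  obtain ⟨d, i⟩ := U
  cases h
  exact ⟨(G.label d).position.symm i, by simp [atomAt]⟩

/-- Relations on the atoms of the edges in `es`. -/
def Tests (es : List G.E) (T : ∀ e, (G.label e).Idx → (G.label e).Idx → Prop) (U V : G.Atom) :
    Prop := ∃ e ∈ es, push (G.atomAt e) (T e) U V

/-- Graphs with conclusions `es` on which no cycle of steps can be formed with the help of relations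
that behave like proofs of the negations of the conclusions. -/
structure Net (es : List G.E) : Prop where
  nodup : es.Nodup
  concl : ∀ e ∈ es, G.IsConcl (G.target e) e
  acyclic : ∀ T : ∀ e, (G.label e).Idx → (G.label e).Idx → Prop,
    (∀ e ∈ es, (G.label e).Sem false (T e)) → Acyclic (G.Step ⊔ G.Tests es T)

variable {G}

theorem Net.acyclic_step {es : List G.E} (h : G.Net es) : Acyclic G.Step :=
  (h.acyclic (fun _ => ⊥) fun _ _ => Formula.sem_bot _ _).mono fun _ _ => .inl

theorem Net.perm {es ds : List G.E} (h : G.Net es) (hp : es.Perm ds) : G.Net ds where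
  nodup := hp.nodup_iff.1 h.nodup
  concl := fun e he => h.concl e (hp.mem_iff.2 he)
  acyclic := fun T hT => (h.acyclic T fun e he => hT e (hp.mem_iff.1 he)).mono
    fun _ _ hUV => hUV.imp_right fun ⟨e, he, hUV⟩ => ⟨e, hp.mem_iff.2 he, hUV⟩

theorem Net.sem {a : G.E} {es : List G.E} (h : G.Net (a :: es))
    {T : ∀ e, (G.label e).Idx → (G.label e).Idx → Prop}
    (hT : ∀ e ∈ es, (G.label e).Sem false (T e)) :
    (G.label a).Sem true (pull (G.atomAt a) (Relation.TransGen (G.Step ⊔ G.Tests es T))) ∧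
      Acyclic (G.Step ⊔ G.Tests es T) := by
  classical
  have key : ∀ S, (G.label a).Sem false S →
      Acyclic ((G.Step ⊔ G.Tests es T) ⊔ push (G.atomAt a) S) := by
    intro S hS
    have hne : ∀ e ∈ es, e ≠ a := fun e he hea => (List.nodup_cons.1 h.nodup).1 (hea ▸ he)
    refine (h.acyclic (Function.update T a S) ?_).mono ?_
    · intro e he
      by_cases hea : e = a
      · subst hea
        simpa using hS
      · rw [Function.update_of_ne hea]
        exact hT e (List.mem_of_ne_of_mem hea he)
    · rintro U V ((hUV | ⟨e, he, hUV⟩) | hUV)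
      · exact .inl hUV
      · refine .inr ⟨e, List.mem_cons_of_mem _ he, ?_⟩
        rwa [Function.update_of_ne (hne e he)]
      · refine .inr ⟨a, List.mem_cons_self, ?_⟩
        rwa [Function.update_self]
  refine ⟨?_, (key ⊥ (Formula.sem_bot _ _)).mono fun _ _ => .inl⟩
  rw [Formula.sem_eq_orth]
  exact fun S hS => acyclic_pull_sup (key S hS)

end Step

/-! ### Axiom links -/

theorem net_axGraph (A : Formula α) : (axGraph A).Net ([false, true] : List Bool) := by
  have hmem : ∀ b : Bool, b ∈ [false, true] := by decide
  refine ⟨show [false, true].Nodup by decide, ?_, ?_⟩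
  · intro e _
    exact ⟨rfl, fun d => ⟨fun h => Option.some.inj h, fun h => congrArg some h⟩, nofun⟩
  · intro T hT
    obtain ⟨e, he, hes⟩ := A.exists_idx_neg
    have h1 : A.Sem false (T true) := hT true (hmem true)
    have h2 : A.Sem true (pull e (T false : A.neg.Idx → A.neg.Idx → Prop)) :=
      (hes false _).1 (hT false (hmem false))
    rw [Formula.sem_eq_orth] at h2
    let f : (axGraph A).Atom → A.Idx := fun U => match U with
      | ⟨true, i⟩ => A.position.symm i
      | ⟨false, i⟩ => e.symm (A.neg.position.symm i)
    have hlink : ∀ (i : Fin A.neg.atoms.length) (j : Fin A.atoms.length),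
        (i : ℕ) + j + 1 = A.atoms.length → e.symm (A.neg.position.symm i) = A.position.symm j := by
      intro i j hij
      rw [Equiv.symm_apply_eq, Equiv.symm_apply_eq]
      have := he (A.position.symm j)
      rw [Equiv.apply_symm_apply] at this
      exact Fin.ext (by omega)
    refine Acyclic.of_contract f (h2 _ h1)
      (c := fun U V => (axGraph A).sign U = false ∧ (axGraph A).sign V = true) ?_ ?_
    · rintro U V (hUV | ⟨d, -, x, y, hxy, rfl, rfl⟩)
      · right
        cases hUV with
        | ax h hU hV =>
          refine ⟨?_, hU, hV⟩
          obtain ⟨_ | _, i⟩ := U <;> obtain ⟨_ | _, j⟩ := V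
          · exact absurd rfl h.ne
          · have := h.sum
            exact hlink i j (this.trans A.length_atoms_neg)
          · have := h.sum
            refine (hlink j i ?_).symm
            rw [add_comm (j : ℕ)]
            exact this
          · exact absurd rfl h.ne
        | cut h => exact absurd h.node nofun
        | down h =>
          obtain ⟨t, ht⟩ := h.node
          cases t <;> exact absurd ht nofun
        | up h =>
          obtain ⟨t, ht⟩ := h.node
          cases t <;> exact absurd ht nofun
      · left
        cases d
        · left
          have hf : ∀ z : A.neg.Idx, f ((axGraph A).atomAt false z) = e.symm z := fun z =>
            congrArg e.symm (A.neg.position.symm_apply_apply z)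
          have hef : ∀ z : A.neg.Idx, e (f ((axGraph A).atomAt false z)) = z := fun z =>
            (congrArg e (hf z)).trans (e.apply_symm_apply z)
          exact (congrArg₂ (T false) (hef x) (hef y)).mpr hxy
        · right
          have hf : ∀ z : A.Idx, f ((axGraph A).atomAt true z) = z := fun z =>
            A.position.symm_apply_apply z
          exact (congrArg₂ (T true) (hf x) (hf y)).mpr hxy
    · rintro x y z ⟨-, h⟩ ⟨h', -⟩
      rw [h] at h'
      exact absurd h' nofun

/-! ### Disjoint unions -/

section Union

variable {G H : ProofGraph α}

/-- The atoms of a disjoint union. -/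
def splitAtom : (G.union H).Atom → G.Atom ⊕ H.Atom
  | ⟨Sum.inl e, i⟩ => Sum.inl ⟨e, i⟩
  | ⟨Sum.inr e, i⟩ => Sum.inr ⟨e, i⟩

theorem opp_union {s : G.E → G.V} {s' : H.E → H.V} {n : Node} {U V : (G.union H).Atom}
    (h : (G.union H).Opp (Sum.map s s') n U V) :
    Sum.LiftRel (G.Opp s n) (H.Opp s' n) (splitAtom U) (splitAtom V) := by
  obtain ⟨e | e, i⟩ := U <;> obtain ⟨d | d, j⟩ := V
  · exact .inl ⟨h.node, Sum.inl.inj h.same, fun h' => h.ne (congrArg Sum.inl h'), h.sum⟩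
  · exact absurd h.same nofun
  · exact absurd h.same nofun
  · exact .inr ⟨h.node, Sum.inr.inj h.same, fun h' => h.ne (congrArg Sum.inr h'), h.sum⟩

theorem desc_union {U V : (G.union H).Atom} (h : (G.union H).Desc U V) :
    Sum.LiftRel G.Desc H.Desc (splitAtom U) (splitAtom V) := by
  obtain ⟨e | e, i⟩ := U <;> obtain ⟨d | d, j⟩ := V
  · exact .inl ⟨h.node, Sum.inl.inj h.source, h.left, h.right⟩
  · exact absurd h.source nofun
  · exact absurd h.source nofun
  · exact .inr ⟨h.node, Sum.inr.inj h.source, h.left, h.right⟩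

theorem sign_union (U : (G.union H).Atom) :
    (G.union H).sign U = Sum.elim G.sign H.sign (splitAtom U) := by
  obtain ⟨e | e, i⟩ := U <;> rfl

theorem step_union {U V : (G.union H).Atom} (h : (G.union H).Step U V) :
    Sum.LiftRel G.Step H.Step (splitAtom U) (splitAtom V) := by
  cases h with
  | ax h hU hV =>
    have h' := opp_union h
    rw [sign_union] at hU hV
    generalize splitAtom U = x at *
    generalize splitAtom V = y at *
    cases h' with
    | inl h' => exact .inl (.ax h' hU hV)
    | inr h' => exact .inr (.ax h' hU hV)
  | cut h hU hV =>
    have h' := opp_union h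
    rw [sign_union] at hU hV
    generalize splitAtom U = x at *
    generalize splitAtom V = y at *
    cases h' with
    | inl h' => exact .inl (.cut h' hU hV)
    | inr h' => exact .inr (.cut h' hU hV)
  | down h hU hV =>
    have h' := desc_union h
    rw [sign_union] at hU hV
    generalize splitAtom U = x at *
    generalize splitAtom V = y at *
    cases h' with
    | inl h' => exact .inl (.down h' hU hV)
    | inr h' => exact .inr (.down h' hU hV)
  | up h hU hV =>
    have h' := desc_union h
    rw [sign_union] at hU hV
    generalize splitAtom U = x at *
    generalize splitAtom V = y at *
    cases h' with
    | inl h' => exact .inl (.up h' hU hV)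
    | inr h' => exact .inr (.up h' hU hV)

theorem IsConcl.union_inl {e : G.E} (h : G.IsConcl (G.target e) e) :
    (G.union H).IsConcl ((G.union H).target (Sum.inl e)) (Sum.inl e) := by
  refine ⟨h.node, ?_, ?_⟩
  · rintro (d | d)
    · exact ⟨fun h' => congrArg Sum.inl ((h.premise d).1 (Sum.inl.inj h')),
        fun h' => congrArg Sum.inl ((h.premise d).2 (Sum.inl.inj h'))⟩
    · exact ⟨nofun, nofun⟩
  · rintro (d | d)
    · exact fun h' => h.conclusion d (Sum.inl.inj h')
    · exact nofun

theorem IsConcl.union_inr {e : H.E} (h : H.IsConcl (H.target e) e) :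
    (G.union H).IsConcl ((G.union H).target (Sum.inr e)) (Sum.inr e) := by
  refine ⟨h.node, ?_, ?_⟩
  · rintro (d | d)
    · exact ⟨nofun, nofun⟩
    · exact ⟨fun h' => congrArg Sum.inr ((h.premise d).1 (Sum.inr.inj h')),
        fun h' => congrArg Sum.inr ((h.premise d).2 (Sum.inr.inj h'))⟩
  · rintro (d | d)
    · exact nofun
    · exact fun h' => h.conclusion d (Sum.inr.inj h')

/-- The atoms of two distinct edges. -/
def atomAt₂ (G : ProofGraph α) (a b : G.E) : (G.label a).Idx ⊕ (G.label b).Idx → G.Atom :=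
  Sum.elim (G.atomAt a) (G.atomAt b)

theorem atomAt₂_injective {a b : G.E} (hab : a ≠ b) : Function.Injective (G.atomAt₂ a b) := by
  rintro (x | x) (y | y) h
  · exact congrArg Sum.inl (G.atomAt_injective a h)
  · exact absurd (congrArg Sigma.fst h) hab
  · exact absurd (congrArg Sigma.fst h) hab.symm
  · exact congrArg Sum.inr (G.atomAt_injective b h)

theorem Net.union_sem {a : G.E} {es : List G.E} {b : H.E} {ds : List H.E}
    (hG : G.Net (a :: es)) (hH : H.Net (b :: ds))
    {T : ∀ e, ((G.union H).label e).Idx → ((G.union H).label e).Idx → Prop}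
    (hT : ∀ e ∈ (es.map Sum.inl ++ ds.map Sum.inr : List (G.E ⊕ H.E)),
      ((G.union H).label e).Sem false (T e)) :
    ∃ R S, (G.label a).Sem true R ∧ (H.label b).Sem true S ∧
      Acyclic ((G.union H).Step ⊔
        (G.union H).Tests (es.map Sum.inl ++ ds.map Sum.inr : List (G.E ⊕ H.E)) T) ∧
      ∀ x y : (G.label a).Idx ⊕ (H.label b).Idx,
        pull ((G.union H).atomAt₂ (Sum.inl a) (Sum.inr b)) (Relation.TransGen ((G.union H).Step ⊔
          (G.union H).Tests (es.map Sum.inl ++ ds.map Sum.inr : List (G.E ⊕ H.E)) T)) x y →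
        Sum.LiftRel R S x y := by
  obtain ⟨h1, h1'⟩ := hG.sem (T := fun e => T (Sum.inl e)) fun e he =>
    hT (Sum.inl e) (List.mem_append_left _ (List.mem_map_of_mem he))
  obtain ⟨h2, h2'⟩ := hH.sem (T := fun e => T (Sum.inr e)) fun e he =>
    hT (Sum.inr e) (List.mem_append_right _ (List.mem_map_of_mem he))
  have hsplit : ∀ U V : (G.union H).Atom, ((G.union H).Step ⊔
      (G.union H).Tests (es.map Sum.inl ++ ds.map Sum.inr : List (G.E ⊕ H.E)) T) U V →
      Sum.LiftRel (G.Step ⊔ G.Tests es fun e => T (Sum.inl e))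
        (H.Step ⊔ H.Tests ds fun e => T (Sum.inr e)) (splitAtom U) (splitAtom V) := by
    rintro U V (h | ⟨e, he, x, y, hxy, rfl, rfl⟩)
    · exact (step_union h).mono (fun _ _ => .inl) fun _ _ => .inl
    · rcases List.mem_append.1 he with he | he
      · obtain ⟨d, hd, rfl⟩ := List.mem_map.1 he
        exact .inl (.inr ⟨d, hd, x, y, hxy, rfl, rfl⟩)
      · obtain ⟨d, hd, rfl⟩ := List.mem_map.1 he
        exact .inr (.inr ⟨d, hd, x, y, hxy, rfl, rfl⟩)
  refine ⟨_, _, h1, h2, (h1'.liftRel h2').of_map splitAtom hsplit, fun x y hxy => ?_⟩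
  have := transGen_liftRel (Relation.TransGen.lift splitAtom hsplit _ _ hxy)
  rcases x with x | x <;> rcases y with y | y <;> cases this <;> constructor <;> assumption

end Union

/-! ### Cut links -/

section Cut

variable {G : ProofGraph α} {a b : G.E}

theorem merge_of_ne {W : Type} (old : G.Rest a b → W) (new : W) {w : G.V}
    (h : w ≠ G.target a ∧ w ≠ G.target b) : G.merge a b old new w = old ⟨w, h⟩ := dif_pos h

theorem eq_of_merge_eq {W : Type} {old : G.Rest a b → W} {new : W}
    (hold : Function.Injective old) (hnew : ∀ w, old w ≠ new) {w w' : G.V}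
    (h : w ≠ G.target a ∧ w ≠ G.target b)
    (heq : G.merge a b old new w' = G.merge a b old new w) : w' = w := by
  rw [merge_of_ne old new h] at heq
  by_cases h' : w' ≠ G.target a ∧ w' ≠ G.target b
  · rw [merge_of_ne old new h'] at heq
    exact congrArg Subtype.val (hold heq)
  · rw [merge, dif_neg h'] at heq
    exact absurd heq.symm (hnew _)

theorem node_addCut_merge {w : G.V} (h : w ≠ G.target a ∧ w ≠ G.target b) :
    (G.addCut a b).node (G.merge a b (some : G.Rest a b → Option (G.Rest a b)) none w) =
      G.node w :=
  congrArg (G.addCut a b).node (merge_of_ne some none h)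

theorem step_addCut (ha : G.IsConcl (G.target a) a) (hb : G.IsConcl (G.target b) b)
    {U V : G.Atom} (h : (G.addCut a b).Step U V) :
    G.Step U V ∨ (((U.1 = a ∧ V.1 = b) ∨ (U.1 = b ∧ V.1 = a)) ∧
      (U.2 : ℕ) + V.2 + 1 = G.len U.1 ∧ G.sign U = true ∧ G.sign V = false) := by
  have hinj : Function.Injective (some : G.Rest a b → Option (G.Rest a b)) :=
    Option.some_injective _
  have hnew : ∀ w : G.Rest a b, some w ≠ none := nofun
  have hs : ∀ e, G.source e ≠ G.target a ∧ G.source e ≠ G.target b := fun e =>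
    ⟨ha.conclusion e, hb.conclusion e⟩
  have hdesc : ∀ {U V : G.Atom}, (G.addCut a b).Desc U V → G.Desc U V := by
    intro U V h
    obtain ⟨t, ht⟩ := h.node
    have hsrc : G.source V.1 = G.target U.1 := (eq_of_merge_eq hinj hnew (hs V.1) h.source.symm).symm
    refine ⟨⟨t, ?_⟩, hsrc, h.left, h.right⟩
    have := hs V.1
    rw [hsrc] at this
    exact (node_addCut_merge this).symm.trans ht
  cases h with
  | ax h hU hV =>
    refine .inl (.ax ⟨?_, eq_of_merge_eq hinj hnew (hs U.1) h.same, h.ne, h.sum⟩ hU hV)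
    exact (node_addCut_merge (hs U.1)).symm.trans h.node
  | cut h hU hV =>
    by_cases hm : G.target U.1 ≠ G.target a ∧ G.target U.1 ≠ G.target b
    · refine .inl (.cut ⟨?_, eq_of_merge_eq hinj hnew hm h.same, h.ne, h.sum⟩ hU hV)
      exact (node_addCut_merge hm).symm.trans h.node
    · refine .inr ⟨?_, h.sum, hU, hV⟩
      have hVm : ¬ (G.target V.1 ≠ G.target a ∧ G.target V.1 ≠ G.target b) := by
        intro hVm
        exact hm (eq_of_merge_eq hinj hnew hVm h.same.symm ▸ hVm)
      rw [← not_or, not_not, ha.premise, hb.premise] at hm hVm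
      have := h.ne
      rcases hm with hm | hm <;> rcases hVm with hVm | hVm
      · exact absurd (hVm.trans hm.symm) this
      · exact .inl ⟨hm, hVm⟩
      · exact .inr ⟨hm, hVm⟩
      · exact absurd (hVm.trans hm.symm) this
  | down h hU hV => exact .inl (.down (hdesc h) hU hV)
  | up h hU hV => exact .inl (.up (hdesc h) hU hV)

theorem IsConcl.addCut {e : G.E} (h : G.IsConcl (G.target e) e) (hea : e ≠ a) (heb : e ≠ b) :
    (G.addCut a b).IsConcl ((G.addCut a b).target e) e := by
  have hinj : Function.Injective (some : G.Rest a b → Option (G.Rest a b)) :=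
    Option.some_injective _
  have hnew : ∀ w : G.Rest a b, some w ≠ none := nofun
  have ht : G.target e ≠ G.target a ∧ G.target e ≠ G.target b :=
    ⟨fun h' => hea ((h.premise a).1 h'.symm).symm, fun h' => heb ((h.premise b).1 h'.symm).symm⟩
  refine ⟨?_, fun d => ⟨fun hd => ?_, fun hd => hd ▸ rfl⟩, fun d hd => ?_⟩
  · exact (node_addCut_merge ht).trans h.node
  · exact (h.premise d).1 (eq_of_merge_eq hinj hnew ht hd)
  · exact h.conclusion d (eq_of_merge_eq hinj hnew ht hd)

end Cut

theorem Net.addCut {G H : ProofGraph α} {a : G.E} {es : List G.E} {b : H.E} {ds : List H.E}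
    (hG : G.Net (a :: es)) (hH : H.Net (b :: ds)) (hab : H.label b = (G.label a).neg) :
    ((G.union H).addCut (Sum.inl a) (Sum.inr b)).Net
      (es.map Sum.inl ++ ds.map Sum.inr : List (G.E ⊕ H.E)) := by
  have ha := (hG.concl a List.mem_cons_self).union_inl (H := H)
  have hb := (hH.concl b List.mem_cons_self).union_inr (G := G)
  obtain ⟨hae, hes⟩ := List.nodup_cons.1 hG.nodup
  obtain ⟨hbd, hds⟩ := List.nodup_cons.1 hH.nodup
  refine ⟨?_, ?_, ?_⟩
  · refine (hes.map Sum.inl_injective).append (hds.map Sum.inr_injective) fun e he he' => ?_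
    obtain ⟨d, -, rfl⟩ := List.mem_map.1 he
    obtain ⟨d', -, h⟩ := List.mem_map.1 he'
    exact absurd h nofun
  · intro e he
    rcases List.mem_append.1 he with he | he
    · obtain ⟨d, hd, rfl⟩ := List.mem_map.1 he
      refine IsConcl.addCut
        (hG.concl d (List.mem_cons_of_mem _ hd)).union_inl ?_ nofun
      intro h
      exact hae (Sum.inl.inj h ▸ hd)
    · obtain ⟨d, hd, rfl⟩ := List.mem_map.1 he
      refine IsConcl.addCut
        (hH.concl d (List.mem_cons_of_mem _ hd)).union_inr nofun ?_
      intro h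
      exact hbd (Sum.inr.inj h ▸ hd)
  · intro T hT
    obtain ⟨R, S, hR, hS, hacyc, hres⟩ := hG.union_sem hH (T := T) hT
    obtain ⟨e, he, hes⟩ := Formula.exists_idx_of_eq_neg hab
    rw [hes, Bool.not_true] at hS
    rw [Formula.sem_eq_orth] at hR
    set f : (G.label a).Idx ⊕ (H.label b).Idx → (G.label a).Idx := Sum.elim id e.symm
    set ι : (G.label a).Idx ⊕ (H.label b).Idx → (G.union H).Atom :=
      (G.union H).atomAt₂ (Sum.inl a) (Sum.inr b)
    set c : (G.label a).Idx ⊕ (H.label b).Idx → (G.label a).Idx ⊕ (H.label b).Idx → Prop :=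
      fun x y => (G.union H).sign (ι x) = true ∧ (G.union H).sign (ι y) = false
    have h1 : Acyclic (pull ι (Relation.TransGen ((G.union H).Step ⊔
        (G.union H).Tests (es.map Sum.inl ++ ds.map Sum.inr : List (G.E ⊕ H.E)) T)) ⊔
        fun x y => f x = f y ∧ c x y) := by
      refine Acyclic.of_contract f (hR _ hS) (c := c) ?_ ?_
      · rintro x y (hxy | hxy)
        · left
          cases hres x y hxy with
          | inl h => exact .inl h
          | inr h =>
            right
            simpa [f, pull] using h
        · exact .inr hxy
      · rintro x y z ⟨-, h⟩ ⟨h', -⟩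
        rw [h] at h'
        exact absurd h' nofun
    have hι : Function.Injective ι := atomAt₂_injective (G := G.union H) nofun
    refine (acyclic_sup_push hι hacyc h1).mono ?_
    have hlink : ∀ (x : (G.label a).Idx) (y : (H.label b).Idx),
        ((G.label a).position x : ℕ) + (H.label b).position y + 1 = (G.label a).atoms.length →
        x = e.symm y := by
      intro x y hxy
      rw [Equiv.eq_symm_apply]
      have := he x
      exact (H.label b).position.injective (Fin.ext (by omega))
    rintro U V (hUV | hUV)
    · rcases step_addCut (G := G.union H) ha hb hUV with h | ⟨⟨hU, hV⟩ | ⟨hU, hV⟩, hsum, hsU, hsV⟩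
      · exact .inl (.inl h)
      · obtain ⟨x, rfl⟩ := (G.union H).exists_atomAt_eq hU
        obtain ⟨y, rfl⟩ := (G.union H).exists_atomAt_eq hV
        exact .inr ⟨Sum.inl x, Sum.inr y, ⟨hlink x y hsum, hsU, hsV⟩, rfl, rfl⟩
      · obtain ⟨x, rfl⟩ := (G.union H).exists_atomAt_eq hU
        obtain ⟨y, rfl⟩ := (G.union H).exists_atomAt_eq hV
        refine .inr ⟨Sum.inr x, Sum.inl y, ⟨(hlink y x ?_).symm, hsU, hsV⟩, rfl, rfl⟩
        have hlen : (H.label b).atoms.length = (G.label a).atoms.length := by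
          rw [hab, Formula.length_atoms_neg]
        have hsum' : ((H.label b).position x : ℕ) + (G.label a).position y + 1 =
          (H.label b).atoms.length := hsum
        omega
    · exact .inl (.inr hUV)

end ProofGraph

namespace ProofGraph

variable {α : Type u}

/-! ### Tensor and par links -/

theorem nodup_none_cons {X : Type*} {l : List X} (h : l.Nodup) :
    (none :: l.map some).Nodup :=
  List.nodup_cons.2 ⟨by simp, h.map (Option.some_injective _)⟩

section Bin

variable {G : ProofGraph α} {a b : G.E} {t : Conn}

/-- Identify the atoms of the conclusion of the new link with those of its premises. -/
def glue (G : ProofGraph α) (t : Conn) (a b : G.E) : (G.addBin t a b).Atom → G.Atom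
  | ⟨none, i⟩ => if h : (i : ℕ) < G.len a then ⟨a, ⟨i, h⟩⟩ else ⟨b, ⟨i - G.len a, by
      have h1 : (i : ℕ) < (t.form (G.label a) (G.label b)).atoms.length := i.2
      rw [t.length_atoms_form] at h1
      have : G.len a = (G.label a).atoms.length := rfl
      omega⟩⟩
  | ⟨some e, i⟩ => ⟨e, i⟩

theorem glue_of_lt {i : Fin ((G.addBin t a b).len none)} {j : Fin (G.len a)} (h : (i : ℕ) = j) :
    G.glue t a b ⟨none, i⟩ = ⟨a, j⟩ := by
  have h1 : (i : ℕ) < G.len a := h ▸ j.2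
  have h2 : (⟨i, h1⟩ : Fin (G.len a)) = j := Fin.ext h
  rw [glue, dif_pos h1, h2]

theorem glue_of_ge {i : Fin ((G.addBin t a b).len none)} {j : Fin (G.len b)}
    (h : (i : ℕ) = G.len a + j) : G.glue t a b ⟨none, i⟩ = ⟨b, j⟩ := by
  have h1 : ¬ (i : ℕ) < G.len a := by omega
  rw [glue, dif_neg h1]
  congr 1
  exact Fin.ext (by simp [h])

theorem node_addBin_merge {w : G.V} (h : w ≠ G.target a ∧ w ≠ G.target b) :
    (G.addBin t a b).node (G.merge a b (Sum.inl : G.Rest a b → G.Rest a b ⊕ Bool)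
      (Sum.inr false) w) = G.node w :=
  congrArg (G.addBin t a b).node (merge_of_ne Sum.inl (Sum.inr false) h)

theorem node_addBin_merge_not {w : G.V} (h : ¬ (w ≠ G.target a ∧ w ≠ G.target b)) :
    (G.addBin t a b).node (G.merge a b (Sum.inl : G.Rest a b → G.Rest a b ⊕ Bool)
      (Sum.inr false) w) = t.node :=
  congrArg (G.addBin t a b).node (dif_neg h)

theorem merge_ne_inr_true {w : G.V} : G.merge a b (Sum.inl : G.Rest a b → G.Rest a b ⊕ Bool)
    (Sum.inr false) w ≠ Sum.inr true := by
  rw [merge]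
  split_ifs <;> simp

theorem merge_ne_inr_false {w : G.V} (h : w ≠ G.target a ∧ w ≠ G.target b) :
    G.merge a b (Sum.inl : G.Rest a b → G.Rest a b ⊕ Bool) (Sum.inr false) w ≠ Sum.inr false := by
  rw [merge_of_ne _ _ h]
  simp

theorem Conn.node_ne (t : Conn) : t.node ≠ .ax ∧ t.node ≠ .cut ∧ t.node ≠ .c := by
  cases t <;> exact ⟨nofun, nofun, nofun⟩

theorem isRight_addBin_left : (G.addBin t a b).isRight (some a) = false := if_pos rfl

theorem isRight_addBin_right (hab : a ≠ b) : (G.addBin t a b).isRight (some b) = true :=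
  (if_neg hab.symm).trans (if_pos rfl)

theorem isRight_addBin_of_ne {e : G.E} (hea : e ≠ a) (heb : e ≠ b) :
    (G.addBin t a b).isRight (some e) = G.isRight e :=
  (if_neg hea).trans (if_neg heb)

theorem desc_addBin (hab : a ≠ b) (ha : G.IsConcl (G.target a) a) (hb : G.IsConcl (G.target b) b)
    {U V : (G.addBin t a b).Atom} (h : (G.addBin t a b).Desc U V) :
    U.1 ≠ none ∧ ((V.1 ≠ none ∧ G.Desc (G.glue t a b U) (G.glue t a b V)) ∨
      (V.1 = none ∧ G.glue t a b U = G.glue t a b V)) := by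
  have hinj : Function.Injective (Sum.inl : G.Rest a b → G.Rest a b ⊕ Bool) := Sum.inl_injective
  have hnew : ∀ w : G.Rest a b, (Sum.inl w : G.Rest a b ⊕ Bool) ≠ Sum.inr false := nofun
  have hs : ∀ e, G.source e ≠ G.target a ∧ G.source e ≠ G.target b := fun e =>
    ⟨ha.conclusion e, hb.conclusion e⟩
  obtain ⟨t', ht'⟩ := h.node
  obtain ⟨_ | e, i⟩ := U
  · exact absurd ht'.symm (Conn.node_ne t').2.2
  refine ⟨nofun, ?_⟩
  obtain ⟨_ | d, j⟩ := V
  · right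
    refine ⟨rfl, ?_⟩
    have he : ¬ (G.target e ≠ G.target a ∧ G.target e ≠ G.target b) := fun he =>
      merge_ne_inr_false he h.source.symm
    rw [← not_or, not_not, ha.premise, hb.premise] at he
    rcases he with rfl | rfl
    · exact (glue_of_lt (h.left isRight_addBin_left)).symm
    · have h1 : (j : ℕ) + G.len e = (t.form (G.label a) (G.label e)).atoms.length + i :=
        h.right (isRight_addBin_right hab)
      rw [t.length_atoms_form] at h1
      exact (glue_of_ge (by simp only [len] at h1 ⊢; omega)).symm
  · left
    have hsrc : G.source d = G.target e := (eq_of_merge_eq hinj hnew (hs d) h.source.symm).symm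
    have he := hs d
    rw [hsrc] at he
    have hr : (G.addBin t a b).isRight (some e) = G.isRight e :=
      isRight_addBin_of_ne (fun h' => he.1 (h' ▸ rfl)) fun h' => he.2 (h' ▸ rfl)
    exact ⟨nofun, ⟨t', (node_addBin_merge he).symm.trans ht'⟩, hsrc,
      fun h' => h.left (hr.trans h'), fun h' => h.right (hr.trans h')⟩

theorem step_addBin (hab : a ≠ b) (ha : G.IsConcl (G.target a) a) (hb : G.IsConcl (G.target b) b)
    {U V : (G.addBin t a b).Atom} (h : (G.addBin t a b).Step U V) :
    G.Step (G.glue t a b U) (G.glue t a b V) ∨ (G.glue t a b U = G.glue t a b V ∧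
      ((U.1 ≠ none ∧ V.1 = none ∧ (G.addBin t a b).sign U = true ∧
          (G.addBin t a b).sign V = true) ∨
        (U.1 = none ∧ V.1 ≠ none ∧ (G.addBin t a b).sign U = false ∧
          (G.addBin t a b).sign V = false))) := by
  have hinj : Function.Injective (Sum.inl : G.Rest a b → G.Rest a b ⊕ Bool) := Sum.inl_injective
  have hnew : ∀ w : G.Rest a b, (Sum.inl w : G.Rest a b ⊕ Bool) ≠ Sum.inr false := nofun
  have hs : ∀ e, G.source e ≠ G.target a ∧ G.source e ≠ G.target b := fun e =>
    ⟨ha.conclusion e, hb.conclusion e⟩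
  have hsign : ∀ {U : (G.addBin t a b).Atom}, U.1 ≠ none →
      G.sign (G.glue t a b U) = (G.addBin t a b).sign U := by
    rintro ⟨_ | e, i⟩ h
    · exact absurd rfl h
    · rfl
  cases h with
  | ax h hU hV =>
    obtain ⟨_ | e, i⟩ := U
    · exact absurd h.node (Conn.node_ne t).1
    obtain ⟨_ | d, j⟩ := V
    · exact absurd h.same.symm (merge_ne_inr_false (hs e))
    refine .inl (.ax ⟨(node_addBin_merge (hs e)).symm.trans h.node,
      eq_of_merge_eq hinj hnew (hs e) h.same, fun h' => h.ne (congrArg some h'), h.sum⟩ hU hV)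
  | cut h hU hV =>
    obtain ⟨_ | e, i⟩ := U
    · exact absurd h.node nofun
    obtain ⟨_ | d, j⟩ := V
    · exact absurd h.same.symm merge_ne_inr_true
    by_cases he : G.target e ≠ G.target a ∧ G.target e ≠ G.target b
    · exact .inl (.cut ⟨(node_addBin_merge he).symm.trans h.node,
        eq_of_merge_eq hinj hnew he h.same, fun h' => h.ne (congrArg some h'), h.sum⟩ hU hV)
    · exact absurd ((node_addBin_merge_not he).symm.trans h.node) (Conn.node_ne t).2.1
  | down h hU hV =>
    obtain ⟨hU', ⟨hV', h'⟩ | ⟨hV', h'⟩⟩ := desc_addBin hab ha hb h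
    · exact .inl (.down h' ((hsign hU').trans hU) ((hsign hV').trans hV))
    · exact .inr ⟨h', .inl ⟨hU', hV', hU, hV⟩⟩
  | up h hU hV =>
    obtain ⟨hV', ⟨hU', h'⟩ | ⟨hU', h'⟩⟩ := desc_addBin hab ha hb h
    · exact .inl (.up h' ((hsign hU').trans hU) ((hsign hV').trans hV))
    · exact .inr ⟨h'.symm, .inr ⟨hU', hV', hU, hV⟩⟩

theorem acyclic_addBin (hab : a ≠ b) (ha : G.IsConcl (G.target a) a)
    (hb : G.IsConcl (G.target b) b) {r s : G.Atom → G.Atom → Prop}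
    {T : (G.addBin t a b).Atom → (G.addBin t a b).Atom → Prop}
    (h : Acyclic (G.Step ⊔ r ⊔ s))
    (hT : ∀ U V, T U V → (r ⊔ s) (G.glue t a b U) (G.glue t a b V)) :
    Acyclic ((G.addBin t a b).Step ⊔ T) := by
  refine Acyclic.of_contract (G.glue t a b) h
    (c := fun U V => (U.1 ≠ none ∧ V.1 = none ∧ (G.addBin t a b).sign U = true ∧
          (G.addBin t a b).sign V = true) ∨
        (U.1 = none ∧ V.1 ≠ none ∧ (G.addBin t a b).sign U = false ∧
          (G.addBin t a b).sign V = false)) ?_ ?_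
  · rintro U V (hUV | hUV)
    · exact (step_addBin hab ha hb hUV).imp_left fun h => .inl (.inl h)
    · left
      rcases hT U V hUV with h | h
      · exact .inl (.inr h)
      · exact .inr h
  · rintro U V W (⟨-, hV, -, hs⟩ | ⟨-, hV, -, hs⟩) (⟨hV', -, hs', -⟩ | ⟨hV', -, hs', -⟩)
    · exact hV' hV
    · rw [hs] at hs'
      exact absurd hs' nofun
    · rw [hs] at hs'
      exact absurd hs' nofun
    · exact hV hV'

theorem IsConcl.addBin {e : G.E} (h : G.IsConcl (G.target e) e) (hea : e ≠ a) (heb : e ≠ b) :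
    (G.addBin t a b).IsConcl ((G.addBin t a b).target (some e)) (some e) := by
  have hinj : Function.Injective (Sum.inl : G.Rest a b → G.Rest a b ⊕ Bool) := Sum.inl_injective
  have hnew : ∀ w : G.Rest a b, (Sum.inl w : G.Rest a b ⊕ Bool) ≠ Sum.inr false := nofun
  have ht : G.target e ≠ G.target a ∧ G.target e ≠ G.target b :=
    ⟨fun h' => hea ((h.premise a).1 h'.symm).symm, fun h' => heb ((h.premise b).1 h'.symm).symm⟩
  refine ⟨(node_addBin_merge ht).trans h.node, ?_, ?_⟩
  · rintro (_ | d)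
    · exact ⟨fun h' => absurd h'.symm merge_ne_inr_true, nofun⟩
    · exact ⟨fun h' => congrArg some ((h.premise d).1 (eq_of_merge_eq hinj hnew ht h')),
        fun h' => by rw [h']⟩
  · rintro (_ | d) h'
    · exact merge_ne_inr_false ht h'.symm
    · exact h.conclusion d (eq_of_merge_eq hinj hnew ht h')

theorem isConcl_addBin_none :
    (G.addBin t a b).IsConcl ((G.addBin t a b).target none) none := by
  refine ⟨rfl, ?_, ?_⟩
  · rintro (_ | d)
    · exact ⟨fun _ => rfl, fun _ => rfl⟩
    · exact ⟨fun h => absurd h merge_ne_inr_true, nofun⟩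
  · rintro (_ | d)
    · exact nofun
    · exact merge_ne_inr_true

theorem tests_addBin {es : List G.E}
    {T : ∀ e, ((G.addBin t a b).label e).Idx → ((G.addBin t a b).label e).Idx → Prop}
    {U V : (G.addBin t a b).Atom} (h : (G.addBin t a b).Tests (none :: es.map some) T U V) :
    G.Tests es (fun e => T (some e)) (G.glue t a b U) (G.glue t a b V) ∨
      push ((G.addBin t a b).atomAt none) (T none) U V := by
  obtain ⟨e, he, hUV⟩ := h
  rcases List.mem_cons.1 he with rfl | he
  · exact .inr hUV
  · obtain ⟨d, hd, rfl⟩ := List.mem_map.1 he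
    obtain ⟨x, y, hxy, rfl, rfl⟩ := hUV
    exact .inl ⟨d, hd, x, y, hxy, rfl, rfl⟩

theorem glue_atomAt_tensor (x : (G.label a).Idx ⊕ (G.label b).Idx) :
    G.glue .tensor a b ((G.addBin .tensor a b).atomAt none x) = G.atomAt₂ a b x := by
  rcases x with x | x
  · exact glue_of_lt (Formula.position_tensor_inl _ _ x)
  · exact glue_of_ge (Formula.position_tensor_inr _ _ x)

theorem glue_atomAt_par (x : (G.label a).Idx ⊕ (G.label b).Idx) :
    G.glue .par a b ((G.addBin .par a b).atomAt none x) = G.atomAt₂ a b x := by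
  rcases x with x | x
  · exact glue_of_lt (Formula.position_par_inl _ _ x)
  · exact glue_of_ge (Formula.position_par_inr _ _ x)

theorem Net.par {es : List G.E} (h : G.Net (a :: b :: es)) :
    (G.addBin .par a b).Net (none :: es.map some : List (Option G.E)) := by
  obtain ⟨ha, hnd⟩ := List.nodup_cons.1 h.nodup
  obtain ⟨hb, hnd⟩ := List.nodup_cons.1 hnd
  have hab : a ≠ b := fun hab => ha (hab ▸ List.mem_cons_self)
  have hca := h.concl a List.mem_cons_self
  have hcb := h.concl b (List.mem_cons_of_mem _ List.mem_cons_self)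
  have hea : ∀ e ∈ es, e ≠ a := fun e he hea => ha (List.mem_cons_of_mem _ (hea ▸ he))
  have heb : ∀ e ∈ es, e ≠ b := fun e he heb => hb (heb ▸ he)
  refine ⟨?_, ?_, ?_⟩
  · exact nodup_none_cons hnd
  · intro e he
    rcases List.mem_cons.1 he with rfl | he
    · exact isConcl_addBin_none
    · obtain ⟨d, hd, rfl⟩ := List.mem_map.1 he
      exact (h.concl d (List.mem_cons_of_mem _ (List.mem_cons_of_mem _ hd))).addBin
        (hea d hd) (heb d hd)
  · classical
    intro T hT
    have hnone : Orth (Orth (Tens ((G.label a).Sem false) ((G.label b).Sem false))) (T none) :=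
      hT none List.mem_cons_self
    obtain ⟨T', hT'⟩ : ∃ T' : ∀ e, (G.label e).Idx → (G.label e).Idx → Prop,
        T' = fun e => T (some e) := ⟨_, rfl⟩
    have hTes : ∀ e ∈ es, (G.label e).Sem false (T' e) := fun e he => by
      rw [hT']
      exact hT (some e) (List.mem_cons_of_mem _ (List.mem_map_of_mem he))
    set r := G.Tests es T'
    have hr : ∀ S S', (G.label a).Sem false S → (G.label b).Sem false S' →
        Acyclic ((G.Step ⊔ r) ⊔ push (G.atomAt₂ a b) (Sum.LiftRel S S')) := by
      intro S S' hS hS'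
      refine (h.acyclic
        (Function.update (Function.update T' b S') a S) ?_).mono ?_
      · intro e he
        by_cases h1 : e = a
        · subst h1
          simpa using hS
        rw [Function.update_of_ne h1]
        by_cases h2 : e = b
        · subst h2
          simpa using hS'
        rw [Function.update_of_ne h2]
        exact hTes e (List.mem_of_ne_of_mem h2 (List.mem_of_ne_of_mem h1 he))
      · rintro U V ((hUV | ⟨e, he, hUV⟩) | ⟨x, y, hxy, rfl, rfl⟩)
        · exact .inl hUV
        · refine .inr ⟨e, List.mem_cons_of_mem _ (List.mem_cons_of_mem _ he), ?_⟩
          rwa [Function.update_of_ne (hea e he), Function.update_of_ne (heb e he)]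
        · cases hxy with
          | inl hxy =>
            refine .inr ⟨a, List.mem_cons_self, _, _, ?_, rfl, rfl⟩
            rwa [Function.update_self]
          | inr hxy =>
            refine .inr ⟨b, List.mem_cons_of_mem _ List.mem_cons_self, _, _, ?_, rfl, rfl⟩
            rwa [Function.update_of_ne hab.symm, Function.update_self]
    have hd : Acyclic (G.Step ⊔ r) :=
      (hr ⊥ ⊥ (Formula.sem_bot _ _) (Formula.sem_bot _ _)).mono fun _ _ => .inl
    have hres : Acyclic (pull (G.atomAt₂ a b) (Relation.TransGen (G.Step ⊔ r)) ⊔ T none) := by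
      refine (hnone (pull (G.atomAt₂ a b) (Relation.TransGen (G.Step ⊔ r))) ?_).mono
        fun _ _ => Or.symm
      rintro _ ⟨S, S', hS, hS', rfl⟩
      exact acyclic_pull_sup (hr S S' hS hS')
    refine acyclic_addBin hab hca hcb (acyclic_sup_push (atomAt₂_injective hab) hd hres)
      fun U V hUV => ?_
    rcases tests_addBin hUV with hUV | ⟨x, y, hxy, rfl, rfl⟩
    · exact .inl (by subst hT'; exact hUV)
    · exact .inr ⟨x, y, hxy, glue_atomAt_par x, glue_atomAt_par y⟩

end Bin

theorem Net.tensor {G H : ProofGraph α} {a : G.E} {es : List G.E} {b : H.E} {ds : List H.E}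
    (hG : G.Net (a :: es)) (hH : H.Net (b :: ds)) :
    ((G.union H).addBin .tensor (Sum.inl a) (Sum.inr b)).Net
      (none :: (es.map Sum.inl ++ ds.map Sum.inr : List (G.E ⊕ H.E)).map some :
        List (Option (G.E ⊕ H.E))) := by
  have ha := (hG.concl a List.mem_cons_self).union_inl (H := H)
  have hb := (hH.concl b List.mem_cons_self).union_inr (G := G)
  obtain ⟨hae, hes⟩ := List.nodup_cons.1 hG.nodup
  obtain ⟨hbd, hds⟩ := List.nodup_cons.1 hH.nodup
  have hab : (Sum.inl a : G.E ⊕ H.E) ≠ Sum.inr b := nofun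
  refine ⟨?_, ?_, ?_⟩
  · refine nodup_none_cons ?_
    refine (hes.map Sum.inl_injective).append (hds.map Sum.inr_injective) fun e he he' => ?_
    obtain ⟨d, -, rfl⟩ := List.mem_map.1 he
    obtain ⟨d', -, h⟩ := List.mem_map.1 he'
    exact absurd h nofun
  · intro e he
    rcases List.mem_cons.1 he with rfl | he
    · exact isConcl_addBin_none
    obtain ⟨e', he', rfl⟩ := List.mem_map.1 he
    rcases List.mem_append.1 he' with he' | he'
    · obtain ⟨d, hd, rfl⟩ := List.mem_map.1 he'
      refine (hG.concl d (List.mem_cons_of_mem _ hd)).union_inl.addBin ?_ nofun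
      intro h
      exact hae (Sum.inl.inj h ▸ hd)
    · obtain ⟨d, hd, rfl⟩ := List.mem_map.1 he'
      refine (hH.concl d (List.mem_cons_of_mem _ hd)).union_inr.addBin nofun ?_
      intro h
      exact hbd (Sum.inr.inj h ▸ hd)
  · intro T hT
    have hnone : Orth (Tens ((G.label a).Sem true) ((H.label b).Sem true)) (T none) :=
      hT none List.mem_cons_self
    obtain ⟨R, S, hR, hS, hacyc, hres⟩ := hG.union_sem hH (T := fun e => T (some e))
      fun e he => hT (some e) (List.mem_cons_of_mem _ (List.mem_map_of_mem he))
    have hres' : Acyclic (pull ((G.union H).atomAt₂ (Sum.inl a) (Sum.inr b))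
        (Relation.TransGen ((G.union H).Step ⊔ (G.union H).Tests
          (es.map Sum.inl ++ ds.map Sum.inr : List (G.E ⊕ H.E)) fun e => T (some e))) ⊔ T none) := by
      refine (hnone _ ⟨R, S, hR, hS, rfl⟩).mono ?_
      rintro x y (hxy | hxy)
      · exact .inr (hres x y hxy)
      · exact .inl hxy
    refine acyclic_addBin (G := G.union H) hab ha hb
      (acyclic_sup_push (atomAt₂_injective hab) hacyc hres') fun U V hUV => ?_
    rcases tests_addBin hUV with hUV | ⟨x, y, hxy, rfl, rfl⟩
    · exact .inl hUV
    · exact .inr ⟨x, y, hxy, glue_atomAt_tensor (G := G.union H) x,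
        glue_atomAt_tensor (G := G.union H) y⟩

end ProofGraph

theorem Translation.net {α : Type u} {Θ : List (Formula α)} {p : SequentProof Θ}
    {G : ProofGraph α} {es : List G.E} (h : Translation p G es) :
    es.map G.label = Θ ∧ G.Net es := by
  induction h with
  | ax A => exact ⟨rfl, ProofGraph.net_axGraph A⟩
  | exch h hlen ih =>
    obtain ⟨hl, hn⟩ := ih
    refine ⟨?_, hn.perm (List.Perm.append_left _ (List.Perm.swap _ _ _))⟩
    rw [List.map_append] at hl ⊢
    obtain ⟨h1, h2⟩ := List.append_inj hl (by simpa using hlen)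
    simp only [List.map_cons, List.cons.injEq] at h2 ⊢
    rw [h1, h2.1, h2.2.1, h2.2.2]
  | cut hp hq ihp ihq =>
    obtain ⟨hl, hn⟩ := ihp
    obtain ⟨hl', hn'⟩ := ihq
    obtain ⟨h1, h2⟩ := List.cons.inj hl
    obtain ⟨h1', h2'⟩ := List.cons.inj hl'
    refine ⟨?_, hn.addCut hn' (h1'.trans (congrArg Formula.neg h1.symm))⟩
    refine List.map_append.trans (congrArg₂ (· ++ ·) ?_ ?_)
    · exact List.map_map.trans h2
    · exact List.map_map.trans h2'
  | tensor hp hq ihp ihq =>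
    obtain ⟨hl, hn⟩ := ihp
    obtain ⟨hl', hn'⟩ := ihq
    obtain ⟨h1, h2⟩ := List.cons.inj hl
    obtain ⟨h1', h2'⟩ := List.cons.inj hl'
    refine ⟨?_, ?_⟩
    · refine congrArg₂ List.cons (congrArg₂ Formula.tensor h1 h1') ?_
      refine List.map_append.trans (congrArg₂ (· ++ ·) ?_ ?_)
      · exact List.map_map.trans h2
      · exact List.map_map.trans h2'
    · have := hn.tensor hn'
      rwa [List.map_append, List.map_map, List.map_map] at this
  | par h ih =>
    obtain ⟨hl, hn⟩ := ih
    obtain ⟨h1, h2⟩ := List.cons.inj hl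
    obtain ⟨h2, h3⟩ := List.cons.inj h2
    refine ⟨?_, hn.par⟩
    exact congrArg₂ List.cons (congrArg₂ Formula.par h1 h2) (List.map_map.trans h3)

namespace ProofGraph

variable {α : Type u} {G H : ProofGraph α}

/-- The map on atoms given by an isomorphism. -/
def Iso.atom (f : Iso G H) (U : G.Atom) : H.Atom :=
  ⟨f.edge U.1, Fin.cast (by rw [f.label_eq]) U.2⟩

theorem Iso.sign_atom (f : Iso G H) (U : G.Atom) : H.sign (f.atom U) = G.sign U := by
  simp [sign, Iso.atom, f.label_eq]

theorem Iso.len_edge (f : Iso G H) (e : G.E) : H.len (f.edge e) = G.len e := by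
  rw [len, f.label_eq]

theorem Iso.desc (f : Iso G H) {U V : G.Atom} (h : G.Desc U V) : H.Desc (f.atom U) (f.atom V) := by
  obtain ⟨t, ht⟩ := h.node
  have hr : H.isRight (f.atom U).1 = G.isRight U.1 := f.isRight_eq _ t ht
  refine ⟨⟨t, ?_⟩, ?_, fun h' => h.left (hr ▸ h'), fun h' => ?_⟩
  · rw [Iso.atom, f.target_eq, f.node_eq, ht]
  · simp only [Iso.atom, f.target_eq, f.source_eq, h.source]
  · simpa [Iso.atom, f.len_edge] using h.right (hr ▸ h')

theorem Iso.step (f : Iso G H) {U V : G.Atom} (h : G.Step U V) : H.Step (f.atom U) (f.atom V) := by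
  cases h with
  | ax h hU hV =>
    refine .ax ⟨?_, ?_, fun h' => h.ne (f.edge.injective h'), ?_⟩ ((f.sign_atom U).trans hU)
      ((f.sign_atom V).trans hV)
    · rw [Iso.atom, f.source_eq, f.node_eq, h.node]
    · simp only [Iso.atom, f.source_eq, h.same]
    · simpa [Iso.atom, f.len_edge] using h.sum
  | cut h hU hV =>
    refine .cut ⟨?_, ?_, fun h' => h.ne (f.edge.injective h'), ?_⟩ ((f.sign_atom U).trans hU)
      ((f.sign_atom V).trans hV)
    · rw [Iso.atom, f.target_eq, f.node_eq, h.node]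
    · simp only [Iso.atom, f.target_eq, h.same]
    · simpa [Iso.atom, f.len_edge] using h.sum
  | down h hU hV => exact .down (f.desc h) ((f.sign_atom U).trans hU) ((f.sign_atom V).trans hV)
  | up h hU hV => exact .up (f.desc h) ((f.sign_atom U).trans hU) ((f.sign_atom V).trans hV)

end ProofGraph

theorem ProofStructure.IsProofNet.acyclic_step {α : Type u} {π : ProofStructure α}
    (h : π.IsProofNet) : Acyclic π.Step := by
  obtain ⟨Θ, p, G, es, hp, ⟨f⟩⟩ := h
  exact hp.net.2.acyclic_step.of_map f.atom fun _ _ => f.step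

variable {α : Type u}

theorem Formula.snd_get_neg {A B : Formula α} (h : B = A.neg) (i : Fin A.atoms.length)
    (j : Fin B.atoms.length) (hij : (i : ℕ) + j + 1 = A.atoms.length) :
    (B.atoms.get j).2 = !(A.atoms.get i).2 := by
  subst h
  have hi : A.atoms.length - 1 - j = i := by omega
  rw [List.get_eq_getElem, List.getElem_of_eq A.atoms_neg]
  simp [hi]

theorem Formula.get_form_left {A B D : Formula α} {t : Conn} (h : D = t.form A B)
    (i : Fin A.atoms.length) (j : Fin D.atoms.length) (hij : (j : ℕ) = i) :
    D.atoms.get j = A.atoms.get i := by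
  subst h
  have : (t.form A B).atoms = A.atoms ++ B.atoms := by cases t <;> rfl
  rw [List.get_eq_getElem, List.getElem_of_eq this, List.getElem_append_left (by omega)]
  simp [hij]

theorem Formula.get_form_right {A B D : Formula α} {t : Conn} (h : D = t.form A B)
    (i : Fin B.atoms.length) (j : Fin D.atoms.length) (hij : (j : ℕ) = A.atoms.length + i) :
    D.atoms.get j = B.atoms.get i := by
  subst h
  have : (t.form A B).atoms = A.atoms ++ B.atoms := by cases t <;> rfl
  rw [List.get_eq_getElem, List.getElem_of_eq this, List.getElem_append_right (by omega)]
  simp [hij]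

namespace ProofGraph

variable {G : ProofGraph α}

theorem atom_ext {U V : G.Atom} (h : U.1 = V.1) (h' : (U.2 : ℕ) = V.2) : U = V := by
  obtain ⟨e, i⟩ := U
  obtain ⟨d, j⟩ := V
  cases h
  exact congrArg (Sigma.mk e) (Fin.ext h')

theorem IsAx.symm {w : G.V} {e e' : G.E} (h : G.IsAx w e e') : G.IsAx w e' e :=
  ⟨h.node, h.ne.symm, h.premise, fun d => (h.conclusion d).trans or_comm, by
    rw [h.label, Formula.neg_neg]⟩

theorem IsCut.symm {w : G.V} {e e' : G.E} (h : G.IsCut w e e') : G.IsCut w e' e :=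
  ⟨h.node, h.ne.symm, fun d => (h.premise d).trans or_comm, h.conclusion, by
    rw [h.label, Formula.neg_neg]⟩

theorem IsBin.len_eq {t : Conn} {w : G.V} {l r d : G.E} (h : G.IsBin t w l r d) :
    G.len d = G.len l + G.len r := by
  rw [len, h.label, t.length_atoms_form]

theorem len_of_label_neg {e e' : G.E} (h : G.label e' = (G.label e).neg) : G.len e' = G.len e := by
  rw [len, h, Formula.length_atoms_neg]

end ProofGraph

namespace ProofStructure

open ProofGraph

variable {π : ProofStructure α} {U V V' : π.Atom}

theorem isAx_of_opp (h : π.Opp π.source .ax U V) : π.IsAx (π.source U.1) U.1 V.1 := by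
  obtain ⟨e, e', he⟩ := π.ax_spec _ h.node
  have := h.ne
  rcases (he.conclusion U.1).1 rfl with h1 | h1 <;> rcases (he.conclusion V.1).1 h.same with h2 | h2
  · exact absurd (h2.trans h1.symm) this
  · rw [h1, h2]
    exact h1 ▸ he
  · rw [h1, h2]
    exact h1 ▸ he.symm
  · exact absurd (h2.trans h1.symm) this

theorem isCut_of_opp (h : π.Opp π.target .cut U V) : π.IsCut (π.target U.1) U.1 V.1 := by
  obtain ⟨e, e', he⟩ := π.cut_spec _ h.node
  have := h.ne
  rcases (he.premise U.1).1 rfl with h1 | h1 <;> rcases (he.premise V.1).1 h.same with h2 | h2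
  · exact absurd (h2.trans h1.symm) this
  · rw [h1, h2]
    exact h1 ▸ he
  · rw [h1, h2]
    exact h1 ▸ he.symm
  · exact absurd (h2.trans h1.symm) this

theorem opp_of_isAx {w : π.V} {e e' : π.E} (h : π.IsAx w e e') (i : Fin (π.len e))
    (j : Fin (π.len e')) (hij : (i : ℕ) + j + 1 = π.len e) : π.Opp π.source .ax ⟨e, i⟩ ⟨e', j⟩ := by
  have h1 := (h.conclusion e).2 (.inl rfl)
  have h2 := (h.conclusion e').2 (.inr rfl)
  exact ⟨by rw [h1, h.node], h2.trans h1.symm, h.ne.symm, hij⟩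

theorem opp_of_isCut {w : π.V} {e e' : π.E} (h : π.IsCut w e e') (i : Fin (π.len e))
    (j : Fin (π.len e')) (hij : (i : ℕ) + j + 1 = π.len e) :
    π.Opp π.target .cut ⟨e, i⟩ ⟨e', j⟩ := by
  have h1 := (h.premise e).2 (.inl rfl)
  have h2 := (h.premise e').2 (.inr rfl)
  exact ⟨by rw [h1, h.node], h2.trans h1.symm, h.ne.symm, hij⟩

theorem opp_ax_symm (h : π.Opp π.source .ax U V) : π.Opp π.source .ax V U := by
  have hax := isAx_of_opp h
  refine opp_of_isAx hax.symm V.2 U.2 ?_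
  have h1 := len_of_label_neg hax.label
  have h2 := h.sum
  omega

theorem opp_cut_symm (h : π.Opp π.target .cut U V) : π.Opp π.target .cut V U := by
  have hcut := isCut_of_opp h
  refine opp_of_isCut hcut.symm V.2 U.2 ?_
  have h1 := len_of_label_neg hcut.label
  have h2 := h.sum
  omega

theorem sign_of_opp_ax (h : π.Opp π.source .ax U V) : π.sign V = !π.sign U :=
  Formula.snd_get_neg (isAx_of_opp h).label _ _ h.sum

theorem sign_of_opp_cut (h : π.Opp π.target .cut U V) : π.sign V = !π.sign U :=
  Formula.snd_get_neg (isCut_of_opp h).label _ _ h.sum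

theorem opp_ax_unique (h : π.Opp π.source .ax U V) (h' : π.Opp π.source .ax U V') : V = V' := by
  have h1 : V'.1 = V.1 := (((isAx_of_opp h).conclusion V'.1).1 h'.same).resolve_left h'.ne
  have h2 := h.sum
  have h3 := h'.sum
  exact atom_ext h1.symm (by omega)

theorem opp_cut_unique (h : π.Opp π.target .cut U V) (h' : π.Opp π.target .cut U V') : V = V' := by
  have h1 : V'.1 = V.1 := (((isCut_of_opp h).premise V'.1).1 h'.same).resolve_left h'.ne
  have h2 := h.sum
  have h3 := h'.sum
  exact atom_ext h1.symm (by omega)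

theorem desc_left {t : Conn} {w : π.V} {l r d : π.E} (h : π.IsBin t w l r d) (i : Fin (π.len l))
    (j : Fin (π.len d)) (hij : (j : ℕ) = i) : π.Desc ⟨l, i⟩ ⟨d, j⟩ := by
  have h1 := (h.premise l).2 (.inl rfl)
  refine ⟨⟨t, by rw [h1, h.node]⟩, ((h.conclusion d).2 rfl).trans h1.symm, fun _ => hij, fun hr => ?_⟩
  rw [h.left] at hr
  exact absurd hr nofun

theorem desc_right {t : Conn} {w : π.V} {l r d : π.E} (h : π.IsBin t w l r d) (i : Fin (π.len r))
    (j : Fin (π.len d)) (hij : (j : ℕ) = π.len l + i) : π.Desc ⟨r, i⟩ ⟨d, j⟩ := by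
  have h1 := (h.premise r).2 (.inr rfl)
  refine ⟨⟨t, by rw [h1, h.node]⟩, ((h.conclusion d).2 rfl).trans h1.symm, fun hr => ?_, fun _ => ?_⟩
  · rw [h.right] at hr
    exact absurd hr nofun
  · have := h.len_eq
    change (j : ℕ) + π.len r = π.len d + i
    omega

/-- The link between `U` and `V`, when `V` corresponds to `U` in the conclusion. -/
theorem exists_isBin_of_desc (h : π.Desc U V) : ∃ t l r, π.IsBin t (π.target U.1) l r V.1 ∧
    ((U.1 = l ∧ (V.2 : ℕ) = U.2) ∨ (U.1 = r ∧ (V.2 : ℕ) = π.len l + U.2)) := by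
  obtain ⟨t, ht⟩ := h.node
  obtain ⟨l, r, d, hb⟩ := π.bin_spec t _ ht
  obtain rfl := (hb.conclusion V.1).1 h.source
  refine ⟨t, l, r, hb, ?_⟩
  rcases (hb.premise U.1).1 rfl with h1 | h1
  · exact .inl ⟨h1, h.left (h1 ▸ hb.left)⟩
  · refine .inr ⟨h1, ?_⟩
    have h2 := h.right (h1 ▸ hb.right)
    have h3 := hb.len_eq
    rw [← h1] at h3
    omega

theorem linked_of_desc (h : π.Desc U V) : π.Linked U V := by
  obtain ⟨t, l, r, hb, ⟨h1, h2⟩ | ⟨h1, h2⟩⟩ := exists_isBin_of_desc h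
  · subst h1
    exact .left hb _ _ h2
  · subst h1
    exact .right hb _ _ h2

theorem sign_of_desc (h : π.Desc U V) : π.sign V = π.sign U := by
  obtain ⟨t, l, r, hb, ⟨h1, h2⟩ | ⟨h1, h2⟩⟩ := exists_isBin_of_desc h
  · subst h1
    exact congrArg Prod.snd (Formula.get_form_left hb.label _ _ h2)
  · subst h1
    exact congrArg Prod.snd (Formula.get_form_right hb.label _ _ h2)

theorem desc_right_unique (h : π.Desc U V) (h' : π.Desc U V') : V = V' := by
  obtain ⟨t, l, r, hb, h1⟩ := exists_isBin_of_desc h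
  have he : V'.1 = V.1 := (hb.conclusion V'.1).1 h'.source
  refine atom_ext he.symm ?_
  rcases hr : π.isRight U.1 with _ | _
  · rw [h.left hr, h'.left hr]
  · have h2 := h.right hr
    have h3 := h'.right hr
    have h4 : π.len V'.1 = π.len V.1 := congrArg π.len he
    omega

theorem desc_left_unique {U' : π.Atom} (h : π.Desc U V) (h' : π.Desc U' V) : U = U' := by
  obtain ⟨t, l, r, hb, h1⟩ := exists_isBin_of_desc h
  obtain ⟨t', l', r', hb', h1'⟩ := exists_isBin_of_desc h'
  have ht : π.target U'.1 = π.target U.1 := h'.source.symm.trans h.source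
  have h3 := (hb.premise l').1 (((hb'.premise l').2 (.inl rfl)).trans ht)
  have h4 := (hb.premise r').1 (((hb'.premise r').2 (.inr rfl)).trans ht)
  have hll : l' = l := h3.resolve_right fun h => by
    have := hb'.left
    rw [h, hb.right] at this
    exact absurd this nofun
  have hrr : r' = r := h4.resolve_left fun h => by
    have := hb'.right
    rw [h, hb.left] at this
    exact absurd this nofun
  subst hll hrr
  have hU := U.2.2
  have hU' := U'.2.2
  rcases h1 with ⟨h1, h2⟩ | ⟨h1, h2⟩ <;> rcases h1' with ⟨h1', h2'⟩ | ⟨h1', h2'⟩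
  · exact atom_ext (h1.trans h1'.symm) (by omega)
  · have h5 : π.len U.1 = π.len l' := congrArg π.len h1
    simp only [len] at *
    omega
  · have h5 : π.len U'.1 = π.len l' := congrArg π.len h1'
    simp only [len] at *
    omega
  · exact atom_ext (h1.trans h1'.symm) (by omega)

theorem sim_of_step (h : π.Step U V) : π.Sim U V := by
  cases h with
  | ax h => exact .inl (.ax (isAx_of_opp h) _ _ h.sum)
  | cut h => exact .inl (.cut (isCut_of_opp h) _ _ h.sum)
  | down h => exact .inl (linked_of_desc h)
  | up h => exact .inr (linked_of_desc h)

theorem step_or_step_of_desc (h : π.Desc U V) : π.Step U V ∨ π.Step V U := by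
  have hs := sign_of_desc h
  cases hU : π.sign U
  · exact .inr (.up h (hs.trans hU) hU)
  · exact .inl (.down h hU (hs.trans hU))

theorem step_or_step_of_linked (h : π.Linked U V) : π.Step U V ∨ π.Step V U := by
  cases h with
  | @ax w e e' h i j hij =>
    have ho := opp_of_isAx h i j hij
    have hs := sign_of_opp_ax ho
    cases hU : π.sign ⟨e, i⟩
    · exact .inl (.ax ho hU (by rw [hs, hU]; rfl))
    · exact .inr (.ax (opp_ax_symm ho) (by rw [hs, hU]; rfl) hU)
  | @cut w e e' h i j hij =>
    have ho := opp_of_isCut h i j hij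
    have hs := sign_of_opp_cut ho
    cases hU : π.sign ⟨e, i⟩
    · exact .inr (.cut (opp_cut_symm ho) (by rw [hs, hU]; rfl) hU)
    · exact .inl (.cut ho hU (by rw [hs, hU]; rfl))
  | left h i j hij => exact step_or_step_of_desc (desc_left h i j hij)
  | right h i j hij => exact step_or_step_of_desc (desc_right h i j hij)

theorem sim_iff : π.Sim U V ↔ π.Step U V ∨ π.Step V U := by
  constructor
  · rintro (h | h)
    · exact step_or_step_of_linked h
    · exact (step_or_step_of_linked h).symm
  · rintro (h | h)
    · exact sim_of_step h
    · exact (sim_of_step h).symm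

theorem node_ne_of_desc (h : π.Desc U V) : π.node (π.target U.1) ≠ .ax ∧
    π.node (π.target U.1) ≠ .cut ∧ π.node (π.target U.1) ≠ .c := by
  obtain ⟨t, ht⟩ := h.node
  rw [ht]
  exact Conn.node_ne t

theorem step_right_unique (h : π.Step U V) (h' : π.Step U V') : V = V' := by
  cases h with
  | ax h hU hV =>
    cases h' with
    | ax h' => exact opp_ax_unique h h'
    | cut h' hU' => exact absurd (hU.symm.trans hU') nofun
    | down h' hU' => exact absurd (hU.symm.trans hU') nofun
    | up h' => exact absurd (h'.source ▸ h.node) (node_ne_of_desc h').1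
  | cut h hU hV =>
    cases h' with
    | ax h' hU' => exact absurd (hU.symm.trans hU') nofun
    | cut h' => exact opp_cut_unique h h'
    | down h' => exact absurd h.node (node_ne_of_desc h').2.1
    | up h' hU' => exact absurd (hU.symm.trans hU') nofun
  | down h hU hV =>
    cases h' with
    | ax h' hU' => exact absurd (hU.symm.trans hU') nofun
    | cut h' => exact absurd h'.node (node_ne_of_desc h).2.1
    | down h' => exact desc_right_unique h h'
    | up h' hU' => exact absurd (hU.symm.trans hU') nofun
  | up h hU hV =>
    cases h' with
    | ax h' => exact absurd (h.source ▸ h'.node) (node_ne_of_desc h).1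
    | cut h' hU' => exact absurd (hU.symm.trans hU') nofun
    | down h' hU' => exact absurd (hU.symm.trans hU') nofun
    | up h' => exact desc_left_unique h h'

theorem step_left_unique {U' : π.Atom} (h : π.Step U V) (h' : π.Step U' V) : U = U' := by
  cases h with
  | ax h hU hV =>
    cases h' with
    | ax h' => exact opp_ax_unique (opp_ax_symm h) (opp_ax_symm h')
    | cut h' _ hV' => exact absurd (hV.symm.trans hV') nofun
    | down h' => exact absurd (h'.source ▸ (opp_ax_symm h).node) (node_ne_of_desc h').1
    | up h' _ hV' => exact absurd (hV.symm.trans hV') nofun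
  | cut h hU hV =>
    cases h' with
    | ax h' _ hV' => exact absurd (hV.symm.trans hV') nofun
    | cut h' => exact opp_cut_unique (opp_cut_symm h) (opp_cut_symm h')
    | down h' _ hV' => exact absurd (hV.symm.trans hV') nofun
    | up h' => exact absurd (opp_cut_symm h).node (node_ne_of_desc h').2.1
  | down h hU hV =>
    cases h' with
    | ax h' => exact absurd (h.source ▸ (opp_ax_symm h').node) (node_ne_of_desc h).1
    | cut h' _ hV' => exact absurd (hV.symm.trans hV') nofun
    | down h' => exact desc_left_unique h h'
    | up h' _ hV' => exact absurd (hV.symm.trans hV') nofun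
  | up h hU hV =>
    cases h' with
    | ax h' _ hV' => exact absurd (hV.symm.trans hV') nofun
    | cut h' => exact absurd (opp_cut_symm h').node (node_ne_of_desc h).2.1
    | down h' _ hV' => exact absurd (hV.symm.trans hV') nofun
    | up h' => exact desc_right_unique h h'

theorem exists_source_neighbour (U : π.Atom) :
    (∃ V, π.Opp π.source .ax U V) ∨ ∃ V, π.Desc V U := by
  obtain ⟨d, i⟩ := U
  have hbin : ∀ t : Conn, π.node (π.source d) = t.node → ∃ V, π.Desc V ⟨d, i⟩ := by
    intro t ht
    obtain ⟨l, r, d', hb⟩ := π.bin_spec t _ ht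
    obtain rfl := (hb.conclusion d).1 rfl
    have h1 := hb.len_eq
    have h2 : (i : ℕ) < π.len d := i.2
    by_cases hi : (i : ℕ) < π.len l
    · exact ⟨⟨l, ⟨i, hi⟩⟩, desc_left hb ⟨i, hi⟩ i rfl⟩
    · exact ⟨⟨r, ⟨i - π.len l, by simp only [len] at *; omega⟩⟩, desc_right hb _ i (by simp only; omega)⟩
  cases hn : π.node (π.source d) with
  | ax =>
    left
    obtain ⟨e, e', h⟩ := π.ax_spec _ hn
    have key : ∀ e', π.IsAx (π.source d) d e' → ∃ V, π.Opp π.source .ax ⟨d, i⟩ V := by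
      intro e' h
      have h1 := len_of_label_neg h.label
      have h2 : (i : ℕ) < π.len d := i.2
      exact ⟨⟨e', ⟨π.len d - 1 - i, by simp only [len] at *; omega⟩⟩,
        opp_of_isAx h i _ (by simp only; omega)⟩
    rcases (h.conclusion d).1 rfl with h' | h'
    · exact key e' (h' ▸ h)
    · exact key e (h' ▸ h.symm)
  | cut =>
    obtain ⟨e, e', h⟩ := π.cut_spec _ hn
    exact absurd rfl (h.conclusion d)
  | tensor => exact .inr (hbin .tensor hn)
  | par => exact .inr (hbin .par hn)
  | c =>
    obtain ⟨e, h⟩ := π.concl_spec _ hn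
    exact absurd rfl (h.conclusion d)

theorem exists_target_neighbour (U : π.Atom) (hc : π.node (π.target U.1) ≠ .c) :
    (∃ V, π.Opp π.target .cut U V) ∨ ∃ V, π.Desc U V := by
  obtain ⟨d, i⟩ := U
  dsimp only at hc
  have h2 : (i : ℕ) < π.len d := i.2
  have hbin : ∀ t : Conn, π.node (π.target d) = t.node → ∃ V, π.Desc ⟨d, i⟩ V := by
    intro t ht
    obtain ⟨l, r, d', hb⟩ := π.bin_spec t _ ht
    have h1 := hb.len_eq
    rcases (hb.premise d).1 rfl with rfl | rfl
    · exact ⟨⟨d', ⟨i, by simp only [len] at *; omega⟩⟩, desc_left hb i _ rfl⟩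
    · exact ⟨⟨d', ⟨π.len l + i, by simp only [len] at *; omega⟩⟩, desc_right hb i _ rfl⟩
  cases hn : π.node (π.target d) with
  | ax =>
    obtain ⟨e, e', h⟩ := π.ax_spec _ hn
    exact absurd rfl (h.premise d)
  | cut =>
    left
    obtain ⟨e, e', h⟩ := π.cut_spec _ hn
    have key : ∀ e', π.IsCut (π.target d) d e' → ∃ V, π.Opp π.target .cut ⟨d, i⟩ V := by
      intro e' h
      have h1 := len_of_label_neg h.label
      exact ⟨⟨e', ⟨π.len d - 1 - i, by simp only [len] at *; omega⟩⟩,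
        opp_of_isCut h i _ (by simp only; omega)⟩
    rcases (h.premise d).1 rfl with h' | h'
    · exact key e' (h' ▸ h)
    · exact key e (h' ▸ h.symm)
  | tensor => exact .inr (hbin .tensor hn)
  | par => exact .inr (hbin .par hn)
  | c => exact absurd hn hc

/-- Every atom has a successor, except the positive ones of the conclusions. -/
theorem exists_step (U : π.Atom) (hc : π.sign U = true → π.node (π.target U.1) ≠ .c) :
    ∃ V, π.Step U V := by
  cases hU : π.sign U
  · rcases exists_source_neighbour U with ⟨V, h⟩ | ⟨V, h⟩
    · exact ⟨V, .ax h hU (by rw [sign_of_opp_ax h, hU]; rfl)⟩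
    · exact ⟨V, .up h hU ((sign_of_desc h).symm.trans hU)⟩
  · rcases exists_target_neighbour U (hc hU) with ⟨V, h⟩ | ⟨V, h⟩
    · exact ⟨V, .cut h hU (by rw [sign_of_opp_cut h, hU]; rfl)⟩
    · exact ⟨V, .down h hU ((sign_of_desc h).trans hU)⟩

/-- Every atom has a predecessor, except the negative ones of the conclusions. -/
theorem exists_step_to (V : π.Atom) (hc : π.sign V = false → π.node (π.target V.1) ≠ .c) :
    ∃ U, π.Step U V := by
  cases hV : π.sign V
  · rcases exists_target_neighbour V (hc hV) with ⟨U, h⟩ | ⟨U, h⟩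
    · exact ⟨U, .cut (opp_cut_symm h) (by rw [sign_of_opp_cut h, hV]; rfl) hV⟩
    · exact ⟨U, .up h ((sign_of_desc h).trans hV) hV⟩
  · rcases exists_source_neighbour V with ⟨U, h⟩ | ⟨U, h⟩
    · exact ⟨U, .ax (opp_ax_symm h) (by rw [sign_of_opp_ax h, hV]; rfl) hV⟩
    · exact ⟨U, .down h ((sign_of_desc h).symm.trans hV) hV⟩

theorem not_step_of_positive_conclusion (hU : π.sign U = true)
    (hc : π.node (π.target U.1) = .c) : ¬ π.Step U V := by
  intro h
  cases h with
  | ax h hU' => exact absurd (hU.symm.trans hU') nofun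
  | cut h => exact absurd (hc.symm.trans h.node) nofun
  | down h => exact (node_ne_of_desc h).2.2 hc
  | up h hU' => exact absurd (hU.symm.trans hU') nofun

theorem not_step_to_negative_conclusion (hV : π.sign V = false)
    (hc : π.node (π.target V.1) = .c) : ¬ π.Step U V := by
  intro h
  cases h with
  | ax h _ hV' => exact absurd (hV.symm.trans hV') nofun
  | cut h => exact absurd (hc.symm.trans (opp_cut_symm h).node) nofun
  | down h _ hV' => exact absurd (hV.symm.trans hV') nofun
  | up h => exact (node_ne_of_desc h).2.2 hc

end ProofStructure

/-! ### Lists in which one element comes before another one -/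

section Pre

variable {σ : Type*}

/-- `U` occurs in `L`, and before the first occurrence of `V`. -/
def Pre (L : List σ) (U V : σ) : Prop := ∃ l₁ l₂, L = l₁ ++ U :: l₂ ∧ V ∉ l₁

theorem Pre.before {σ : Type} {L : List σ} {U V : σ} (h : Pre L U V) (hne : U ≠ V) :
    Before L U V := by
  classical
  obtain ⟨l₁, l₂, rfl, hV⟩ := h
  rw [Before, List.idxOf_append_of_notMem hV, List.idxOf_cons_ne _ hne]
  by_cases hU : U ∈ l₁
  · rw [List.idxOf_append_of_mem hU]
    have := List.idxOf_lt_length_of_mem hU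
    omega
  · rw [List.idxOf_append_of_notMem hU, List.idxOf_cons_self]
    omega

theorem Pre.filter {L : List σ} {U V : σ} (h : Pre L U V) {p : σ → Bool} (hU : p U) :
    Pre (L.filter p) U V := by
  obtain ⟨l₁, l₂, rfl, hV⟩ := h
  refine ⟨l₁.filter p, l₂.filter p, ?_, fun h => hV (List.mem_of_mem_filter h)⟩
  rw [List.filter_append, List.filter_cons_of_pos hU]

theorem Pre.append_right {L : List σ} {U V : σ} (h : Pre L U V) (L' : List σ) :
    Pre (L ++ L') U V := by
  obtain ⟨l₁, l₂, rfl, hV⟩ := h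
  exact ⟨l₁, l₂ ++ L', by simp, hV⟩

theorem Pre.append_left {L' : List σ} {U V : σ} (h : Pre L' U V) {L : List σ} (hV : V ∉ L) :
    Pre (L ++ L') U V := by
  obtain ⟨l₁, l₂, rfl, hV'⟩ := h
  exact ⟨L ++ l₁, l₂, by simp, by simp [hV, hV']⟩

theorem Pre.flatten {Ls : List (List σ)} {U V : σ} (h : ∀ L ∈ Ls, V ∈ L → Pre L U V)
    (hV : ∃ L ∈ Ls, V ∈ L) : Pre Ls.flatten U V := by
  induction Ls with
  | nil => simp at hV
  | cons L Ls ih =>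
    rw [List.flatten_cons]
    by_cases hL : V ∈ L
    · exact (h L List.mem_cons_self hL).append_right _
    · refine (ih (fun L hL => h L (List.mem_cons_of_mem _ hL)) ?_).append_left hL
      obtain ⟨L', hL', hV⟩ := hV
      rcases List.mem_cons.1 hL' with rfl | hL'
      · exact absurd hV hL
      · exact ⟨L', hL', hV⟩

end Pre

theorem isChain_step_of_isChain_sim {σ : Type*} {R S : σ → σ → Prop}
    (hS : ∀ x y, S x y → R x y ∨ R y x) (hR : ∀ {x y z}, R x z → R y z → x = y) (P : List σ)
    (hnd : P.Nodup) (hP : P.IsChain S) (hhead : ∀ x y, P.head? = some y → R x y → x ∉ P) :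
    P.IsChain R := by
  induction P with
  | nil => exact .nil
  | cons x P ih =>
    cases P with
    | nil => exact .singleton x
    | cons y l =>
      rw [List.isChain_cons_cons] at hP ⊢
      have hxy : R x y := (hS x y hP.1).resolve_right fun hyx =>
        hhead y x rfl hyx (by simp)
      refine ⟨hxy, ih (List.nodup_cons.1 hnd).2 hP.2 fun z w hw hzw => ?_⟩
      obtain rfl : y = w := by simpa using hw
      rw [hR hzw hxy]
      exact (List.nodup_cons.1 hnd).1

variable {α : Type u}

namespace ProofStructure

open ProofGraph Relation

variable {π : ProofStructure α} {e : π.E}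

instance : Finite π.Atom := by
  have := π.finite_E
  infer_instance

theorem eq_conclusion (he : π.IsSingleConclusion e) {U : π.Atom}
    (hU : π.node (π.target U.1) = .c) : ∃ i, U = ⟨e, i⟩ := by
  obtain ⟨d, i⟩ := U
  obtain rfl := (he d).1 hU
  exact ⟨i, rfl⟩

/-- Being connected to an atom without successor does not depend on the atom within its class. -/
theorem reflTransGen_iff_of_eqvGen {U W V : π.Atom} (hV : ∀ W, ¬ π.Step V W)
    (h : EqvGen π.Sim U W) : ReflTransGen π.Step U V ↔ ReflTransGen π.Step W V := by
  have key : ∀ {U W}, π.Step U W → (ReflTransGen π.Step U V ↔ ReflTransGen π.Step W V) := by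
    intro U W hUW
    refine ⟨fun h => ?_, fun h => .head hUW h⟩
    rcases h.cases_head with rfl | ⟨W', hW', h⟩
    · exact absurd hUW (hV W)
    · rwa [step_right_unique hUW hW']
  induction h with
  | rel U W h =>
    rcases sim_iff.1 h with h | h
    · exact key h
    · exact (key h).symm
  | refl => exact Iff.rfl
  | symm _ _ _ ih => exact ih.symm
  | trans _ _ _ _ _ ih ih' => exact ih.trans ih'

theorem eqvGen_of_reflTransGen {U V : π.Atom} (h : ReflTransGen π.Step U V) :
    EqvGen π.Sim U V := by
  induction h with
  | refl => exact .refl _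
  | tail _ h ih => exact .trans _ _ _ ih (.rel _ _ (sim_of_step h))

theorem wellFounded_step (hπ : Acyclic π.Step) : WellFounded (TransGen π.Step) :=
  have : Std.Irrefl (TransGen π.Step) := ⟨hπ⟩
  Finite.wellFounded_of_trans_of_irrefl _

theorem wellFounded_swap_step (hπ : Acyclic π.Step) :
    WellFounded (Function.swap (TransGen π.Step)) :=
  have : Std.Irrefl (Function.swap (TransGen π.Step)) := ⟨hπ⟩
  have : IsTrans π.Atom (Function.swap (TransGen π.Step)) := ⟨fun _ _ _ h h' => h'.trans h⟩
  Finite.wellFounded_of_trans_of_irrefl _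

theorem exists_last (hπ : Acyclic π.Step) (U : π.Atom) :
    ∃ V, ReflTransGen π.Step U V ∧ ∀ W, ¬ π.Step V W := by
  induction U using (wellFounded_swap_step hπ).induction with
  | _ U ih =>
    by_cases h : ∃ W, π.Step U W
    · obtain ⟨W, hW⟩ := h
      obtain ⟨V, hV, hV'⟩ := ih W (.single hW)
      exact ⟨V, .head hW hV, hV'⟩
    · exact ⟨U, .refl, not_exists.1 h⟩

theorem exists_path_to (hπ : Acyclic π.Step) (V : π.Atom) :
    ∃ P : List π.Atom, P.getLast? = some V ∧ P.IsChain π.Step ∧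
      (∀ U, U ∈ P ↔ ReflTransGen π.Step U V) ∧ ∃ S, P.head? = some S ∧ ∀ U, ¬ π.Step U S := by
  induction V using (wellFounded_step hπ).induction with
  | _ V ih =>
    by_cases h : ∃ U, π.Step U V
    · obtain ⟨U, hU⟩ := h
      obtain ⟨P, hlast, hchain, hmem, S, hS, hS'⟩ := ih U (.single hU)
      refine ⟨P ++ [V], by simp, ?_, fun W => ?_, S, by simp [hS], hS'⟩
      · refine List.isChain_append.2 ⟨hchain, .singleton V, fun x hx y hy => ?_⟩
        rw [hlast, Option.mem_some_iff] at hx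
        rw [List.head?_cons, Option.mem_some_iff] at hy
        rwa [← hx, ← hy]
      · rw [List.mem_append, hmem, List.mem_singleton]
        constructor
        · rintro (h | rfl)
          · exact h.tail hU
          · exact .refl
        · intro h
          rcases h.cases_tail with h | ⟨U', hU', h⟩
          · exact .inr h.symm
          · exact .inl (step_left_unique hU h ▸ hU')
    · refine ⟨[V], rfl, .singleton V, fun W => ?_, V, rfl, not_exists.1 h⟩
      rw [List.mem_singleton]
      constructor
      · rintro rfl
        exact .refl
      · intro h'
        rcases h'.cases_tail with h' | ⟨U, -, h'⟩
        · exact h'.symm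
        · exact absurd ⟨U, h'⟩ h

theorem pairwise_transGen {P : List π.Atom} (hP : P.IsChain π.Step) :
    P.Pairwise (TransGen π.Step) :=
  (hP.imp fun _ _ => TransGen.single).pairwise

theorem exists_isPathList (hπ : Acyclic π.Step) (he : π.IsSingleConclusion e) :
    ∃ Ps, π.IsPathList e Ps := by
  choose path hlast hchain hmem hhead using exists_path_to hπ
  have hterm : ∀ {i}, π.sign ⟨e, i⟩ = true → ∀ W, ¬ π.Step ⟨e, i⟩ W := fun hi _ =>
    not_step_of_positive_conclusion hi ((he e).2 rfl)
  refine ⟨((List.finRange (π.len e)).filter fun i => π.sign ⟨e, i⟩).map fun i => path ⟨e, i⟩,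
    ?_, ?_, ?_⟩
  · intro P hP
    obtain ⟨i, hi, rfl⟩ := List.mem_map.1 hP
    have hs : π.sign ⟨e, i⟩ = true := (List.mem_filter.1 hi).2
    refine ⟨?_, ⟨⟨e, i⟩, fun U => ?_⟩, (hchain _).imp fun _ _ => sim_of_step, ?_, i, hlast _, hs⟩
    · refine (pairwise_transGen (hchain _)).imp ?_
      rintro U V h rfl
      exact hπ U h
    · rw [hmem]
      constructor
      · exact fun h => (eqvGen_of_reflTransGen h).symm
      · exact fun h => (reflTransGen_iff_of_eqvGen (hterm hs) h).1 .refl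
    · obtain ⟨S, hS, hS'⟩ := hhead ⟨e, i⟩
      have : π.sign S = false ∧ π.node (π.target S.1) = .c := by
        by_contra hcon
        obtain ⟨U, hU⟩ := exists_step_to S fun h1 h2 => hcon ⟨h1, h2⟩
        exact hS' U hU
      obtain ⟨j, rfl⟩ := eq_conclusion he this.2
      exact ⟨j, hS, this.1⟩
  · intro U
    obtain ⟨V, hUV, hV⟩ := exists_last hπ U
    have : π.sign V = true ∧ π.node (π.target V.1) = .c := by
      by_contra hcon
      obtain ⟨W, hW⟩ := exists_step V fun h1 h2 => hcon ⟨h1, h2⟩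
      exact hV W hW
    obtain ⟨i, rfl⟩ := eq_conclusion he this.2
    refine ⟨path ⟨e, i⟩, List.mem_map.2 ⟨i, List.mem_filter.2 ⟨List.mem_finRange _, this.1⟩, rfl⟩,
      (hmem _ _).2 hUV⟩
  · refine List.Pairwise.map _ (R := (· < ·)) (fun i j hij i' j' hi hj => ?_)
      ((List.pairwise_lt_finRange _).filter _)
    rw [hlast] at hi hj
    obtain rfl : i = i' := by simpa using hi
    obtain rfl : j = j' := by simpa using hj
    exact hij

section Path

variable (he : π.IsSingleConclusion e)
include he

theorem isChain_step {P : List π.Atom} (hP : π.IsPersistentPath e P) : P.IsChain π.Step := by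
  refine isChain_step_of_isChain_sim (fun _ _ => sim_iff.1) step_left_unique P hP.nodup hP.chain ?_
  obtain ⟨i, hi, hs⟩ := hP.head
  intro U V hV hUV
  obtain rfl : ⟨e, i⟩ = V := by simpa [hi] using hV
  exact absurd hUV (not_step_to_negative_conclusion hs ((he e).2 rfl))

theorem pre_of_transGen (hπ : Acyclic π.Step) {P : List π.Atom} (hP : π.IsPersistentPath e P)
    {U V : π.Atom} (hUV : TransGen π.Step U V) (hV : V ∈ P) : Pre P U V := by
  obtain ⟨W, hW⟩ := hP.eqClass
  have hU : U ∈ P := (hW U).2 (((hW V).1 hV).trans _ _ _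
    (eqvGen_of_reflTransGen hUV.to_reflTransGen).symm)
  obtain ⟨l₁, l₂, rfl, hVl⟩ := List.append_of_mem hV |>.elim fun l₁ h => h.elim fun l₂ h =>
    (⟨l₁, l₂, h, fun hV₁ => by
      have := hP.nodup
      rw [h] at this
      exact (List.disjoint_of_nodup_append this) hV₁ List.mem_cons_self⟩ :
      ∃ l₁ l₂, P = l₁ ++ V :: l₂ ∧ V ∉ l₁)
  have hpw := pairwise_transGen (isChain_step he hP)
  rcases List.mem_append.1 hU with hU | hU
  · obtain ⟨a, b, rfl⟩ := List.append_of_mem hU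
    exact ⟨a, b ++ V :: l₂, by simp, fun h => hVl (by simp [h])⟩
  · rcases List.mem_cons.1 hU with rfl | hU
    · exact absurd hUV (hπ U)
    · have := (List.pairwise_cons.1 (List.pairwise_append.1 hpw).2.1).1 U hU
      exact absurd (hUV.trans this) (hπ U)

theorem not_step_last {P : List π.Atom} (hP : π.IsPersistentPath e P) :
    ∃ i, P.getLast? = some ⟨e, i⟩ ∧ ∀ W, ¬ π.Step ⟨e, i⟩ W := by
  obtain ⟨i, hi, hs⟩ := hP.last
  exact ⟨i, hi, fun W => not_step_of_positive_conclusion hs ((he e).2 rfl)⟩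

theorem pairwise_disjoint {Ps : List (List π.Atom)} (hPs : π.IsPathList e Ps) :
    Ps.Pairwise List.Disjoint := by
  refine hPs.sorted.imp_of_mem fun {P Q} hP hQ hPQ U hU hU' => ?_
  obtain ⟨i, hi, hi'⟩ := not_step_last he (hPs.path P hP)
  obtain ⟨j, hj, hj'⟩ := not_step_last he (hPs.path Q hQ)
  obtain ⟨W, hW⟩ := (hPs.path P hP).eqClass
  obtain ⟨W', hW'⟩ := (hPs.path Q hQ).eqClass
  have h1 := (hW _).1 (List.mem_of_getLast? hi)
  have h2 := (hW' _).1 (List.mem_of_getLast? hj)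
  have h3 := (hW _).1 hU
  have h4 := (hW' _).1 hU'
  have h5 : EqvGen π.Sim ⟨e, i⟩ ⟨e, j⟩ :=
    .trans _ _ _ (.trans _ _ _ h1.symm h3) (.trans _ _ _ h4.symm h2)
  have h6 := (reflTransGen_iff_of_eqvGen hj' h5).2 .refl
  rcases h6.cases_head with h6 | ⟨V, hV, -⟩
  · have h7 : i = j := by simpa using h6
    have := hPQ i j hi hj
    omega
  · exact hi' V hV

end Path

end ProofStructure

/-! ### Steps and reductions -/

variable {α : Type u}

namespace Reduction

open ProofGraph

variable {π π' : ProofStructure α}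

theorem edge_injective (γ : Reduction π π') : Function.Injective γ.edge := by
  cases γ with
  | a γ => exact Subtype.val_injective.comp γ.edge.injective
  | m γ => exact Subtype.val_injective.comp γ.edge.injective

theorem len_edge (γ : Reduction π π') (e : π'.E) : π.len (γ.edge e) = π'.len e := by
  rw [len, len, γ.label_edge]

theorem atomMap_injective (γ : Reduction π π') : Function.Injective γ.atomMap := by
  intro U V h
  refine atom_ext (γ.edge_injective (congrArg Sigma.fst h)) ?_
  exact congrArg (fun W : π.Atom => (W.2 : ℕ)) h

theorem sign_atomMap (γ : Reduction π π') (U : π'.Atom) : π.sign (γ.atomMap U) = π'.sign U := by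
  have h := List.getElem_of_eq (congrArg Formula.atoms (γ.label_edge U.1)) U.2.2
  exact congrArg Prod.snd h.symm

theorem mem_range_atomMap (γ : Reduction π π') (U : π.Atom) :
    U ∈ Set.range γ.atomMap ↔ U.1 ∈ Set.range γ.edge := by
  constructor
  · rintro ⟨V, rfl⟩
    exact ⟨V.1, rfl⟩
  · rintro ⟨d, hd⟩
    have h1 : π'.len d = π.len U.1 := (γ.len_edge d).symm.trans (congrArg π.len hd)
    exact ⟨⟨d, ⟨U.2, lt_of_lt_of_eq U.2.2 h1.symm⟩⟩, atom_ext hd rfl⟩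

end Reduction

/-- An inclusion of atoms that identifies the steps of `π'` with the sequences of steps of `π` between
consecutive atoms in its image. -/
structure IsCollapse {π π' : ProofStructure α} (f : π'.Atom → π.Atom) : Prop where
  injective : Function.Injective f
  sign : ∀ U, π.sign (f U) = π'.sign U
  node_iff : ∀ U : π'.Atom, π'.node (π'.target U.1) = .c ↔ π.node (π.target (f U).1) = .c
  mem_range : ∀ U : π.Atom, π.node (π.target U.1) = .c → U ∈ Set.range f
  hop : ∀ {U V}, π'.Step U V → Hop π.Step (· ∈ Set.range f) (f U) (f V)

section Hop

variable {σ : Type} {R : σ → σ → Prop} {K : σ → Prop}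

theorem hop_single {U V : σ} (h : R U V) : Hop R K U V := ⟨U, .refl, h⟩

end Hop

namespace IsCollapse

open Relation ProofStructure

variable {π ρ π' : ProofStructure α}

theorem comp {f : ρ.Atom → π.Atom} {g : π'.Atom → ρ.Atom} (hf : IsCollapse f)
    (hg : IsCollapse g) : IsCollapse (f ∘ g) where
  injective := hf.injective.comp hg.injective
  sign U := (hf.sign _).trans (hg.sign U)
  node_iff U := (hg.node_iff U).trans (hf.node_iff _)
  mem_range U hU := by
    obtain ⟨V, rfl⟩ := hf.mem_range U hU
    obtain ⟨W, rfl⟩ := hg.mem_range V ((hf.node_iff V).2 hU)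
    exact ⟨W, rfl⟩
  hop {U V} h := by
    have hreach : ∀ {x y}, Reach π.Step (· ∈ Set.range f) x y →
        Reach π.Step (· ∈ Set.range (f ∘ g)) x y := fun h => by
      refine ReflTransGen.mono ?_ _ _ h
      rintro x y ⟨h, h'⟩
      exact ⟨h, fun hy => h' (Set.range_comp_subset_range g f hy)⟩
    have key : ∀ {x y}, Reach ρ.Step (· ∈ Set.range g) x y →
        Reach π.Step (· ∈ Set.range (f ∘ g)) (f x) (f y) := fun h => by
      induction h with
      | refl => exact .refl
      | tail _ h ih =>
        obtain ⟨w, hw, hw'⟩ := hf.hop h.1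
        refine (ih.trans (hreach hw)).tail ⟨hw', ?_⟩
        rintro ⟨z, hz⟩
        exact h.2 ⟨z, hf.injective hz⟩
    obtain ⟨z, hz, hz'⟩ := hg.hop h
    obtain ⟨w, hw, hw'⟩ := hf.hop hz'
    exact ⟨w, (key hz).trans (hreach hw), hw'⟩

theorem step_iff_hop {f : π'.Atom → π.Atom} (hf : IsCollapse f)
    (hunique : ∀ {U V V'}, Hop π.Step (· ∈ Set.range f) (f U) (f V) →
      Hop π.Step (· ∈ Set.range f) (f U) (f V') → f V = f V') (U V : π'.Atom) :
    π'.Step U V ↔ Hop π.Step (· ∈ Set.range f) (f U) (f V) := by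
  refine ⟨hf.hop, fun h => ?_⟩
  obtain ⟨W, hW⟩ : ∃ W, π'.Step U W := by
    refine exists_step U fun hU hc => ?_
    have hno : ∀ W, ¬ π.Step (f U) W := fun W =>
      not_step_of_positive_conclusion ((hf.sign U).trans hU) ((hf.node_iff U).1 hc)
    obtain ⟨z, hz, hz'⟩ := h
    rcases hz.cases_head with rfl | ⟨y, hy, -⟩
    · exact hno _ hz'
    · exact hno _ hy.1
  rwa [hf.injective (hunique h (hf.hop hW))]

end IsCollapse

namespace AReduction

open ProofGraph ProofStructure Relation

variable {π π' : ProofStructure α} (γ : AReduction π π')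

theorem edge_ne (U : π'.Atom) :
    (Reduction.a γ).edge U.1 ≠ γ.left ∧ (Reduction.a γ).edge U.1 ≠ γ.mid := (γ.edge U.1).2

theorem notMem_range {U : π.Atom} (h : U.1 = γ.left ∨ U.1 = γ.mid) :
    U ∉ Set.range (Reduction.a γ).atomMap := by
  rintro ⟨V, rfl⟩
  have := γ.edge_ne V
  rcases h with h | h
  · exact this.1 h
  · exact this.2 h

/-- The atom of `π` at which the link above `U` in `π'` is found, and the detour between this atom and
`U` in `π`. -/
theorem exists_detour (U : π'.Atom) : ∃ W : π.Atom,
    ((γ.edge U.1).1 ≠ γ.right ∧ W.1 = (γ.edge U.1).1 ∨ (γ.edge U.1).1 = γ.right ∧ W.1 = γ.left) ∧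
    (W.2 : ℕ) = U.2 ∧ π.len W.1 = π'.len U.1 ∧ π.sign W = π'.sign U ∧
    π.source W.1 = (γ.vert (π'.source U.1)).1 ∧
    (π'.sign U = false →
      Reach π.Step (· ∈ Set.range (Reduction.a γ).atomMap) ((Reduction.a γ).atomMap U) W) ∧
    (π'.sign U = true → ∀ Y Z,
      Reach π.Step (· ∈ Set.range (Reduction.a γ).atomMap) Y Z → π.Step Z W →
      Hop π.Step (· ∈ Set.range (Reduction.a γ).atomMap) Y ((Reduction.a γ).atomMap U)) := by
  have hsrc := γ.source_eq U.1
  have hlenU := (Reduction.a γ).len_edge U.1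
  have hsign := (Reduction.a γ).sign_atomMap U
  by_cases hr : (γ.edge U.1).1 = γ.right
  · rw [if_pos hr] at hsrc
    have hr' : (Reduction.a γ).edge U.1 = γ.right := hr
    rw [hr'] at hlenU
    have h1 := len_of_label_neg γ.isCut.label
    have h2 := len_of_label_neg γ.isAx.label
    have hi : (U.2 : ℕ) < π'.len U.1 := U.2.2
    have hl : (U.2 : ℕ) < π.len γ.left := by omega
    have hm : π'.len U.1 - 1 - U.2 < π.len γ.mid := by omega
    have hr'' : (U.2 : ℕ) < π.len γ.right := by omega
    have hsum : (U.2 : ℕ) + (π'.len U.1 - 1 - U.2) + 1 = π.len γ.left := by omega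
    have hsum' : (U.2 : ℕ) + (π'.len U.1 - 1 - U.2) + 1 = π.len γ.right := by omega
    let W : π.Atom := ⟨γ.left, ⟨U.2, hl⟩⟩
    let M : π.Atom := ⟨γ.mid, ⟨π'.len U.1 - 1 - U.2, hm⟩⟩
    have hcut : π.Opp π.target .cut W M := opp_of_isCut γ.isCut _ _ hsum
    have hax : π.Opp π.source .ax ((Reduction.a γ).atomMap U) M := by
      have h4 : (Reduction.a γ).atomMap U = ⟨γ.right, ⟨U.2, hr''⟩⟩ := atom_ext hr rfl
      rw [h4]
      exact opp_of_isAx γ.isAx.symm _ _ hsum'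
    have hsM := sign_of_opp_ax hax
    have hsM' := sign_of_opp_cut hcut
    have hsW : π.sign W = π'.sign U := by
      rw [← hsign]
      exact Bool.not_inj (hsM'.symm.trans hsM)
    have hW : W ∉ Set.range (Reduction.a γ).atomMap := γ.notMem_range (.inl rfl)
    have hM : M ∉ Set.range (Reduction.a γ).atomMap := γ.notMem_range (.inr rfl)
    refine ⟨W, .inr ⟨hr, rfl⟩, rfl, ?_, hsW, hsrc.symm, fun hU => ?_, fun hU Y Z hYZ hZ => ?_⟩
    · change π.len γ.left = _
      omega
    · have hMt : π.sign M = true := by rw [hsM, hsign, hU]; rfl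
      exact (ReflTransGen.refl.tail ⟨.ax hax (hsign.trans hU) hMt, hM⟩).tail
        ⟨.cut (opp_cut_symm hcut) hMt (hsW.trans hU), hW⟩
    · have hMf : π.sign M = false := by rw [hsM, hsign, hU]; rfl
      exact ⟨M, (hYZ.tail ⟨hZ, hW⟩).tail ⟨.cut hcut (hsW.trans hU) hMf, hM⟩,
        .ax (opp_ax_symm hax) hMf (hsign.trans hU)⟩
  · rw [if_neg hr] at hsrc
    exact ⟨(Reduction.a γ).atomMap U, .inl ⟨hr, rfl⟩, rfl, hlenU, hsign, hsrc.symm,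
      fun _ => .refl, fun _ Y Z hYZ hZ => ⟨Z, hYZ, hZ⟩⟩

theorem desc_of_desc {U V : π'.Atom} (h : π'.Desc U V) {W : π.Atom} (hW : (W.2 : ℕ) = V.2)
    (hlen : π.len W.1 = π'.len V.1) (hsrc : π.source W.1 = (γ.vert (π'.source V.1)).1) :
    π.Desc ((Reduction.a γ).atomMap U) W := by
  obtain ⟨t, ht⟩ := h.node
  have hright := γ.isRight_eq _ t ht
  have hl := (Reduction.a γ).len_edge U.1
  refine ⟨⟨t, ?_⟩, ?_, fun hr => ?_, fun hr => ?_⟩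
  · have h1 := γ.node_eq (π'.target U.1)
    rw [γ.target_eq] at h1
    exact h1.symm.trans ht
  · rw [hsrc, h.source]
    exact γ.target_eq U.1
  · exact hW.trans (h.left (hright.trans hr))
  · have h1 := h.right (hright.trans hr)
    change (W.2 : ℕ) + π.len ((Reduction.a γ).edge U.1) = π.len W.1 + (U.2 : ℕ)
    omega

theorem isCollapse : IsCollapse (Reduction.a γ).atomMap where
  injective := (Reduction.a γ).atomMap_injective
  sign := (Reduction.a γ).sign_atomMap
  node_iff U := by
    rw [γ.node_eq, γ.target_eq]
    exact Iff.rfl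
  mem_range U hU := by
    rw [Reduction.mem_range_atomMap]
    have key : ∀ d, π.target d = γ.cut → U.1 ≠ d := by
      rintro d hd h
      rw [h, hd, γ.isCut.node] at hU
      exact absurd hU nofun
    refine ⟨γ.edge.symm ⟨U.1, key _ ((γ.isCut.premise _).2 (.inl rfl)),
      key _ ((γ.isCut.premise _).2 (.inr rfl))⟩, ?_⟩
    simp [Reduction.edge]
  hop {U V} h := by
    have hsU := (Reduction.a γ).sign_atomMap U
    have hsV := (Reduction.a γ).sign_atomMap V
    cases h with
    | ax h hU hV =>
      obtain ⟨U', hU1, hU2, hU3, hU4, hU5, hU6, -⟩ := γ.exists_detour U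
      obtain ⟨V', hV1, hV2, -, hV4, hV5, -, hV6⟩ := γ.exists_detour V
      refine hV6 hV _ _ (hU6 hU) (.ax ⟨?_, ?_, ?_, ?_⟩ (hU4.trans hU) (hV4.trans hV))
      · rw [hU5, ← γ.node_eq, h.node]
      · rw [hV5, hU5, h.same]
      · intro heq
        have hne : (γ.edge V.1).1 ≠ (γ.edge U.1).1 := fun h' =>
          h.ne (γ.edge.injective (Subtype.ext h'))
        have hUl := (γ.edge U.1).2.1
        have hVl := (γ.edge V.1).2.1
        rcases hU1 with ⟨h1, h2⟩ | ⟨h1, h2⟩ <;> rcases hV1 with ⟨h3, h4⟩ | ⟨h3, h4⟩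
        · exact hne (h4.symm.trans (heq.trans h2))
        · exact hUl (h2.symm.trans (heq.symm.trans h4))
        · exact hVl (h4.symm.trans (heq.trans h2))
        · exact hne (h3.trans h1.symm)
      · have := h.sum
        omega
    | cut h hU hV =>
      refine hop_single (.cut ⟨?_, ?_, ?_, ?_⟩ (hsU.trans hU) (hsV.trans hV))
      · have h1 := γ.node_eq (π'.target U.1)
        rw [γ.target_eq] at h1
        exact h1.symm.trans h.node
      · have h1 := congrArg (fun w => (γ.vert w).1) h.same
        simp only [γ.target_eq] at h1
        exact h1
      · exact fun h' => h.ne ((Reduction.a γ).edge_injective h')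
      · exact h.sum.trans ((Reduction.a γ).len_edge U.1).symm
    | down h hU hV =>
      obtain ⟨V', -, hV2, hV3, hV4, hV5, -, hV6⟩ := γ.exists_detour V
      exact hV6 hV _ _ .refl (.down (γ.desc_of_desc h hV2 hV3 hV5) (hsU.trans hU) (hV4.trans hV))
    | up h hU hV =>
      obtain ⟨U', -, hU2, hU3, hU4, hU5, hU6, -⟩ := γ.exists_detour U
      exact ⟨U', hU6 hU, .up (γ.desc_of_desc h hU2 hU3 hU5) (hU4.trans hU) (hsV.trans hV)⟩

end AReduction

namespace MReduction

open ProofGraph ProofStructure Relation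

variable {π π' : ProofStructure α} (γ : MReduction π π')

theorem tens_ne_parr : γ.tens ≠ γ.parr := by
  intro h
  have := γ.isTensor.node
  rw [h, γ.isPar.node] at this
  exact absurd this nofun

theorem len_b' : π.len γ.b' = π.len γ.b := by
  have h := γ.isCut.label
  rw [γ.isTensor.label, γ.isPar.label] at h
  exact len_of_label_neg (Formula.par.inj h).1

theorem len_a' : π.len γ.a' = π.len γ.a := by
  have h := γ.isCut.label
  rw [γ.isTensor.label, γ.isPar.label] at h
  exact len_of_label_neg (Formula.par.inj h).2

theorem notMem_range {U : π.Atom} (h : U.1 = γ.ab ∨ U.1 = γ.ba') :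
    U ∉ Set.range (Reduction.m γ).atomMap := by
  rintro ⟨V, rfl⟩
  have : (Reduction.m γ).edge V.1 ≠ γ.ab ∧ (Reduction.m γ).edge V.1 ≠ γ.ba' := (γ.edge V.1).2
  rcases h with h | h
  · exact this.1 h
  · exact this.2 h

theorem target_eq_tens {d : π'.E} (h : (γ.vert (π'.target d)).1 = γ.tens) :
    (γ.edge d).1 = γ.a ∨ (γ.edge d).1 = γ.a' := by
  rw [γ.target_eq] at h
  split_ifs at h with h1 h2
  · exact .inr h1
  · exact absurd h.symm γ.tens_ne_parr
  · exact .inl (((γ.isTensor.premise _).1 h).resolve_right h2)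

theorem target_eq_parr {d : π'.E} (h : (γ.vert (π'.target d)).1 = γ.parr) :
    (γ.edge d).1 = γ.b ∨ (γ.edge d).1 = γ.b' := by
  rw [γ.target_eq] at h
  split_ifs at h with h1 h2
  · exact absurd h γ.tens_ne_parr
  · exact .inl h2
  · exact .inr (((γ.isPar.premise _).1 h).resolve_right h1)

theorem target_eq_of_ne {d : π'.E} (h1 : (γ.vert (π'.target d)).1 ≠ γ.tens)
    (h2 : (γ.vert (π'.target d)).1 ≠ γ.parr) :
    (γ.vert (π'.target d)).1 = π.target (γ.edge d).1 := by
  have h := γ.target_eq d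
  split_ifs at h
  · exact absurd h h1
  · exact absurd h h2
  · exact h

theorem node_eq_of_ne {w : π'.V} (h : π'.node w ≠ .cut) :
    (γ.vert w).1 ≠ γ.tens ∧ (γ.vert w).1 ≠ γ.parr ∧ π'.node w = π.node (γ.vert w).1 := by
  have h1 := γ.node_eq w
  split_ifs at h1 with h2
  · exact absurd h1 h
  · exact ⟨fun h => h2 (.inl h), fun h => h2 (.inr h), h1⟩

theorem desc_of_desc {U V : π'.Atom} (h : π'.Desc U V) :
    π.Desc ((Reduction.m γ).atomMap U) ((Reduction.m γ).atomMap V) := by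
  obtain ⟨t, ht⟩ := h.node
  have hright := γ.isRight_eq _ t ht
  have hlU := (Reduction.m γ).len_edge U.1
  have hlV := (Reduction.m γ).len_edge V.1
  obtain ⟨h1, h2, h3⟩ := γ.node_eq_of_ne (node_ne_of_desc h).2.1
  have h4 := γ.target_eq_of_ne h1 h2
  refine ⟨⟨t, ?_⟩, ?_, fun hr => ?_, fun hr => ?_⟩
  · rw [h4] at h3
    exact h3.symm.trans ht
  · have h5 := congrArg (fun w => (γ.vert w).1) h.source
    simp only [γ.source_eq, h4] at h5
    exact h5
  · exact h.left (hright.trans hr)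
  · have h1 := h.right (hright.trans hr)
    change (V.2 : ℕ) + π.len ((Reduction.m γ).edge U.1) =
      π.len ((Reduction.m γ).edge V.1) + (U.2 : ℕ)
    omega

/-- The detour through the cut of the redex. -/
theorem hop_of_desc {U V Z Z' : π.Atom} (hU : π.Desc U Z) (hV : π.Desc V Z')
    (h : π.Opp π.target .cut Z Z') (hZ : Z.1 = γ.ab ∨ Z.1 = γ.ba')
    (hZ' : Z'.1 = γ.ab ∨ Z'.1 = γ.ba') (hsU : π.sign U = true) (hsV : π.sign V = false) :
    Hop π.Step (· ∈ Set.range (Reduction.m γ).atomMap) U V := by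
  have h1 := (sign_of_desc hU).trans hsU
  have h2 := (sign_of_desc hV).trans hsV
  exact ⟨Z', (ReflTransGen.refl.tail ⟨.down hU hsU h1, γ.notMem_range hZ⟩).tail
    ⟨.cut h h1 h2, γ.notMem_range hZ'⟩, .up hV h2 hsV⟩

theorem exists_detour_tens {U V : π.Atom} (hU : U.1 = γ.a) (hV : V.1 = γ.a')
    (h : (U.2 : ℕ) + V.2 + 1 = π.len U.1) : ∃ Z Z' : π.Atom, π.Desc U Z ∧ π.Desc V Z' ∧
      π.Opp π.target .cut Z Z' ∧ Z.1 = γ.ab ∧ Z'.1 = γ.ba' := by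
  obtain ⟨e, i⟩ := U
  obtain ⟨d, j⟩ := V
  dsimp only at hU hV h
  subst hU hV
  have h1 := γ.isTensor.len_eq
  have h2 := γ.isPar.len_eq
  have h3 := γ.len_b'
  have h4 := γ.len_a'
  refine ⟨⟨γ.ab, ⟨i, by simp only [len] at *; omega⟩⟩,
    ⟨γ.ba', ⟨π.len γ.b' + j, by simp only [len] at *; omega⟩⟩, desc_left γ.isTensor _ _ rfl,
    desc_right γ.isPar _ _ rfl, opp_of_isCut γ.isCut _ _ ?_, rfl, rfl⟩
  dsimp only
  omega

theorem exists_detour_parr {U V : π.Atom} (hU : U.1 = γ.b) (hV : V.1 = γ.b')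
    (h : (U.2 : ℕ) + V.2 + 1 = π.len U.1) : ∃ Z Z' : π.Atom, π.Desc U Z ∧ π.Desc V Z' ∧
      π.Opp π.target .cut Z Z' ∧ Z.1 = γ.ab ∧ Z'.1 = γ.ba' := by
  obtain ⟨e, i⟩ := U
  obtain ⟨d, j⟩ := V
  dsimp only at hU hV h
  subst hU hV
  have h1 := γ.isTensor.len_eq
  have h2 := γ.isPar.len_eq
  have h3 := γ.len_b'
  have h4 := γ.len_a'
  refine ⟨⟨γ.ab, ⟨π.len γ.a + i, by simp only [len] at *; omega⟩⟩,
    ⟨γ.ba', ⟨j, by simp only [len] at *; omega⟩⟩, desc_right γ.isTensor _ _ rfl,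
    desc_left γ.isPar _ _ rfl, opp_of_isCut γ.isCut _ _ ?_, rfl, rfl⟩
  dsimp only
  omega

theorem hop_of_cut {U V : π'.Atom} (h : π'.Opp π'.target .cut U V) (hsU : π'.sign U = true)
    (hsV : π'.sign V = false) : Hop π.Step (· ∈ Set.range (Reduction.m γ).atomMap)
      ((Reduction.m γ).atomMap U) ((Reduction.m γ).atomMap V) := by
  replace hsU := ((Reduction.m γ).sign_atomMap U).trans hsU
  replace hsV := ((Reduction.m γ).sign_atomMap V).trans hsV
  have hne : (γ.edge V.1).1 ≠ (γ.edge U.1).1 := fun h' =>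
    h.ne ((Reduction.m γ).edge_injective h')
  have htgt : (γ.vert (π'.target V.1)).1 = (γ.vert (π'.target U.1)).1 :=
    congrArg (fun w => (γ.vert w).1) h.same
  have hsum := h.sum.trans ((Reduction.m γ).len_edge U.1).symm
  have hsum' := (opp_cut_symm h).sum.trans ((Reduction.m γ).len_edge V.1).symm
  by_cases ht : (γ.vert (π'.target U.1)).1 = γ.tens
  · rcases γ.target_eq_tens ht with h1 | h1 <;> rcases γ.target_eq_tens (htgt.trans ht) with h2 | h2
    · exact absurd (h2.trans h1.symm) hne
    · obtain ⟨Z, Z', h3, h4, h5, h6, h7⟩ := γ.exists_detour_tens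
        (U := (Reduction.m γ).atomMap U) (V := (Reduction.m γ).atomMap V) h1 h2 hsum
      exact γ.hop_of_desc h3 h4 h5 (.inl h6) (.inr h7) hsU hsV
    · obtain ⟨Z, Z', h3, h4, h5, h6, h7⟩ := γ.exists_detour_tens
        (U := (Reduction.m γ).atomMap V) (V := (Reduction.m γ).atomMap U) h2 h1 hsum'
      exact γ.hop_of_desc h4 h3 (opp_cut_symm h5) (.inr h7) (.inl h6) hsU hsV
    · exact absurd (h2.trans h1.symm) hne
  by_cases hp : (γ.vert (π'.target U.1)).1 = γ.parr
  · rcases γ.target_eq_parr hp with h1 | h1 <;> rcases γ.target_eq_parr (htgt.trans hp) with h2 | h2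
    · exact absurd (h2.trans h1.symm) hne
    · obtain ⟨Z, Z', h3, h4, h5, h6, h7⟩ := γ.exists_detour_parr
        (U := (Reduction.m γ).atomMap U) (V := (Reduction.m γ).atomMap V) h1 h2 hsum
      exact γ.hop_of_desc h3 h4 h5 (.inl h6) (.inr h7) hsU hsV
    · obtain ⟨Z, Z', h3, h4, h5, h6, h7⟩ := γ.exists_detour_parr
        (U := (Reduction.m γ).atomMap V) (V := (Reduction.m γ).atomMap U) h2 h1 hsum'
      exact γ.hop_of_desc h4 h3 (opp_cut_symm h5) (.inr h7) (.inl h6) hsU hsV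
    · exact absurd (h2.trans h1.symm) hne
  have h1 := γ.target_eq_of_ne ht hp
  have h2 := γ.target_eq_of_ne (htgt.trans_ne ht) (htgt.trans_ne hp)
  have h3 := γ.node_eq (π'.target U.1)
  rw [if_neg (not_or.2 ⟨ht, hp⟩), h1] at h3
  exact hop_single (.cut ⟨h3.symm.trans h.node, h2.symm.trans (htgt.trans h1), hne, hsum⟩ hsU hsV)

theorem isCollapse : IsCollapse (Reduction.m γ).atomMap where
  injective := (Reduction.m γ).atomMap_injective
  sign := (Reduction.m γ).sign_atomMap
  node_iff U := by
    change _ ↔ π.node (π.target (γ.edge U.1).1) = .c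
    by_cases h : (γ.vert (π'.target U.1)).1 = γ.tens ∨ (γ.vert (π'.target U.1)).1 = γ.parr
    · have h1 := γ.node_eq (π'.target U.1)
      rw [if_pos h] at h1
      refine ⟨fun h' => absurd (h1.symm.trans h') nofun, fun h' => ?_⟩
      have h2 : π.node γ.tens ≠ .c := by
        rw [γ.isTensor.node]
        exact nofun
      have h3 : π.node γ.parr ≠ .c := by
        rw [γ.isPar.node]
        exact nofun
      rcases h with h | h
      · rcases γ.target_eq_tens h with h4 | h4 <;> rw [h4] at h'
        · rw [(γ.isTensor.premise _).2 (.inl rfl)] at h'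
          exact absurd h' h2
        · rw [(γ.isPar.premise _).2 (.inr rfl)] at h'
          exact absurd h' h3
      · rcases γ.target_eq_parr h with h4 | h4 <;> rw [h4] at h'
        · rw [(γ.isTensor.premise _).2 (.inr rfl)] at h'
          exact absurd h' h2
        · rw [(γ.isPar.premise _).2 (.inl rfl)] at h'
          exact absurd h' h3
    · rw [γ.node_eq, if_neg h, γ.target_eq_of_ne (fun h' => h (.inl h')) fun h' => h (.inr h')]
  mem_range U hU := by
    rw [Reduction.mem_range_atomMap]
    have key : ∀ d, π.target d = γ.cut → U.1 ≠ d := by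
      rintro d hd h
      rw [h, hd, γ.isCut.node] at hU
      exact absurd hU nofun
    refine ⟨γ.edge.symm ⟨U.1, key _ ((γ.isCut.premise _).2 (.inl rfl)),
      key _ ((γ.isCut.premise _).2 (.inr rfl))⟩, ?_⟩
    simp [Reduction.edge]
  hop {U V} h := by
    have hsU := (Reduction.m γ).sign_atomMap U
    have hsV := (Reduction.m γ).sign_atomMap V
    cases h with
    | ax h hU hV =>
      have h1 := γ.source_eq U.1
      have h2 := (γ.node_eq_of_ne (w := π'.source U.1) (by rw [h.node]; exact nofun)).2.2
      have h3 := congrArg (fun w => (γ.vert w).1) h.same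
      simp only [γ.source_eq] at h3
      rw [h1] at h2
      exact hop_single (.ax ⟨h2.symm.trans h.node, h3,
        fun h' => h.ne ((Reduction.m γ).edge_injective h'),
        h.sum.trans ((Reduction.m γ).len_edge U.1).symm⟩ (hsU.trans hU) (hsV.trans hV))
    | cut h hU hV => exact γ.hop_of_cut h hU hV
    | down h hU hV => exact hop_single (.down (γ.desc_of_desc h) (hsU.trans hU) (hsV.trans hV))
    | up h hU hV => exact hop_single (.up (γ.desc_of_desc h) (hsU.trans hU) (hsV.trans hV))

end MReduction

theorem Reduction.isCollapse {π π' : ProofStructure α} (γ : Reduction π π') :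
    IsCollapse γ.atomMap := by
  cases γ with
  | a γ => exact γ.isCollapse
  | m γ => exact γ.isCollapse

theorem ReductionSequence.isCollapse {π π' : ProofStructure α} (Γ : ReductionSequence π π') :
    IsCollapse Γ.atomMap := by
  induction Γ with
  | single γ => exact γ.isCollapse
  | cons γ Γ ih => exact γ.isCollapse.comp ih

variable {α : Type u}

theorem Hop.transGen {σ : Type} {R : σ → σ → Prop} {K : σ → Prop} {U V : σ} (h : Hop R K U V) :
    Relation.TransGen R U V := by
  obtain ⟨z, hz, hV⟩ := h
  exact Relation.TransGen.tail' (Relation.ReflTransGen.mono (fun _ _ h => h.1) _ _ hz) hV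

/-! ### The orders given by the persistent paths -/

namespace ProofStructure

open ProofGraph Relation

variable {π : ProofStructure α} {e : π.E} {Ps : List (List π.Atom)}

theorem sim_and_iff_of_step (L : List π.Atom) (hL : ∀ U V, π.Step U V → Before L U V)
    {U V : π.Atom} : π.Sim U V ∧ Before L U V ↔ π.Step U V := by
  rw [sim_iff]
  refine ⟨fun ⟨h, h'⟩ => h.resolve_right fun h => ?_, fun h => ⟨.inl h, hL U V h⟩⟩
  exact lt_asymm h' (hL V U h)

theorem mem_edgeList {L : List π.Atom} (hL : ∀ U, U ∈ L) {U V : π.Atom} :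
    (V, U) ∈ π.edgeList L ↔ π.Sim U V ∧ Before L U V := by
  simp only [edgeList, List.mem_flatMap, List.mem_map, List.mem_filter, decide_eq_true_eq]
  constructor
  · rintro ⟨V', -, U', ⟨-, h⟩, h'⟩
    obtain ⟨rfl, rfl⟩ := Prod.mk.inj h'
    exact h
  · exact fun h => ⟨V, hL V, U, ⟨hL U, h⟩, rfl⟩

theorem nodup_edgeList {L : List π.Atom} (hL : L.Nodup) : (π.edgeList L).Nodup := by
  classical
  refine List.nodup_flatMap.2 ⟨fun V _ => ?_, hL.imp fun {V V'} hne => ?_⟩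
  · exact (hL.filter _).map fun U U' h => (Prod.mk.inj h).2
  · intro p hp hp'
    obtain ⟨U, -, rfl⟩ := List.mem_map.1 hp
    obtain ⟨U', -, h⟩ := List.mem_map.1 hp'
    exact hne (Prod.mk.inj h).1.symm

theorem isEdgeList_edgeList {L : List π.Atom} (hL : ∀ U, U ∈ L) :
    IsEdgeList (lexOrder L hL) π.Step (π.edgeList L) := fun V U => by
  rw [mem_edgeList hL, sim_iff, varLt_lexOrder]

theorem ideal_eq_span (k : Type v) [Field k] (B : Set (MvPolynomial π.Atom k))
    (hB : ∀ g, g ∈ B ↔ ∃ U V, π.Step U V ∧ g = X V - X U) : π.ideal k = Ideal.span B := by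
  refine le_antisymm (Ideal.span_le.2 ?_) (Ideal.span_le.2 fun g hg => ?_)
  · rintro _ ⟨U, V, h, rfl⟩
    rcases step_or_step_of_linked h with h | h
    · rw [← neg_sub]
      exact neg_mem (Ideal.subset_span ((hB _).2 ⟨U, V, h, rfl⟩))
    · exact Ideal.subset_span ((hB _).2 ⟨V, U, h, rfl⟩)
  · obtain ⟨U, V, h, rfl⟩ := (hB _).1 hg
    rcases sim_of_step h with h | h
    · rw [← neg_sub]
      exact neg_mem (Ideal.subset_span ⟨U, V, h, rfl⟩)
    · exact Ideal.subset_span ⟨V, U, h, rfl⟩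

theorem ne_of_transGen (hπ : Acyclic π.Step) {U V : π.Atom} (h : TransGen π.Step U V) :
    U ≠ V := by
  rintro rfl
  exact hπ U h

variable (he : π.IsSingleConclusion e) (hPs : π.IsPathList e Ps)
include he hPs

theorem before_order0 (hπ : Acyclic π.Step) {U V : π.Atom} (h : π.Step U V) :
    Before (order0 Ps) U V :=
  (Pre.flatten (fun P hP => pre_of_transGen he hπ (hPs.path P hP) (.single h))
    (hPs.cover V)).before (ne_of_transGen hπ (.single h))

theorem mem_generators_order0 (hπ : Acyclic π.Step) (k : Type v) [Field k]
    (g : MvPolynomial π.Atom k) :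
    g ∈ π.generators k (order0 Ps) ↔ ∃ U V, π.Step U V ∧ g = X V - X U := by
  have hstep : ∀ {U V}, (V, U) ∈ π.edgeList (order0 Ps) ↔ π.Step U V := fun {U V} =>
    (mem_edgeList hPs.mem_order0).trans
      (sim_and_iff_of_step _ fun _ _ => before_order0 he hPs hπ)
  rw [generators, List.mem_map]
  constructor
  · rintro ⟨⟨V, U⟩, h, rfl⟩
    exact ⟨U, V, hstep.1 h, rfl⟩
  · rintro ⟨U, V, h, rfl⟩
    exact ⟨(V, U), hstep.2 h, rfl⟩

theorem isMinimalGroebnerBasis_generators (hπ : Acyclic π.Step) (k : Type v) [Field k] :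
    IsMinimalGroebnerBasis (lexOrder (order0 Ps) hPs.mem_order0) (π.ideal k)
      {g | g ∈ π.generators k (order0 Ps)} :=
  isMinimalGroebnerBasis_differences π.Step
    (fun _ _ h => (varLt_lexOrder _).2 (before_order0 he hPs hπ h))
    (fun _ _ _ => step_left_unique) _ _ (mem_generators_order0 he hPs hπ k)
    (ideal_eq_span k _ (mem_generators_order0 he hPs hπ k))

theorem pre_flatten_filter (hπ : Acyclic π.Step) {p : π.Atom → Bool} {U V : π.Atom}
    (h : TransGen π.Step U V) (hU : p U) (hV : p V) : Pre (Ps.map (List.filter p)).flatten U V := by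
  refine Pre.flatten (fun L hL hVL => ?_) ?_
  · obtain ⟨P, hP, rfl⟩ := List.mem_map.1 hL
    exact (pre_of_transGen he hπ (hPs.path P hP) h (List.mem_of_mem_filter hVL)).filter hU
  · obtain ⟨P, hP, hVP⟩ := hPs.cover V
    exact ⟨_, List.mem_map_of_mem hP, List.mem_filter.2 ⟨hVP, hV⟩⟩

theorem nodup_flatten_filter (p : π.Atom → Bool) : (Ps.map (List.filter p)).flatten.Nodup := by
  refine List.nodup_flatten.2 ⟨fun L hL => ?_, ?_⟩
  · obtain ⟨P, hP, rfl⟩ := List.mem_map.1 hL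
    exact (hPs.path P hP).nodup.filter _
  · refine List.Pairwise.map _ (R := List.Disjoint) (fun P Q h U hU hU' => ?_)
      (pairwise_disjoint he hPs)
    exact h (List.mem_of_mem_filter hU) (List.mem_of_mem_filter hU')

omit he hPs in
theorem of_mem_flatten_filter {p : π.Atom → Bool} {U : π.Atom}
    (h : U ∈ (Ps.map (List.filter p)).flatten) : p U := by
  obtain ⟨L, hL, hU⟩ := List.mem_flatten.1 h
  obtain ⟨P, -, rfl⟩ := List.mem_map.1 hL
  exact (List.mem_filter.1 hU).2

theorem nodup_orderGamma {τ : Type} (f : τ → π.Atom) : (orderGamma f Ps).Nodup := by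
  classical
  refine (nodup_flatten_filter he hPs _).append (nodup_flatten_filter he hPs _) fun U hU hU' => ?_
  have h1 := of_mem_flatten_filter hU
  have h2 := of_mem_flatten_filter hU'
  simp only [decide_eq_true_eq] at h1 h2
  exact h2 h1

theorem pathOrder_orderGamma (hπ : Acyclic π.Step) {π' : ProofStructure α}
    {f : π'.Atom → π.Atom} (hf : IsCollapse f) :
    PathOrder (lexOrder (orderGamma f Ps) (hPs.mem_orderGamma f)) π.Step (· ∈ Set.range f) where
  right_unique := step_right_unique
  left_unique := step_left_unique
  lt_kept {U V} hU hV h := by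
    classical
    rw [varLt_lexOrder]
    exact ((pre_flatten_filter he hPs hπ h.transGen (by simpa using hU)
      (by simpa using hV)).append_right _).before (ne_of_transGen hπ h.transGen)
  lt_removed {U V} hU hV h := by
    classical
    rw [varLt_lexOrder]
    refine ((pre_flatten_filter he hPs hπ (.single h) (by simpa using hU)
      (by simpa using hV)).append_left fun h' => ?_).before (ne_of_transGen hπ (.single h))
    exact hV (by simpa using of_mem_flatten_filter h')
  lt_of_kept {U V} hU hV := by
    classical
    rw [varLt_lexOrder]
    obtain ⟨P, hP, hUP⟩ := hPs.cover U
    have hU' : U ∈ (Ps.map (List.filter fun U => decide (U ∈ Set.range f))).flatten :=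
      List.mem_flatten.2 ⟨_, List.mem_map_of_mem hP, List.mem_filter.2 ⟨hUP, by simpa using hU⟩⟩
    obtain ⟨l₁, l₂, h⟩ := List.append_of_mem hU'
    have hpre : Pre (Ps.map (List.filter fun U => decide (U ∈ Set.range f))).flatten U V := by
      refine ⟨l₁, l₂, h, fun hVl => hV ?_⟩
      have := of_mem_flatten_filter (h ▸ List.mem_append_left _ hVl)
      simpa using this
    refine (hpre.append_right _).before ?_
    rintro rfl
    exact hV hU
  exists_pred {V} hV := exists_step_to V fun _ hc => hV (hf.mem_range V hc)

end ProofStructure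

open ProofStructure ProofGraph in
theorem image_generators_eq (k : Type v) [Field k] {π π' : ProofStructure α}
    (hπ : Acyclic π.Step) (hπ' : Acyclic π'.Step) {e : π.E} (he : π.IsSingleConclusion e)
    {e' : π'.E} (he' : π'.IsSingleConclusion e') {Ps : List (List π.Atom)}
    (hPs : π.IsPathList e Ps) {Ps' : List (List π'.Atom)} (hPs' : π'.IsPathList e' Ps')
    {f : π'.Atom → π.Atom} (hf : IsCollapse f) :
    ∃ H, BuchbergerES (lexOrder (orderGamma f Ps) (hPs.mem_orderGamma f))
        (π.generators k (orderGamma f Ps)) H ∧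
      rename (R := k) f '' {g | g ∈ π'.generators k (order0 Ps')} =
        {h | h ∈ H} ∩ Set.range (rename (R := k) f) := by
  have hpath := pathOrder_orderGamma he hPs hπ hf
  have hedge := isEdgeList_edgeList (hPs.mem_orderGamma f)
  obtain ⟨A, hA, hmem⟩ := exists_buchbergerES (k := k) hpath hedge
    (nodup_edgeList (nodup_orderGamma he hPs f))
  refine ⟨_, hA, ?_⟩
  have hstep := fun U V => (hf.step_iff_hop
    (fun h h' => Hop.unique hpath ⟨_, rfl⟩ ⟨_, rfl⟩ h h') U V).trans
    (mem_output_iff hpath hedge hmem ⟨U, rfl⟩ ⟨V, rfl⟩).symm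
  ext g
  constructor
  · rintro ⟨g, hg, rfl⟩
    obtain ⟨U, V, h, rfl⟩ := (mem_generators_order0 he' hPs' hπ' k g).1 hg
    exact ⟨List.mem_map.2 ⟨_, (hstep U V).1 h, by simp⟩, _, rfl⟩
  · rintro ⟨hg, hg'⟩
    obtain ⟨⟨V, U⟩, hVU, rfl⟩ := List.mem_map.1 hg
    have hlt : VarLt (lexOrder (orderGamma f Ps) (hPs.mem_orderGamma f)) U V := by
      rcases List.mem_append.1 hVU with h | h
      · exact ((hedge V U).1 h).2
      · obtain ⟨z, hz⟩ := (hmem _).1 h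
        exact hz.lt hpath
    obtain ⟨⟨U, rfl⟩, V, rfl⟩ := (X_sub_X_mem_range_rename hlt.ne).1 hg'
    exact ⟨X V - X U, (mem_generators_order0 he' hPs' hπ' k _).2 ⟨U, V, (hstep U V).2 hVU, rfl⟩,
      by simp⟩

end MLL

theorem mainTheorem1 {α : Type*} (k : Type*) [Field k] {π π' : MLL.ProofStructure α}
    (hπ : π.IsProofNet) (hπ' : π'.IsProofNet)
    (e : π.E) (he : π.IsSingleConclusion e) (e' : π'.E) (he' : π'.IsSingleConclusion e')
    (Γ : MLL.ReductionSequence π π') :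
    (∃ Ps, π.IsPathList e Ps) ∧ (∃ Ps', π'.IsPathList e' Ps') ∧
    ∀ (Ps : List (List π.Atom)) (hPs : π.IsPathList e Ps)
      (Ps' : List (List π'.Atom)) (hPs' : π'.IsPathList e' Ps'),
      MLL.IsMinimalGroebnerBasis (MLL.lexOrder (MLL.order0 Ps') hPs'.mem_order0) (π'.ideal k)
          {g | g ∈ π'.generators k (MLL.order0 Ps')} ∧
      (∃ H, MLL.BuchbergerES
        (MLL.lexOrder (MLL.orderGamma Γ.atomMap Ps) (hPs.mem_orderGamma Γ.atomMap))
        (π.generators k (MLL.orderGamma Γ.atomMap Ps)) H) ∧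
      ∀ H, MLL.BuchbergerES
          (MLL.lexOrder (MLL.orderGamma Γ.atomMap Ps) (hPs.mem_orderGamma Γ.atomMap))
          (π.generators k (MLL.orderGamma Γ.atomMap Ps)) H →
        Γ.T k '' {g | g ∈ π'.generators k (MLL.order0 Ps')} =
          {h | h ∈ H} ∩ Set.range (Γ.T k) := by
  have ha := hπ.acyclic_step
  have ha' := hπ'.acyclic_step
  refine ⟨MLL.ProofStructure.exists_isPathList ha he, MLL.ProofStructure.exists_isPathList ha' he',
    fun Ps hPs Ps' hPs' =>
      ⟨MLL.ProofStructure.isMinimalGroebnerBasis_generators he' hPs' ha' k, ?_⟩⟩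
  obtain ⟨H, hH, heq⟩ := MLL.image_generators_eq k ha ha' he he' hPs hPs' Γ.isCollapse
  exact ⟨⟨H, hH⟩, fun H' hH' => hH'.unique hH ▸ heq⟩
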